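/- All logarithms are to base 2. For $n\in\mathbb N$ and $\varepsilon\in[-1,1]$, an $\varepsilon$-biased coin takes the value $1$ with probability $\frac{1+\varepsilon}{2}$ and $-1$ otherwise; let $\mathrm{Bin}(n,\varepsilon)$ be the distribution of the sum of $n$ independent $\varepsilon$-biased coins, and for $n\ge 1$ and $\delta\in[0,1]$ let $\mathrm{sBias}(n,\delta)$ be the $\varepsilon\in[-1,1]$ with $\Pr[\mathrm{Bin}(n,\varepsilon)\ge 0]=\delta$. For an integer $m\ge 2$ put $\mathrm{ms}(i)=\sum_{j=i}^{m}(m-j+1)^2$ (so $\mathrm{ms}(m+1)=0$). Fix $\varepsilon\in[-1,1]$ and $k\in\{1,\dots,m\}$. Let $f$ be the randomized function that, on input $(i,b,c)\in\{1,\dots,m\}\times\mathbb Z\times\mathbb Z$, computes $\delta=\Pr[\mathrm{Bin}(\mathrm{ms}(i+1),\varepsilon)\ge -b-c]$ and $\varepsilon'=\mathrm{sBias}(\mathrm{ms}(1),\delta)$, and returns a vector of $k\cdot\mathrm{ms}(1)$ independent $\varepsilon'$-biased coins. In the $m$-round online binomial game $G=G_{m,\varepsilon,f}$ with this vector hint,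 $C_1,\dots,C_m$ are independent with $C_i\sim\mathrm{Bin}((m-i+1)^2,\varepsilon)$, $S_i=C_1+\dots+C_i$ (so $S_0=0$), and $H_i=f(i,S_{i-1},C_i)$, where every call of $f$ uses fresh randomness. For $i\le m$ let $O_i=\delta_i(S_{i-1},H_i)$ and $O_i^-=\delta_i(S_{i-1})$, where $\delta_i(b,h)=\Pr[S_m\ge 0\mid S_{i-1}=b,H_i=h]$ and $\delta_i(b)=\Pr[S_m\ge 0\mid S_{i-1}=b]$; let $O_{m+1}=O_{m+1}^-$ be $1$ if $S_m\ge 0$ and $0$ otherwise. A player $B$ is an arbitrary (possibly randomized, history-dependent, computationally unbounded) algorithm that in round $i=1,\dots,m$ receives $(S_{i-1},H_i)$ and outputs a bit. Let $I$ be the first round in which $B$ outputs $1$, and $I=m+1$ if there is none. The bias of $G$ is $$\mathrm{bias}(G)=\sup_B\bigl|\mathbb E[O_I-O_I^-]\bigr|.$$ Then there is a universal constant $K>0$ such that, for all integers $m\ge 2$, all $k\in\{1,\dots,m\}$ with $k\le m/\log^6 m$, and all $\varepsilon\in[-1,1]$, $$\mathrm{bias}(G)\le K\cdot\frac{\sqrt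 k}{m}\cdot\sqrt{\log m}.$$ -/

import Mathlib

open scoped Classical in
/-- Probability of the event `A` under the weight function `p` on a finite sample space. -/
noncomputable def prob {Ω : Type*} [Fintype Ω] (p : Ω → ℝ) (A : Ω → Prop) : ℝ :=
  ∑ ω, if A ω then p ω else 0

/-- Conditional probability `Pr[A | B]`; it is only ever used at conditions `B` that hold at an
outcome of positive weight. -/
noncomputable def condProb {Ω : Type*} [Fintype Ω] (p : Ω → ℝ) (A B : Ω → Prop) : ℝ :=
  prob p (fun ω => A ω ∧ B ω) / prob p B

/-- The law of one `ε`-biased `±1` coin: `1` has probability `(1 + ε) / 2` and `-1` has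
probability `(1 - ε) / 2`. The set `{-1, 1}` is the group of units of `ℤ`. -/
noncomputable def coinProb (ε : ℝ) (x : ℤˣ) : ℝ := (1 + ε * ((x : ℤ) : ℝ)) / 2

/-- The law of a vector of independent `ε`-biased coins. -/
noncomputable def coinsProb {ι : Type*} [Fintype ι] (ε : ℝ) (v : ι → ℤˣ) : ℝ :=
  ∏ j, coinProb ε (v j)

/-- `Pr[X ≥ t]` for `X` the sum of `n` independent `ε`-biased coins. -/
noncomputable def binomTail (n : ℕ) (ε : ℝ) (t : ℤ) : ℝ :=
  prob (coinsProb ε) (fun v : Fin n → ℤˣ => t ≤ ∑ j, (v j : ℤ))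

/-- The `ε ∈ [-1, 1]` for which a sum of `n` independent `ε`-biased coins is nonnegative with
probability `δ`. For `1 ≤ n` and `δ ∈ [0, 1]` it exists, see `exists_binomTail_eq`. -/
noncomputable def signBias (n : ℕ) (δ : ℝ) : ℝ :=
  open scoped Classical in
  if h : ∃ ε ∈ Set.Icc (-1 : ℝ) 1, binomTail n ε 0 = δ then h.choose else 0

/-- The number of coins tossed in round `i`, where `1 ≤ i ≤ m`. -/
def roundSize (m i : ℕ) : ℕ := (m + 1 - i) ^ 2

/-- The number of coins tossed in rounds `i, …, m` together. -/
def remSize (m i : ℕ) : ℕ := ∑ j ∈ Finset.Icc i m, roundSize m j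

/-- A randomized function on `[m] × ℤ × ℤ` with values in the finite set `H`, given by its output
probabilities: `f i b c h` is the probability that the output on `(i + 1, b, c)` is `h`.
(An index `i : Fin m` always stands for round `i + 1`.) -/
abbrev HintFunction (m : ℕ) (H : Type) : Type := Fin m → ℤ → ℤ → H → ℝ

/-- The vector hint: on input `(i, b, c)`, it returns a vector of `l` independent `ε'`-biased coins,
where `ε'` is the bias with which a sum of `remSize m 1` coins is nonnegative with the probability
`δ` that `b + c` plus the coins of the rounds after `i` is nonnegative. -/
noncomputable def vectorHint (m : ℕ) (ε : ℝ) (l : ℕ) : HintFunction m (Fin l → ℤˣ) :=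
  fun i b c h =>
    coinsProb (signBias (remSize m 1) (binomTail (remSize m ((i : ℕ) + 2)) ε (-b - c))) h

/-- The outcomes of the `m`-round game: all coins of all rounds, and all hints. -/
abbrev Outcome (m : ℕ) (H : Type) : Type :=
  ((i : Fin m) → Fin (roundSize m ((i : ℕ) + 1)) → ℤˣ) × (Fin m → H)

/-- The round's coins `C_{i+1}`: the sum of the coins tossed in the round. -/
def roundCoins {m : ℕ} {H : Type} (ω : Outcome m H) (i : Fin m) : ℤ := ∑ j, (ω.1 i j : ℤ)

/-- `S_t = C_1 + ⋯ + C_t`. -/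
def partialSum {m : ℕ} {H : Type} (ω : Outcome m H) (t : ℕ) : ℤ :=
  ∑ i : Fin m, if (i : ℕ) < t then roundCoins ω i else 0

section Game

variable {m : ℕ} {H : Type} [Fintype H] (ε : ℝ) (f : HintFunction m H)

/-- The law of the online binomial game: all coins are independent and `ε`-biased and, given the
coins, the hints `H_i = f(i, S_{i-1}, C_i)` are drawn independently. -/
noncomputable def gameProb (ω : Outcome m H) : ℝ :=
  (∏ i, coinsProb ε (ω.1 i)) * ∏ i : Fin m, f i (partialSum ω i) (roundCoins ω i) (ω.2 i)

/-- `Pr[S_m ≥ 0 | S_{i-1} = b]`. -/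
noncomputable def gameValue (i : Fin m) (b : ℤ) : ℝ :=
  condProb (gameProb ε f) (fun ω => 0 ≤ partialSum ω m) (fun ω => partialSum ω i = b)

/-- `Pr[S_m ≥ 0 | S_{i-1} = b, H_i = h]`. -/
noncomputable def gameValueHint (i : Fin m) (b : ℤ) (h : H) : ℝ :=
  condProb (gameProb ε f) (fun ω => 0 ≤ partialSum ω m)
    (fun ω => partialSum ω i = b ∧ ω.2 i = h)

/-- A (randomized, history dependent, computationally unbounded) algorithm: from the inputs
`(S_{j-1}, H_j)` of the rounds `j ≤ i`, the probability that it outputs `1` in round `i`, given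
that it has output only `0` before. -/
abbrev Player (m : ℕ) (H : Type) : Type := (i : Fin m) → (Set.Iic i → ℤ × H) → unitInterval

/-- The probability that the player outputs `1` in the given round, at the outcome `ω`, if it has
output only `0` before. -/
noncomputable def abortProb (B : Player m H) (ω : Outcome m H) (i : Fin m) : ℝ :=
  (B i (fun j => (partialSum ω (j : Fin m), ω.2 j)) : ℝ)

/-- The expectation, over the player's randomness, of `X_I` at the outcome `ω`. Here `I` is the
first round in which the player outputs `1`, and `I = m + 1` if there is none;
`X_{m+1}` is `1` if `S_m ≥ 0` and `0` otherwise. -/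
noncomputable def stoppedValue (B : Player m H) (X : Fin m → ℝ) (ω : Outcome m H) : ℝ :=
  (∑ i, (∏ j ∈ Finset.Iio i, (1 - abortProb B ω j)) * abortProb B ω i * X i) +
    (∏ j, (1 - abortProb B ω j)) * (if 0 ≤ partialSum ω m then 1 else 0)

/-- The bias gained by a player: `|E[O_I - O_I⁻]|`, where `O_i = Pr[S_m ≥ 0 | S_{i-1}, H_i]` and
`O_i⁻ = Pr[S_m ≥ 0 | S_{i-1}]`. -/
noncomputable def playerBias (B : Player m H) : ℝ :=
  |∑ ω, gameProb ε f ω *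
    (stoppedValue B (fun i => gameValueHint ε f i (partialSum ω i) (ω.2 i)) ω -
      stoppedValue B (fun i => gameValue ε f i (partialSum ω i)) ω)|

/-- The bias of the game: the supremum over all players. -/
noncomputable def gameBias : ℝ := ⨆ B : Player m H, playerBias ε f B

/-- The supremum in `gameBias` is over a bounded set. -/
theorem bddAbove_playerBias : BddAbove (Set.range (playerBias ε f)) := by
  refine ⟨∑ ω, |gameProb ε f ω| * ∑ i, |gameValueHint ε f i (partialSum ω i) (ω.2 i) -
    gameValue ε f i (partialSum ω i)|, ?_⟩
  rintro _ ⟨B, rfl⟩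
  refine (Finset.abs_sum_le_sum_abs _ _).trans (Finset.sum_le_sum fun ω _ => ?_)
  rw [abs_mul]
  refine mul_le_mul_of_nonneg_left ?_ (abs_nonneg _)
  have h0 : ∀ j, 0 ≤ abortProb B ω j := fun j => (B j _).2.1
  have h1 : ∀ j, abortProb B ω j ≤ 1 := fun j => (B j _).2.2
  unfold stoppedValue
  rw [add_sub_add_right_eq_sub, ← Finset.sum_sub_distrib]
  refine (Finset.abs_sum_le_sum_abs _ _).trans (Finset.sum_le_sum fun i _ => ?_)
  rw [← mul_sub, abs_mul]
  have hp0 : 0 ≤ ∏ j ∈ Finset.Iio i, (1 - abortProb B ω j) :=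
    Finset.prod_nonneg fun j _ => by linarith [h1 j]
  have hp1 : ∏ j ∈ Finset.Iio i, (1 - abortProb B ω j) ≤ 1 :=
    Finset.prod_le_one (fun j _ => by linarith [h1 j]) fun j _ => by linarith [h0 j]
  rw [abs_of_nonneg (mul_nonneg hp0 (h0 i))]
  exact mul_le_of_le_one_left (abs_nonneg _) (mul_le_one₀ hp1 (h0 i) (h1 i))

end Game

theorem coinProb_nonneg {ε : ℝ} (hε : ε ∈ Set.Icc (-1 : ℝ) 1) (x : ℤˣ) : 0 ≤ coinProb ε x := by
  obtain ⟨h1, h2⟩ := hε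
  rcases Int.units_eq_one_or x with rfl | rfl <;> simp [coinProb] <;> linarith

theorem sum_coinProb (ε : ℝ) : ∑ x, coinProb ε x = 1 := by
  have h : (Finset.univ : Finset ℤˣ) = {1, -1} := by decide
  rw [h, Finset.sum_pair (by decide)]
  simp [coinProb]
  ring

/-- `coinsProb ε` is a probability distribution. -/
theorem sum_coinsProb {ι : Type*} [Fintype ι] [DecidableEq ι] (ε : ℝ) :
    ∑ v : ι → ℤˣ, coinsProb ε v = 1 := by
  simp only [coinsProb]
  rw [← Fintype.prod_sum (fun (_ : ι) x => coinProb ε x)]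
  simp only [sum_coinProb, Finset.prod_const_one]

/-- The bias in the definition of `signBias` exists. -/
theorem exists_binomTail_eq {n : ℕ} (hn : 1 ≤ n) {δ : ℝ} (hδ : δ ∈ Set.Icc (0 : ℝ) 1) :
    ∃ ε ∈ Set.Icc (-1 : ℝ) 1, binomTail n ε 0 = δ := by
  have hcont : Continuous fun ε : ℝ => binomTail n ε 0 := by
    unfold binomTail prob coinsProb coinProb
    refine continuous_finsetSum _ fun v _ => ?_
    split_ifs <;> fun_prop
  have hm : binomTail n (-1) 0 = 0 := by
    unfold binomTail prob
    refine Finset.sum_eq_zero fun v _ => ?_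
    split_ifs with hv
    · by_contra hne
      have hall : ∀ j, v j = -1 := fun j => by
        rcases Int.units_eq_one_or (v j) with h | h
        · exact absurd (Finset.prod_eq_zero (Finset.mem_univ j) (by simp [coinProb, h])) hne
        · exact h
      simp [hall] at hv
      omega
    · rfl
  have hp : binomTail n 1 0 = 1 := by
    refine Eq.trans ?_ (sum_coinsProb (ι := Fin n) 1)
    unfold binomTail prob
    refine Finset.sum_congr rfl fun v _ => ?_
    split_ifs with hv
    · rfl
    · by_contra hne
      have hall : ∀ j, v j = 1 := fun j => by
        rcases Int.units_eq_one_or (v j) with h | h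
        · exact h
        · exact absurd (Finset.prod_eq_zero (Finset.mem_univ j) (by simp [coinProb, h])).symm hne
      simp [hall] at hv
  have := intermediate_value_Icc (by norm_num : (-1 : ℝ) ≤ 1) hcont.continuousOn
  rw [hm, hp] at this
  obtain ⟨ε, hε, h⟩ := this hδ
  exact ⟨ε, hε, h⟩

/-! Let `n` be the number of rounds left, the current one included. The round tosses `n ^ 2` coins,
about `n ^ 3 / 3` coins follow, and σ = `n ^ (3 / 2)` is the scale of the remaining sum. Let `Y` be
the expected final sum given the earlier coins, s = 1 + |Y| / σ, `N` the total number of coins, and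
`L` = log₂ m.

One round. The gain in a round is the posterior minus the prior mean of the winning probability V(v)
as a function of the round's coins v, given a hint with likelihood q(v). Times the normaliser, it is
half the average over independent pairs v, w of (q(v) - q(w)) (V(v) - V(w)): a product of two
sensitivities, and only the variance `n ^ 2` of the round's coins enters
(`posterior_sub_prior_le_of_lipschitz`). V has slope O(1 / (σ s³)). The bias of the hint coins has
slope O(s / (σ √N)), even far from the mean, because the factor V (1 - V) in the point masses of the
remaining coins cancels against the same factor in the derivative of a tail in the bias
(`hintBias_step`). A shift d of the bias changes the likelihood of a typical vector of kN coins by a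
relative O(√(kN) d √L) (`coinsProb_ratio`). Altogether the gain is O(√L √k / (n s²)), up to events
of probability exp(-2L) ≤ 1 / m² (`observationBound_main_of_near`). The likelihood ratios stay
bounded only if n ≥ k L³; for L < n ≤ k L³ the oscillation of V alone gives O(√L / (√n s²)), and for
n ≤ L the gain is at most 1, and negligible unless |Y| < 8 σ √L.

All rounds. By `playerBias_le` it remains to bound the expected weight at the round where the player
stops. The factor 1 / s² is dominated by a bump in `Y`. Over the next n / 2 rounds `Y` moves by only
O(σ), so the expected bump stays comparable to the present one, and a stop is paid for by the
average of the bumps of these rounds. As the stopping probabilities sum to at most one, the whole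
bias is at most a sum over rounds of weight / n times the mean bump (`sum_stopProb_bump_le`), in
which the player no longer occurs. The mean bump is O((n / m) ^ (3 / 2)), since the sum so far is
spread over a scale `m ^ (3 / 2)`. Summing gives √k m^(-3/2) Σ n^(-1/2) = O(√k / m), plus k L³
m^(-3/2) ≤ √k / m from the middle rounds because k L⁶ ≤ m (`sum_bumpWeight_le`). The last L rounds
contribute L · L² m^(-3/2) ≤ 1 / m by a union bound.

If |ε| > 1/2, the result is almost surely never in doubt; for bounded m the trivial bound 1
suffices. -/

/-! ### Expectations over sums of coins and Hoeffding's inequality -/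

/-- The expectation of `g (X)` for `X` the sum of `n` independent `ε`-biased coins. -/
noncomputable def coinExp (ε : ℝ) (n : ℕ) (g : ℤ → ℝ) : ℝ :=
  ∑ v : Fin n → ℤˣ, coinsProb ε v * g (∑ j, (v j : ℤ))

theorem coinsProb_nonneg {ι : Type*} [Fintype ι] {ε : ℝ} (hε : ε ∈ Set.Icc (-1 : ℝ) 1)
    (v : ι → ℤˣ) : 0 ≤ coinsProb ε v :=
  Finset.prod_nonneg fun _ _ => coinProb_nonneg hε _

theorem coinExp_zero (ε : ℝ) (g : ℤ → ℝ) : coinExp ε 0 g = g 0 := by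
  simp [coinExp, coinsProb]

theorem coinExp_succ (ε : ℝ) (n : ℕ) (g : ℤ → ℝ) :
    coinExp ε (n + 1) g = (1 + ε) / 2 * coinExp ε n (fun x => g (1 + x)) +
      (1 - ε) / 2 * coinExp ε n (fun x => g (-1 + x)) := by
  have h : (Finset.univ : Finset ℤˣ) = {1, -1} := by decide
  unfold coinExp
  rw [← (Fin.consEquiv fun _ : Fin (n + 1) => ℤˣ).sum_comp, Fintype.sum_prod_type, h,
    Finset.sum_pair (by decide), Finset.mul_sum, Finset.mul_sum]
  congr 1 <;> refine Finset.sum_congr rfl fun v _ => ?_ <;>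
    simp [coinsProb, coinProb, Fin.consEquiv, Fin.prod_univ_succ, Fin.sum_univ_succ] <;> ring

theorem coinExp_const (ε : ℝ) (n : ℕ) (a : ℝ) : coinExp ε n (fun _ => a) = a := by
  unfold coinExp
  rw [← Finset.sum_mul, sum_coinsProb, one_mul]

theorem coinExp_add_fun (ε : ℝ) (n : ℕ) (g h : ℤ → ℝ) :
    coinExp ε n (fun x => g x + h x) = coinExp ε n g + coinExp ε n h := by
  simp [coinExp, mul_add, Finset.sum_add_distrib]

theorem coinExp_sub_fun (ε : ℝ) (n : ℕ) (g h : ℤ → ℝ) :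
    coinExp ε n (fun x => g x - h x) = coinExp ε n g - coinExp ε n h := by
  simp [coinExp, mul_sub, Finset.sum_sub_distrib]

theorem coinExp_const_mul (ε : ℝ) (n : ℕ) (a : ℝ) (g : ℤ → ℝ) :
    coinExp ε n (fun x => a * g x) = a * coinExp ε n g := by
  simp only [coinExp, Finset.mul_sum]
  exact Finset.sum_congr rfl fun v _ => by ring

theorem coinExp_sum {α : Type*} (s : Finset α) (ε : ℝ) (n : ℕ) (g : α → ℤ → ℝ) :
    coinExp ε n (fun x => ∑ a ∈ s, g a x) = ∑ a ∈ s, coinExp ε n (g a) := by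
  simp only [coinExp, Finset.mul_sum]
  exact Finset.sum_comm

theorem coinExp_mono {ε : ℝ} (hε : ε ∈ Set.Icc (-1 : ℝ) 1) (n : ℕ) {g h : ℤ → ℝ}
    (hgh : ∀ x, g x ≤ h x) : coinExp ε n g ≤ coinExp ε n h :=
  Finset.sum_le_sum fun v _ => mul_le_mul_of_nonneg_left (hgh _) (coinsProb_nonneg hε v)

theorem coinExp_nonneg {ε : ℝ} (hε : ε ∈ Set.Icc (-1 : ℝ) 1) (n : ℕ) {g : ℤ → ℝ}
    (hg : ∀ x, 0 ≤ g x) : 0 ≤ coinExp ε n g :=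
  Finset.sum_nonneg fun v _ => mul_nonneg (coinsProb_nonneg hε v) (hg _)

theorem coinExp_add (ε : ℝ) (n k : ℕ) (g : ℤ → ℝ) :
    coinExp ε (n + k) g = coinExp ε n (fun a => coinExp ε k fun b => g (a + b)) := by
  induction n generalizing g with
  | zero => simp [coinExp_zero]
  | succ n ih =>
    rw [Nat.succ_add, coinExp_succ, ih, ih, coinExp_succ]
    simp only [add_assoc]

theorem coinExp_neg (ε : ℝ) (n : ℕ) (g : ℤ → ℝ) :
    coinExp (-ε) n g = coinExp ε n (fun x => g (-x)) := by
  induction n generalizing g with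
  | zero => simp [coinExp_zero]
  | succ n ih =>
    rw [coinExp_succ, coinExp_succ, ih, ih, add_comm]
    congr 1
    · congr 1
      · ring
      · congr 1; funext x; congr 1; ring
    · congr 1
      congr 1; funext x; congr 1; ring

/-- The second moment of a sum of coins around an arbitrary point. -/
theorem coinExp_sq (ε : ℝ) (n : ℕ) (a : ℝ) :
    coinExp ε n (fun x => ((x : ℝ) - ε * n + a) ^ 2) = n * (1 - ε ^ 2) + a ^ 2 := by
  induction n generalizing a with
  | zero => simp [coinExp_zero]
  | succ n ih =>
    have h1 : (fun x : ℤ => (((1 + x : ℤ) : ℝ) - ε * ((n + 1 : ℕ) : ℝ) + a) ^ 2) =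
        fun x : ℤ => ((x : ℝ) - ε * n + (1 - ε + a)) ^ 2 := by
      funext x; push_cast; ring
    have h2 : (fun x : ℤ => (((-1 + x : ℤ) : ℝ) - ε * ((n + 1 : ℕ) : ℝ) + a) ^ 2) =
        fun x : ℤ => ((x : ℝ) - ε * n + (-1 - ε + a)) ^ 2 := by
      funext x; push_cast; ring
    rw [coinExp_succ, h1, h2, ih, ih]
    push_cast
    ring

/-- An elementary Hoeffding lemma with a non-optimal constant. The centred coin has mean zero, so
its moment generating function at `-t` is at least one; multiplying by it symmetrises the coin and
leaves p² + q² + 2pq cosh(2t). -/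
theorem coin_mgf_le {ε : ℝ} (hε : ε ∈ Set.Icc (-1 : ℝ) 1) (t : ℝ) :
    (1 + ε) / 2 * Real.exp (t * (1 - ε)) + (1 - ε) / 2 * Real.exp (t * (-1 - ε)) ≤
      Real.exp (2 * t ^ 2) := by
  obtain ⟨h1, h2⟩ := hε
  set p := (1 + ε) / 2 with hp
  set q := (1 - ε) / 2 with hq
  have hp0 : 0 ≤ p := by rw [hp]; linarith
  have hq0 : 0 ≤ q := by rw [hq]; linarith
  have hpq : p + q = 1 := by rw [hp, hq]; ring
  set A := Real.exp (t * (1 - ε)) with hA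
  set B := Real.exp (t * (-1 - ε)) with hB
  have hA0 : 0 < A := Real.exp_pos _
  have hB0 : 0 < B := Real.exp_pos _
  have hA' : A⁻¹ = Real.exp (-(t * (1 - ε))) := by rw [hA, Real.exp_neg]
  have hB' : B⁻¹ = Real.exp (-(t * (-1 - ε))) := by rw [hB, Real.exp_neg]
  have hJ : 1 ≤ p * A⁻¹ + q * B⁻¹ := by
    have e1 := Real.add_one_le_exp (-(t * (1 - ε)))
    have e2 := Real.add_one_le_exp (-(t * (-1 - ε)))
    rw [hA', hB']
    have : p * (-(t * (1 - ε)) + 1) + q * (-(t * (-1 - ε)) + 1) = 1 := by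
      rw [hp, hq]; ring
    nlinarith [mul_le_mul_of_nonneg_left e1 hp0, mul_le_mul_of_nonneg_left e2 hq0]
  have hcosh : A * B⁻¹ + B * A⁻¹ ≤ 2 * Real.exp (2 * t ^ 2) := by
    have := Real.cosh_le_exp_half_sq (2 * t)
    rw [Real.cosh_eq] at this
    have e1 : A * B⁻¹ = Real.exp (2 * t) := by
      rw [hB', hA, ← Real.exp_add]; congr 1; ring
    have e2 : B * A⁻¹ = Real.exp (-(2 * t)) := by
      rw [hA', hB, ← Real.exp_add]; congr 1; ring
    rw [e1, e2]
    have e3 : (2 * t) ^ 2 / 2 = 2 * t ^ 2 := by ring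
    rw [e3] at this
    linarith
  have hone : 1 ≤ Real.exp (2 * t ^ 2) := Real.one_le_exp (by positivity)
  have hsum : (p * A + q * B) * (p * A⁻¹ + q * B⁻¹) =
      p ^ 2 + q ^ 2 + p * q * (A * B⁻¹ + B * A⁻¹) := by
    field_simp
    ring
  calc p * A + q * B ≤ (p * A + q * B) * (p * A⁻¹ + q * B⁻¹) :=
        le_mul_of_one_le_right (by positivity) hJ
    _ = p ^ 2 + q ^ 2 + p * q * (A * B⁻¹ + B * A⁻¹) := hsum
    _ ≤ p ^ 2 + q ^ 2 + p * q * (2 * Real.exp (2 * t ^ 2)) := by gcongr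
    _ ≤ (p ^ 2 + q ^ 2) * Real.exp (2 * t ^ 2) + p * q * (2 * Real.exp (2 * t ^ 2)) := by
        have := le_mul_of_one_le_right (by positivity : 0 ≤ p ^ 2 + q ^ 2) hone
        linarith
    _ = (p + q) ^ 2 * Real.exp (2 * t ^ 2) := by ring
    _ = Real.exp (2 * t ^ 2) := by rw [hpq]; ring

theorem coinExp_exp_le {ε : ℝ} (hε : ε ∈ Set.Icc (-1 : ℝ) 1) (n : ℕ) (t : ℝ) :
    coinExp ε n (fun x => Real.exp (t * ((x : ℝ) - ε * n))) ≤ Real.exp (2 * t ^ 2 * n) := by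
  induction n with
  | zero => simp [coinExp_zero]
  | succ n ih =>
    have h1 : (fun x : ℤ => Real.exp (t * (((1 + x : ℤ) : ℝ) - ε * ((n + 1 : ℕ) : ℝ)))) =
        fun x : ℤ => Real.exp (t * (1 - ε)) * Real.exp (t * ((x : ℝ) - ε * n)) := by
      funext x; rw [← Real.exp_add]; congr 1; push_cast; ring
    have h2 : (fun x : ℤ => Real.exp (t * (((-1 + x : ℤ) : ℝ) - ε * ((n + 1 : ℕ) : ℝ)))) =
        fun x : ℤ => Real.exp (t * (-1 - ε)) * Real.exp (t * ((x : ℝ) - ε * n)) := by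
      funext x; rw [← Real.exp_add]; congr 1; push_cast; ring
    rw [coinExp_succ, h1, h2, coinExp_const_mul, coinExp_const_mul, ← mul_assoc, ← mul_assoc,
      ← add_mul]
    have h3 : Real.exp (2 * t ^ 2 * ((n + 1 : ℕ) : ℝ)) =
        Real.exp (2 * t ^ 2) * Real.exp (2 * t ^ 2 * n) := by
      rw [← Real.exp_add]; congr 1; push_cast; ring
    rw [h3]
    exact mul_le_mul (coin_mgf_le hε t) ih (coinExp_nonneg hε n fun _ => (Real.exp_pos _).le)
      (Real.exp_pos _).le

open scoped Classical in
/-- Hoeffding's inequality for the upper tail. -/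
theorem coinExp_upper_tail_le {ε : ℝ} (hε : ε ∈ Set.Icc (-1 : ℝ) 1) (n : ℕ) {u s : ℝ}
    (hu : 0 ≤ u) (hs : 0 < s) (hn : (n : ℝ) ≤ s) :
    coinExp ε n (fun x => if u ≤ (x : ℝ) - ε * n then 1 else 0) ≤
      Real.exp (-(u ^ 2 / (8 * s))) := by
  -- This `t` minimises `-t * u + 2 * t ^ 2 * s`.
  set t := u / (4 * s) with ht
  have ht0 : 0 ≤ t := by positivity
  have h1 : coinExp ε n (fun x => if u ≤ (x : ℝ) - ε * n then 1 else 0) ≤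
      coinExp ε n (fun x => Real.exp (-(t * u)) * Real.exp (t * ((x : ℝ) - ε * n))) := by
    refine coinExp_mono hε n fun x => ?_
    rw [← Real.exp_add]
    split_ifs with h
    · apply Real.one_le_exp
      nlinarith
    · exact (Real.exp_pos _).le
  refine h1.trans ?_
  rw [coinExp_const_mul]
  refine (mul_le_mul_of_nonneg_left (coinExp_exp_le hε n t) (Real.exp_pos _).le).trans ?_
  rw [← Real.exp_add]
  apply Real.exp_le_exp.mpr
  have h2 : 2 * t ^ 2 * n ≤ 2 * t ^ 2 * s := by gcongr
  have h3 : -(t * u) + 2 * t ^ 2 * s = -(u ^ 2 / (8 * s)) := by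
    rw [ht]; field_simp; ring
  linarith

open scoped Classical in
theorem coinExp_lower_tail_le {ε : ℝ} (hε : ε ∈ Set.Icc (-1 : ℝ) 1) (n : ℕ) {u s : ℝ}
    (hu : 0 ≤ u) (hs : 0 < s) (hn : (n : ℝ) ≤ s) :
    coinExp ε n (fun x => if (x : ℝ) - ε * n ≤ -u then 1 else 0) ≤
      Real.exp (-(u ^ 2 / (8 * s))) := by
  have h := coinExp_upper_tail_le (ε := -ε) ⟨by linarith [hε.2], by linarith [hε.1]⟩ n hu hs hn
  rw [coinExp_neg] at h
  refine le_of_eq_of_le ?_ h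
  congr 1
  funext x
  refine if_congr ?_ rfl rfl
  push_cast
  constructor <;> intro h <;> linarith

open scoped Classical in
/-- Hoeffding's inequality. -/
theorem coinExp_abs_tail_le {ε : ℝ} (hε : ε ∈ Set.Icc (-1 : ℝ) 1) (n : ℕ) {u s : ℝ}
    (hu : 0 ≤ u) (hs : 0 < s) (hn : (n : ℝ) ≤ s) :
    coinExp ε n (fun x => if u ≤ |(x : ℝ) - ε * n| then 1 else 0) ≤
      2 * Real.exp (-(u ^ 2 / (8 * s))) := by
  refine (coinExp_mono hε n (h := fun x => (if u ≤ (x : ℝ) - ε * n then 1 else 0) +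
    (if (x : ℝ) - ε * n ≤ -u then 1 else 0)) fun x => ?_).trans ?_
  · by_cases h : u ≤ |(x : ℝ) - ε * n|
    · rw [if_pos h]
      rcases le_abs.mp h with h | h
      · rw [if_pos h]; split_ifs <;> norm_num
      · rw [if_pos (by linarith : (x : ℝ) - ε * n ≤ -u)]; split_ifs <;> norm_num
    · rw [if_neg h]; split_ifs <;> norm_num
  · rw [coinExp_add_fun]
    linarith [coinExp_upper_tail_le hε n hu hs hn, coinExp_lower_tail_le hε n hu hs hn]

open scoped Classical in
theorem binomTail_eq_coinExp (n : ℕ) (ε : ℝ) (t : ℤ) :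
    binomTail n ε t = coinExp ε n (fun x => if t ≤ x then 1 else 0) := by
  unfold binomTail prob coinExp
  refine Finset.sum_congr rfl fun v _ => ?_
  by_cases h : t ≤ ∑ j, (v j : ℤ)
  · simp [h]
  · simp [h]

/-! ### Point probabilities and tails of binomial distributions -/

/-- The probability that the sum of `n` independent `ε`-biased coins is `t`. -/
noncomputable def binomPmf (n : ℕ) (ε : ℝ) (t : ℤ) : ℝ :=
  coinExp ε n (fun x => if x = t then 1 else 0)

theorem binomPmf_nonneg {ε : ℝ} (hε : ε ∈ Set.Icc (-1 : ℝ) 1) (n : ℕ) (t : ℤ) :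
    0 ≤ binomPmf n ε t :=
  coinExp_nonneg hε n fun _ => by split_ifs <;> norm_num

theorem binomTail_nonneg {ε : ℝ} (hε : ε ∈ Set.Icc (-1 : ℝ) 1) (n : ℕ) (t : ℤ) :
    0 ≤ binomTail n ε t := by
  rw [binomTail_eq_coinExp]
  exact coinExp_nonneg hε n fun _ => by split_ifs <;> norm_num

theorem binomTail_le_one {ε : ℝ} (hε : ε ∈ Set.Icc (-1 : ℝ) 1) (n : ℕ) (t : ℤ) :
    binomTail n ε t ≤ 1 := by
  rw [binomTail_eq_coinExp]
  refine (coinExp_mono hε n (h := fun _ => 1) fun _ => ?_).trans_eq (coinExp_const ε n 1)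
  split_ifs <;> norm_num

theorem binomTail_antitone {ε : ℝ} (hε : ε ∈ Set.Icc (-1 : ℝ) 1) (n : ℕ) :
    Antitone (binomTail n ε) := by
  intro s t hst
  rw [binomTail_eq_coinExp, binomTail_eq_coinExp]
  refine coinExp_mono hε n fun x => ?_
  by_cases h : t ≤ x
  · rw [if_pos h, if_pos (hst.trans h)]
  · rw [if_neg h]; split_ifs <;> norm_num

theorem binomTail_eq_add (n : ℕ) (ε : ℝ) (t : ℤ) :
    binomTail n ε t = binomTail n ε (t + 1) + binomPmf n ε t := by
  rw [binomTail_eq_coinExp, binomTail_eq_coinExp, binomPmf, ← coinExp_add_fun]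
  congr 1
  funext x
  rcases lt_trichotomy x t with h | h | h
  · simp [h.ne, not_le.mpr h, not_le.mpr (h.trans (lt_add_one t))]
  · simp [h]
  · simp [h.le, h.ne', Int.add_one_le_iff.mpr h]

theorem one_sub_binomTail (n : ℕ) (ε : ℝ) (t : ℤ) :
    1 - binomTail n ε t = binomTail n (-ε) (1 - t) := by
  rw [sub_eq_iff_eq_add, binomTail_eq_coinExp, binomTail_eq_coinExp, coinExp_neg,
    ← coinExp_add_fun]
  refine (coinExp_const ε n 1).symm.trans ?_
  congr 1
  funext x
  by_cases h : t ≤ x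
  · rw [if_pos h, if_neg (by omega)]; norm_num
  · rw [if_neg h, if_pos (by omega)]; norm_num

theorem binomPmf_neg (n : ℕ) (ε : ℝ) (t : ℤ) : binomPmf n (-ε) t = binomPmf n ε (-t) := by
  rw [binomPmf, coinExp_neg, binomPmf]
  congr 1
  funext x
  exact if_congr ⟨fun h => by omega, fun h => by omega⟩ rfl rfl

theorem binomPmf_succ (n : ℕ) (ε : ℝ) (t : ℤ) :
    binomPmf (n + 1) ε t =
      (1 + ε) / 2 * binomPmf n ε (t - 1) + (1 - ε) / 2 * binomPmf n ε (t + 1) := by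
  rw [binomPmf, coinExp_succ]
  congr 2 <;> rw [binomPmf] <;> congr 1 <;> funext x <;>
    exact if_congr ⟨fun h => by omega, fun h => by omega⟩ rfl rfl

theorem binomPmf_zero (ε : ℝ) (t : ℤ) : binomPmf 0 ε t = if t = 0 then 1 else 0 := by
  rw [binomPmf, coinExp_zero]
  exact if_congr eq_comm rfl rfl

theorem coinExp_eq_sum_binomPmf {ι : Type*} (s : Finset ι) (n : ℕ) (ε : ℝ) (g : ℤ → ℝ)
    (a : ι → ℤ) (ha : Function.Injective a) (hg : ∀ x, x ∉ a '' s → g x = 0) :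
    coinExp ε n g = ∑ i ∈ s, binomPmf n ε (a i) * g (a i) := by
  classical
  have : g = fun x => ∑ i ∈ s, (g (a i)) * (if x = a i then 1 else 0) := by
    funext x
    by_cases hx : x ∈ a '' s
    · obtain ⟨i, hi, rfl⟩ := hx
      rw [Finset.sum_eq_single i]
      · simp
      · intro j _ hj
        rw [if_neg (fun h => hj (ha h).symm), mul_zero]
      · exact fun h => absurd hi h
    · rw [hg x hx, Finset.sum_eq_zero]
      intro i hi
      rw [if_neg, mul_zero]
      rintro rfl
      exact hx ⟨i, hi, rfl⟩
  conv_lhs => rw [this]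
  rw [coinExp_sum]
  exact Finset.sum_congr rfl fun i _ => by rw [coinExp_const_mul, binomPmf, mul_comm]

theorem sum_binomPmf_le_binomTail {ε : ℝ} (hε : ε ∈ Set.Icc (-1 : ℝ) 1) (n : ℕ) (t : ℤ)
    (J : ℕ) : ∑ j ∈ Finset.range J, binomPmf n ε (t + 2 * j) ≤ binomTail n ε t := by
  simp only [binomPmf]
  rw [← coinExp_sum, binomTail_eq_coinExp]
  refine coinExp_mono hε n fun x => ?_
  rw [Finset.sum_ite, Finset.sum_const_zero, add_zero, Finset.sum_const, nsmul_one]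
  split_ifs with h
  · have : (Finset.filter (fun j : ℕ => x = t + 2 * (j : ℤ)) (Finset.range J)).card ≤ 1 := by
      rw [Finset.card_le_one]
      intro a ha b hb
      simp only [Finset.mem_filter] at ha hb
      omega
    exact_mod_cast this
  · rw [Finset.filter_eq_empty_iff.mpr, Finset.card_empty, Nat.cast_zero]
    intro j _ hj
    omega

theorem binomPmf_eq_zero_of_lt {n : ℕ} {ε : ℝ} {t : ℤ} (h : (n : ℤ) < |t|) :
    binomPmf n ε t = 0 := by
  induction n generalizing t with
  | zero =>
    rw [binomPmf_zero, if_neg]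
    rintro rfl
    simp at h
  | succ n ih =>
    rw [binomPmf_succ, ih, ih]
    · ring
    all_goals
      push_cast at h
      rcases lt_abs.mp h with h | h
      · exact lt_abs.mpr (Or.inl (by omega))
      · exact lt_abs.mpr (Or.inr (by omega))

theorem binomPmf_eq_zero_of_odd {n : ℕ} {ε : ℝ} {t : ℤ} (h : (t + n) % 2 = 1) :
    binomPmf n ε t = 0 := by
  induction n generalizing t with
  | zero =>
    rw [binomPmf_zero, if_neg]
    rintro rfl
    simp at h
  | succ n ih =>
    rw [binomPmf_succ, ih, ih]
    · ring
    all_goals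
      push_cast at h
      omega

/-- The ratio of consecutive point probabilities of a binomial distribution. -/
theorem binomPmf_add_two (n : ℕ) (ε : ℝ) (t : ℤ) :
    ((n : ℝ) + t + 2) * (1 - ε) * binomPmf n ε (t + 2) =
      ((n : ℝ) - t) * (1 + ε) * binomPmf n ε t := by
  induction n generalizing t with
  | zero =>
    rw [binomPmf_zero, binomPmf_zero]
    by_cases h : t = 0
    · subst h; simp
    · rw [if_neg h]
      by_cases h2 : t + 2 = 0
      · have : (t : ℝ) = -2 := by exact_mod_cast (by omega : t = -2)
        rw [this]; simp
      · rw [if_neg h2]; simp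
  | succ n ih =>
    have h1 := ih (t + 1)
    have h2 := ih (t - 1)
    rw [binomPmf_succ, binomPmf_succ]
    have e1 : t + 2 - 1 = t + 1 := by ring
    have e2 : t - 1 + 2 = t + 1 := by ring
    have e3 : t + 2 + 1 = t + 1 + 2 := by ring
    rw [e2] at h2
    rw [e1, e3]
    push_cast at h1 h2 ⊢
    linear_combination (1 - ε) / 2 * h1 + (1 + ε) / 2 * h2

theorem binomTail_eq_sum (n : ℕ) (ε : ℝ) (t : ℤ) :
    binomTail n ε t = ∑ u ∈ Finset.Icc t n, binomPmf n ε u := by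
  have h : ∀ k : ℕ, ∀ t : ℤ, (n : ℤ) + 1 ≤ t + k →
      binomTail n ε t = ∑ u ∈ Finset.Icc t n, binomPmf n ε u := by
    intro k
    induction k with
    | zero =>
      intro t ht
      rw [Finset.Icc_eq_empty (by push_cast at ht; omega), Finset.sum_empty]
      unfold binomTail prob
      refine Finset.sum_eq_zero fun v _ => if_neg fun hv => ?_
      have : ∑ j, (v j : ℤ) ≤ ∑ _j : Fin n, (1 : ℤ) := Finset.sum_le_sum fun j _ => by
        rcases Int.units_eq_one_or (v j) with h | h <;> simp [h]
      simp at this hv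
      push_cast at ht
      omega
    | succ k ih =>
      intro t ht
      by_cases htn : (n : ℤ) < t
      · exact ih t (by omega)
      · rw [binomTail_eq_add, ih (t + 1) (by push_cast at ht ⊢; omega),
          ← Finset.insert_Icc_add_one_left_eq_Icc (not_lt.mp htn), Finset.sum_insert (by simp),
          add_comm]
  exact h (n + 1 - t).toNat t (by omega)

/-- Monotone likelihood ratio: by `binomPmf_add_two`, a negative bias lowers every ratio of
successive point masses compared with the fair coin. The cross-multiplied form survives vanishing
masses. -/
theorem binomPmf_mul_le_of_nonpos {n : ℕ} {ε : ℝ} (h1 : -1 ≤ ε) (h0 : ε ≤ 0) {s : ℤ}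
    (hs : -n ≤ s) (j : ℕ) :
    binomPmf n ε (s + 2 * j) * binomPmf n 0 s ≤ binomPmf n 0 (s + 2 * j) * binomPmf n ε s := by
  induction j with
  | zero => simp [mul_comm]
  | succ j ih =>
    have hI : ε ∈ Set.Icc (-1 : ℝ) 1 := ⟨h1, by linarith⟩
    have hI0 : (0 : ℝ) ∈ Set.Icc (-1 : ℝ) 1 := by norm_num
    set u : ℤ := s + 2 * j with hu
    have e : s + 2 * ((j + 1 : ℕ) : ℤ) = u + 2 := by rw [hu]; push_cast; ring
    rw [e]
    have r1 := binomPmf_add_two n ε u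
    have r2 := binomPmf_add_two n 0 u
    have hun : (0 : ℝ) < (n : ℝ) + u + 2 := by
      have : (-n : ℝ) ≤ u := by exact_mod_cast (by omega : (-n : ℤ) ≤ u)
      linarith
    by_cases hlt : (n : ℤ) < u
    · rw [binomPmf_eq_zero_of_lt (ε := ε) (t := u + 2) (lt_abs.mpr (Or.inl (by omega))), zero_mul]
      exact mul_nonneg (binomPmf_nonneg hI0 _ _) (binomPmf_nonneg hI _ _)
    · have hnu : (0 : ℝ) ≤ (n : ℝ) - u := by
        have : (u : ℝ) ≤ n := by exact_mod_cast not_lt.mp hlt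
        linarith
      have a1 := binomPmf_nonneg hI n (u + 2)
      have a2 := binomPmf_nonneg hI n u
      have a3 := binomPmf_nonneg hI0 n (u + 2)
      have a4 := binomPmf_nonneg hI0 n s
      have step : ((n : ℝ) + u + 2) * binomPmf n ε (u + 2) ≤ ((n : ℝ) - u) * binomPmf n ε u := by
        nlinarith [mul_nonneg hun.le a1, mul_nonneg hnu a2]
      have : ((n : ℝ) + u + 2) * (binomPmf n ε (u + 2) * binomPmf n 0 s) ≤
          ((n : ℝ) + u + 2) * (binomPmf n 0 (u + 2) * binomPmf n ε s) :=
        calc _ = ((n : ℝ) + u + 2) * binomPmf n ε (u + 2) * binomPmf n 0 s := by ring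
          _ ≤ ((n : ℝ) - u) * binomPmf n ε u * binomPmf n 0 s := by gcongr
          _ = ((n : ℝ) - u) * (binomPmf n ε u * binomPmf n 0 s) := by ring
          _ ≤ ((n : ℝ) - u) * (binomPmf n 0 u * binomPmf n ε s) := by gcongr
          _ = _ := by linear_combination -(binomPmf n ε s) * r2
      exact le_of_mul_le_mul_left this hun

/-- The likelihood ratio inequality, summed over the points of the tail; those of the wrong parity
carry no mass. -/
theorem binomTail_mul_le_of_nonpos {n : ℕ} {ε : ℝ} (h1 : -1 ≤ ε) (h0 : ε ≤ 0) {s : ℤ}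
    (hs : -n ≤ s) (hpar : (s + n) % 2 = 0) :
    binomTail n ε s * binomPmf n 0 s ≤ binomPmf n ε s := by
  have hI : ε ∈ Set.Icc (-1 : ℝ) 1 := ⟨h1, by linarith⟩
  have hI0 : (0 : ℝ) ∈ Set.Icc (-1 : ℝ) 1 := by norm_num
  calc binomTail n ε s * binomPmf n 0 s ≤ binomTail n 0 s * binomPmf n ε s := by
        rw [binomTail_eq_sum, binomTail_eq_sum, Finset.sum_mul, Finset.sum_mul]
        refine Finset.sum_le_sum fun u hu => ?_
        rw [Finset.mem_Icc] at hu
        rcases Int.emod_two_eq_zero_or_one (u - s) with h | h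
        · obtain ⟨j, hj⟩ : ∃ j : ℕ, u = s + 2 * j := ⟨((u - s) / 2).toNat, by omega⟩
          rw [hj]
          exact binomPmf_mul_le_of_nonpos h1 h0 hs j
        · rw [binomPmf_eq_zero_of_odd (ε := ε) (t := u) (by omega), zero_mul]
          exact mul_nonneg (binomPmf_nonneg hI0 _ _) (binomPmf_nonneg hI _ _)
    _ ≤ binomPmf n ε s :=
        mul_le_of_le_one_left (binomPmf_nonneg hI _ _) (binomTail_le_one hI0 _ _)

theorem binomPmf_fair_neg (n : ℕ) (t : ℤ) : binomPmf n 0 (-t) = binomPmf n 0 t := by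
  have := binomPmf_neg n 0 t
  rw [neg_zero] at this
  exact this.symm

theorem binomPmf_fair_succ_one (n : ℕ) :
    ((n : ℝ) + 2) * binomPmf (n + 1) 0 1 = ((n : ℝ) + 1) * binomPmf n 0 0 := by
  have h := binomPmf_add_two n 0 0
  rw [binomPmf_succ]
  norm_num at h ⊢
  linarith

/-- The right-hand side equals one at `a = 0` and does not decrease with `a`, which replaces
Stirling's formula. -/
theorem binomPmf_fair_zero_sq (a : ℕ) : 1 ≤ (4 * (a : ℝ) + 1) * binomPmf (2 * a) 0 0 ^ 2 := by
  induction a with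
  | zero => simp [binomPmf_zero]
  | succ a ih =>
    have h1 := binomPmf_fair_succ_one (2 * a)
    have h2 : binomPmf (2 * (a + 1)) 0 0 = binomPmf (2 * a + 1) 0 1 := by
      rw [show 2 * (a + 1) = 2 * a + 1 + 1 by ring, binomPmf_succ]
      norm_num
      rw [binomPmf_fair_neg]
      ring
    rw [h2]
    set x := binomPmf (2 * a) 0 0
    set y := binomPmf (2 * a + 1) 0 1
    push_cast at h1 ⊢
    have ha : (0 : ℝ) ≤ a := by positivity
    have h3 : y = (2 * a + 1) / (2 * a + 2) * x := by
      field_simp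
      linarith
    rw [h3]
    have : (4 * ((a : ℝ) + 1) + 1) * ((2 * a + 1) / (2 * a + 2) * x) ^ 2 =
        (4 * ((a : ℝ) + 1) + 1) * (2 * a + 1) ^ 2 / (2 * a + 2) ^ 2 * x ^ 2 := by
      field_simp
    rw [this]
    refine ih.trans (mul_le_mul_of_nonneg_right ?_ (sq_nonneg x))
    rw [le_div_iff₀ (by positivity)]
    nlinarith

theorem binomPmf_fair_central {n : ℕ} {s : ℤ} (hs : |s| ≤ 1) (hpar : (s + n) % 2 = 0) :
    1 ≤ 2 * Real.sqrt (n + 1) * binomPmf n 0 s := by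
  have hI0 : (0 : ℝ) ∈ Set.Icc (-1 : ℝ) 1 := by norm_num
  have key : 1 ≤ 4 * ((n : ℝ) + 1) * binomPmf n 0 s ^ 2 := by
    rcases Nat.even_or_odd' n with ⟨a, rfl | rfl⟩
    · have : s = 0 := by
        rw [abs_le] at hs; push_cast at hpar; omega
      subst this
      refine (binomPmf_fair_zero_sq a).trans (mul_le_mul_of_nonneg_right ?_ (sq_nonneg _))
      push_cast
      have ha : (0 : ℝ) ≤ a := by positivity
      linarith
    · have : binomPmf (2 * a + 1) 0 s = binomPmf (2 * a + 1) 0 1 := by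
        rw [abs_le] at hs; push_cast at hpar
        have : s = 1 ∨ s = -1 := by omega
        rcases this with rfl | rfl
        · rfl
        · exact binomPmf_fair_neg _ 1
      rw [this]
      have h1 := binomPmf_fair_succ_one (2 * a)
      have h2 := binomPmf_fair_zero_sq a
      set x := binomPmf (2 * a) 0 0
      set y := binomPmf (2 * a + 1) 0 1
      push_cast at h1 ⊢
      have ha : (0 : ℝ) ≤ a := by positivity
      have h3 : y = (2 * a + 1) / (2 * a + 2) * x := by
        field_simp
        linarith
      rw [h3]
      have : 4 * (2 * (a : ℝ) + 1 + 1) * ((2 * a + 1) / (2 * a + 2) * x) ^ 2 =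
          4 * (2 * a + 1) ^ 2 / (2 * a + 2) * x ^ 2 := by
        field_simp
        ring
      rw [this]
      refine h2.trans (mul_le_mul_of_nonneg_right ?_ (sq_nonneg x))
      rw [le_div_iff₀ (by positivity)]
      nlinarith
  have h2 : 0 ≤ 2 * Real.sqrt (n + 1) * binomPmf n 0 s :=
    mul_nonneg (by positivity) (binomPmf_nonneg hI0 _ _)
  have h3 : (2 * Real.sqrt (n + 1) * binomPmf n 0 s) ^ 2 =
      4 * ((n : ℝ) + 1) * binomPmf n 0 s ^ 2 := by
    rw [mul_pow, mul_pow, Real.sq_sqrt (by positivity)]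
    norm_num
  rw [← h3] at key
  nlinarith

theorem binomTail_le_binomPmf_of_nonpos {n : ℕ} {ε : ℝ} (h1 : -1 ≤ ε) (h0 : ε ≤ 0) {s : ℤ}
    (hs : |s| ≤ 1) (hpar : (s + n) % 2 = 0) :
    binomTail n ε s ≤ 2 * Real.sqrt (n + 1) * binomPmf n ε s := by
  have hI : ε ∈ Set.Icc (-1 : ℝ) 1 := ⟨h1, by linarith⟩
  have hsn : -(n : ℤ) ≤ s := by
    rw [abs_le] at hs; omega
  have hc := binomPmf_fair_central hs hpar
  calc binomTail n ε s ≤ (2 * Real.sqrt (n + 1) * binomPmf n 0 s) * binomTail n ε s :=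
        le_mul_of_one_le_left (binomTail_nonneg hI _ _) hc
    _ = 2 * Real.sqrt (n + 1) * (binomTail n ε s * binomPmf n 0 s) := by ring
    _ ≤ _ := mul_le_mul_of_nonneg_left (binomTail_mul_le_of_nonpos h1 h0 hsn hpar) (by positivity)

/-! ### How a tail grows with the bias of the coins -/

/-- Russo's formula: differentiating in the bias of a single coin gives half the expected jump of
`g` when that coin is flipped, and all coins contribute equally. -/
theorem coinExp_hasDerivAt (n : ℕ) (g : ℤ → ℝ) (ε : ℝ) :
    HasDerivAt (fun e => coinExp e (n + 1) g)
      (((n : ℝ) + 1) / 2 * coinExp ε n (fun x => g (1 + x) - g (-1 + x))) ε := by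
  induction n generalizing g with
  | zero =>
    simp only [coinExp_succ, coinExp_zero]
    have h1 : HasDerivAt (fun e : ℝ => (1 + e) / 2) (1 / 2) ε :=
      ((hasDerivAt_id ε).const_add 1).div_const 2
    have h2 : HasDerivAt (fun e : ℝ => (1 - e) / 2) (-1 / 2) ε :=
      ((hasDerivAt_id ε).const_sub 1).div_const 2
    refine ((h1.mul_const (g (1 + 0))).add (h2.mul_const (g (-1 + 0)))).congr_deriv ?_
    push_cast
    ring
  | succ n ih =>
    have h1 : HasDerivAt (fun e : ℝ => (1 + e) / 2) (1 / 2) ε :=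
      ((hasDerivAt_id ε).const_add 1).div_const 2
    have h2 : HasDerivAt (fun e : ℝ => (1 - e) / 2) (-1 / 2) ε :=
      ((hasDerivAt_id ε).const_sub 1).div_const 2
    have h3 := (h1.mul (ih fun x => g (1 + x))).add (h2.mul (ih fun x => g (-1 + x)))
    have e : (fun e => coinExp e (n + 1 + 1) g) = fun e => (1 + e) / 2 *
        coinExp e (n + 1) (fun x => g (1 + x)) + (1 - e) / 2 *
        coinExp e (n + 1) (fun x => g (-1 + x)) := by
      funext e; exact coinExp_succ e (n + 1) g
    rw [e]
    refine h3.congr_deriv ?_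
    have c1 : ∀ x : ℤ, -1 + (1 + x) = 1 + (-1 + x) := fun x => by ring
    simp only [coinExp_sub_fun]
    rw [coinExp_succ ε n (fun x => g (1 + x)), coinExp_succ ε n (fun x => g (-1 + x))]
    simp only [c1]
    push_cast
    ring

theorem binomTail_hasDerivAt (n : ℕ) (ε : ℝ) :
    HasDerivAt (fun e => binomTail (n + 1) e 0)
      (((n : ℝ) + 1) / 2 * (binomPmf n ε (-1) + binomPmf n ε 0)) ε := by
  classical
  have h := coinExp_hasDerivAt n (fun x => if (0 : ℤ) ≤ x then 1 else 0) ε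
  have e : (fun e => binomTail (n + 1) e 0) =
      fun e => coinExp e (n + 1) (fun x => if (0 : ℤ) ≤ x then 1 else 0) := by
    funext e
    rw [binomTail_eq_coinExp]
  rw [e]
  convert h using 2
  rw [binomPmf, binomPmf, ← coinExp_add_fun]
  congr 1
  funext x
  by_cases h1 : x = -1
  · subst h1; simp
  · by_cases h2 : x = 0
    · subst h2; simp
    · rcases lt_or_ge x (-1) with h3 | h3
      · rw [if_neg h1, if_neg h2, if_neg (by omega), if_neg (by omega)]; norm_num
      · rw [if_neg h1, if_neg h2, if_pos (by omega), if_pos (by omega)]; norm_num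

theorem binomTail_succ (n : ℕ) (ε : ℝ) (t : ℤ) :
    binomTail (n + 1) ε t =
      (1 + ε) / 2 * binomTail n ε (t - 1) + (1 - ε) / 2 * binomTail n ε (t + 1) := by
  rw [binomTail_eq_coinExp, coinExp_succ, binomTail_eq_coinExp, binomTail_eq_coinExp]
  congr 3 <;> funext x <;> exact if_congr ⟨fun h => by omega, fun h => by omega⟩ rfl rfl

theorem binomTail_succ_le {ε : ℝ} (hε : ε ∈ Set.Icc (-1 : ℝ) 1) (n : ℕ) (t : ℤ) :
    binomTail (n + 1) ε t ≤ binomTail n ε (t - 1) := by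
  have h := binomTail_antitone hε n (by omega : t - 1 ≤ t + 1)
  rw [binomTail_succ]
  nlinarith [hε.1, hε.2]

/-- Exactly one of the points `-1` and `0` has the parity of `n`; for a nonpositive bias its mass is
at least a fraction 1 / √n of the tail. -/
theorem binomTail_zero_le_of_nonpos {n : ℕ} {ε : ℝ} (h1 : -1 ≤ ε) (h0 : ε ≤ 0) :
    binomTail (n + 1) ε 0 ≤ 2 * Real.sqrt (n + 1) * (binomPmf n ε (-1) + binomPmf n ε 0) := by
  have hI : ε ∈ Set.Icc (-1 : ℝ) 1 := ⟨h1, by linarith⟩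
  have hs : (0 : ℝ) ≤ 2 * Real.sqrt (n + 1) := by positivity
  have b1 := binomPmf_nonneg hI n (-1)
  have b2 := binomPmf_nonneg hI n 0
  refine (binomTail_succ_le hI n 0).trans ?_
  rcases Int.emod_two_eq_zero_or_one n with h | h
  · rw [zero_sub, binomTail_eq_add n ε (-1), binomPmf_eq_zero_of_odd (n := n) (t := -1) (by omega), zero_add,
      add_zero]
    exact binomTail_le_binomPmf_of_nonpos h1 h0 (s := 0) (by simp) (by omega)
  · refine (binomTail_le_binomPmf_of_nonpos (n := n) h1 h0 (s := -1) (by simp) (by omega)).trans ?_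
    gcongr
    linarith

theorem one_sub_binomTail_zero_le_of_nonneg {n : ℕ} {ε : ℝ} (h1 : ε ≤ 1) (h0 : 0 ≤ ε) :
    1 - binomTail (n + 1) ε 0 ≤
      2 * Real.sqrt (n + 1) * (binomPmf n ε (-1) + binomPmf n ε 0) := by
  have hI : ε ∈ Set.Icc (-1 : ℝ) 1 := ⟨by linarith, h1⟩
  have hI' : -ε ∈ Set.Icc (-1 : ℝ) 1 := ⟨by linarith, by linarith⟩
  have hs : (0 : ℝ) ≤ 2 * Real.sqrt (n + 1) := by positivity
  have b1 := binomPmf_nonneg hI n (-1)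
  have b2 := binomPmf_nonneg hI n 0
  rw [one_sub_binomTail]
  refine (binomTail_succ_le hI' n _).trans ?_
  rcases Int.emod_two_eq_zero_or_one n with h | h
  · refine (binomTail_le_binomPmf_of_nonpos (n := n) (by linarith) (by linarith) (s := 0)
      (by simp) (by omega)).trans ?_
    rw [binomPmf_neg, neg_zero]
    gcongr
    linarith
  · have : (1 : ℤ) - 0 - 1 = 0 := by norm_num
    rw [this, binomTail_eq_add n _ 0, binomPmf_eq_zero_of_odd (n := n) (t := 0) (by omega), zero_add, add_zero]
    refine (binomTail_le_binomPmf_of_nonpos (n := n) (by linarith) (by linarith) (s := 1)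
      (by simp) (by omega)).trans ?_
    rw [binomPmf_neg]
    gcongr
    linarith

/-- Between two biases, the probability that a sum of coins is nonnegative grows at least
proportionally to its variance. -/
theorem binomTail_sub_ge {n : ℕ} {a b : ℝ} (ha : a ∈ Set.Icc (-1 : ℝ) 1)
    (hb : b ∈ Set.Icc (-1 : ℝ) 1) (hab : a ≤ b) :
    Real.sqrt (n + 1) / 4 * (binomTail (n + 1) a 0 * (1 - binomTail (n + 1) b 0)) * (b - a) ≤
      binomTail (n + 1) b 0 - binomTail (n + 1) a 0 := by
  have hd := fun e => binomTail_hasDerivAt n e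
  have hdiff : Differentiable ℝ fun e => binomTail (n + 1) e 0 :=
    fun e => (hd e).differentiableAt
  have hmono : MonotoneOn (fun e => binomTail (n + 1) e 0) (Set.Icc (-1 : ℝ) 1) := by
    refine monotoneOn_of_deriv_nonneg (convex_Icc _ _) hdiff.continuous.continuousOn
      hdiff.differentiableOn fun e he => ?_
    rw [(hd e).deriv]
    have he' := interior_subset he
    have := binomPmf_nonneg he' n (-1)
    have := binomPmf_nonneg he' n 0
    positivity
  refine (convex_Icc a b).mul_sub_le_image_sub_of_le_deriv hdiff.continuous.continuousOn
    hdiff.differentiableOn (fun e he => ?_) a (Set.left_mem_Icc.mpr hab) b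
    (Set.right_mem_Icc.mpr hab) hab
  have he' := interior_subset he
  have heI : e ∈ Set.Icc (-1 : ℝ) 1 := ⟨ha.1.trans he'.1, he'.2.trans hb.2⟩
  have m1 := hmono ha heI he'.1
  have m2 := hmono heI hb he'.2
  simp only at m1 m2
  have c1 := binomTail_nonneg ha (n + 1) 0
  have c2 := binomTail_le_one hb (n + 1) 0
  have c3 := binomTail_nonneg heI (n + 1) 0
  have c4 := binomTail_le_one heI (n + 1) 0
  rw [(hd e).deriv]
  have hs : Real.sqrt ((n : ℝ) + 1) * Real.sqrt (n + 1) = n + 1 :=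
    Real.mul_self_sqrt (by positivity)
  have hs0 : 0 ≤ Real.sqrt ((n : ℝ) + 1) := Real.sqrt_nonneg _
  set P := binomPmf n e (-1) + binomPmf n e 0 with hP
  -- For `e ≤ 0` the tail, for `e ≥ 0` its complement, is bounded by the central mass `P`. By
  -- monotonicity in the bias, the product taken at the endpoints `a` and `b` lies below both.
  have key : binomTail (n + 1) a 0 * (1 - binomTail (n + 1) b 0) ≤
      2 * Real.sqrt (n + 1) * P := by
    rcases le_total e 0 with h | h
    · have := binomTail_zero_le_of_nonpos (n := n) heI.1 h
      nlinarith
    · have := one_sub_binomTail_zero_le_of_nonneg (n := n) heI.2 h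
      nlinarith
  calc _ ≤ Real.sqrt (n + 1) / 4 * (2 * Real.sqrt (n + 1) * P) := by gcongr
    _ = (Real.sqrt ((n : ℝ) + 1) * Real.sqrt (n + 1)) / 2 * P := by ring
    _ = _ := by rw [hs]

theorem binomTail_strictMono_bias {n : ℕ} {a b : ℝ} (ha : a ∈ Set.Icc (-1 : ℝ) 1)
    (hb : b ∈ Set.Icc (-1 : ℝ) 1) (h : binomTail (n + 1) a 0 < binomTail (n + 1) b 0) :
    a ≤ b := by
  by_contra hba
  have := binomTail_sub_ge (n := n) hb ha (not_le.mp hba).le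
  have h2 : 0 ≤ Real.sqrt ((n : ℝ) + 1) / 4 *
      (binomTail (n + 1) b 0 * (1 - binomTail (n + 1) a 0)) * (a - b) := by
    have c1 := binomTail_nonneg hb (n + 1) 0
    have c2 := binomTail_le_one ha (n + 1) 0
    have c3 : 0 ≤ a - b := by linarith
    have c4 : 0 ≤ 1 - binomTail (n + 1) a 0 := by linarith
    positivity
  linarith

/-! ### The hazard rate of a binomial distribution -/

/-- The two coefficients in `binomPmf_add_two` differ by `2 * w + 2 * (1 - ε)`, with `w` the
distance of `u` from the mean, while the left one is of order `n` at and beyond the mean. Hence a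
step of two loses at most a fraction of order `y / n`. -/
theorem binomPmf_step {n : ℕ} {ε y θ : ℝ} (hε : |ε| ≤ 1 / 2) (hn : 0 < n) {u : ℤ}
    (hu : -(n : ℤ) ≤ u) (hy : (u : ℝ) - ε * n ≤ y) (hθ0 : 0 ≤ θ)
    (hθ : 4 * (2 * y + 3) ≤ 3 * n * θ) :
    (1 - θ) * binomPmf n ε u ≤ binomPmf n ε (u + 2) := by
  obtain ⟨e1, e2⟩ := abs_le.mp hε
  have hI : ε ∈ Set.Icc (-1 : ℝ) 1 := ⟨by linarith, by linarith⟩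
  have hr := binomPmf_add_two n ε u
  have hn' : (0 : ℝ) < n := by exact_mod_cast hn
  have hu' : -(n : ℝ) ≤ u := by exact_mod_cast hu
  set w := (u : ℝ) - ε * n with hw
  have hD0 : 0 < ((n : ℝ) + u + 2) * (1 - ε) := mul_pos (by linarith) (by linarith)
  have hdiff : ((n : ℝ) + u + 2) * (1 - ε) - ((n : ℝ) - u) * (1 + ε) = 2 * w + 2 * (1 - ε) := by
    rw [hw]; ring
  have hmain : 2 * w + 2 * (1 - ε) ≤ θ * (((n : ℝ) + u + 2) * (1 - ε)) := by
    -- Left of `-3 / 2` the masses still increase; to its right the denominator is at least `n * (1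
    -- - ε ^ 2) ≥ 3 * n / 4`.
    rcases le_total w (-3 / 2) with h | h
    · have : 0 ≤ θ * (((n : ℝ) + u + 2) * (1 - ε)) := by positivity
      linarith
    · have hD : 3 * (n : ℝ) / 4 ≤ ((n : ℝ) + u + 2) * (1 - ε) := by
        have : ((n : ℝ) + u + 2) * (1 - ε) = n * (1 - ε ^ 2) + (w + 2) * (1 - ε) := by
          rw [hw]; ring
        rw [this]
        have h1 : 0 ≤ (w + 2) * (1 - ε) := mul_nonneg (by linarith) (by linarith)
        have h2 : ε ^ 2 ≤ 1 / 4 := by nlinarith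
        nlinarith
      have := mul_le_mul_of_nonneg_left hD hθ0
      linarith
  have hb := binomPmf_nonneg hI n u
  have : (((n : ℝ) + u + 2) * (1 - ε)) * ((1 - θ) * binomPmf n ε u) ≤
      (((n : ℝ) + u + 2) * (1 - ε)) * binomPmf n ε (u + 2) := by
    rw [hr]
    have h3 : (((n : ℝ) + u + 2) * (1 - ε)) * (1 - θ) ≤ ((n : ℝ) - u) * (1 + ε) := by
      linarith
    calc _ = (((n : ℝ) + u + 2) * (1 - ε)) * (1 - θ) * binomPmf n ε u := by ring
      _ ≤ _ := mul_le_mul_of_nonneg_right h3 hb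
  exact le_of_mul_le_mul_left this hD0

/-- An upper bound on the hazard rate of a binomial distribution. -/
theorem sqrt_mul_binomPmf_le {n : ℕ} {ε x : ℝ} (hε : |ε| ≤ 1 / 2) (hn : 0 < n) (hx : 0 ≤ x)
    {t : ℤ} (ht : (t : ℝ) - ε * n ≤ x * Real.sqrt n) :
    Real.sqrt n * binomPmf n ε t ≤ 16 * (1 + x) * binomTail n ε t := by
  obtain ⟨e1, e2⟩ := abs_le.mp hε
  have hI : ε ∈ Set.Icc (-1 : ℝ) 1 := ⟨by linarith, by linarith⟩
  have hT := binomTail_nonneg hI n t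
  by_cases htn : t < -(n : ℤ)
  · rw [binomPmf_eq_zero_of_lt (lt_abs.mpr (Or.inr (by omega))), mul_zero]
    positivity
  set r := Real.sqrt n with hr
  have hn' : (0 : ℝ) < n := by exact_mod_cast hn
  have hr0 : 0 < r := Real.sqrt_pos.mpr hn'
  have hr2 : r * r = n := Real.mul_self_sqrt hn'.le
  -- Over `J` steps of two from `t` the point mass loses at most half of its value, so the tail
  -- contains `J + 1` masses of at least `binomPmf n ε t / 2`.
  set J := ⌊r / (8 * (1 + x))⌋₊ with hJ
  have hJ1 : (J : ℝ) ≤ r / (8 * (1 + x)) := Nat.floor_le (by positivity)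
  have hJ2 : r / (8 * (1 + x)) < J + 1 := Nat.lt_floor_add_one _
  have hJ3 : (J : ℝ) * (8 * (1 + x)) ≤ r := by
    rwa [le_div_iff₀ (by positivity)] at hJ1
  have hJ4 : r < (J + 1) * (8 * (1 + x)) := by
    rwa [div_lt_iff₀ (by positivity)] at hJ2
  have hb := binomPmf_nonneg hI n t
  have hJ0 : (0 : ℝ) ≤ J := by positivity
  -- The loss per step from `binomPmf_step`; `x * r + 2 * J` bounds the distance from the mean along
  -- the whole progression.
  set θ := 4 * (2 * (x * r + 2 * J) + 3) / (3 * n) with hθ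
  have hθ0 : 0 ≤ θ := by positivity
  have hθJ : J * θ ≤ 1 / 2 := by
    rw [hθ, mul_div_assoc', div_le_iff₀ (by positivity)]
    rcases Nat.eq_zero_or_pos J with h0 | h0
    · rw [h0]; norm_num
    · have h1 : (1 : ℝ) ≤ J := by exact_mod_cast h0
      rw [← hr2]
      have h8 : 8 ≤ r := by nlinarith
      have a1 : (J : ℝ) * 8 ≤ r := by nlinarith
      have a2 : (J : ℝ) * x * 8 ≤ r := by nlinarith
      have b1 : (J : ℝ) * (x * r) * 8 ≤ r * r := by nlinarith
      have b2 : (J : ℝ) * J * 64 ≤ r * r := by nlinarith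
      have b3 : (J : ℝ) * 64 ≤ r * r := by nlinarith
      nlinarith
  have hpow : ∀ j : ℕ, j ≤ J → (1 - j * θ) * binomPmf n ε t ≤ binomPmf n ε (t + 2 * j) := by
    intro j
    induction j with
    | zero => simp
    | succ j ih =>
      intro hj
      have ih' := ih (by omega)
      have hjJ : (j : ℝ) ≤ J := by exact_mod_cast (by omega : j ≤ J)
      have hj1J : (j : ℝ) + 1 ≤ J := by exact_mod_cast hj
      have hstep := binomPmf_step (n := n) (ε := ε) (y := x * r + 2 * J) (θ := θ) hε hn
        (u := t + 2 * j) (by omega) (by push_cast; linarith) hθ0 (by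
          rw [hθ]; apply le_of_eq; field_simp)
      have e : t + 2 * ((j + 1 : ℕ) : ℤ) = t + 2 * j + 2 := by push_cast; ring
      rw [e]
      refine le_trans ?_ hstep
      have hθ1 : θ ≤ 1 := by
        have : 1 * θ ≤ J * θ := by
          apply mul_le_mul_of_nonneg_right _ hθ0
          have : (0 : ℝ) ≤ j := by positivity
          linarith
        linarith
      calc _ ≤ (1 - θ) * (1 - j * θ) * binomPmf n ε t := by
            apply mul_le_mul_of_nonneg_right _ hb
            have : (0 : ℝ) ≤ j * θ * θ := by positivity
            push_cast
            nlinarith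
        _ = (1 - θ) * ((1 - j * θ) * binomPmf n ε t) := by ring
        _ ≤ _ := mul_le_mul_of_nonneg_left ih' (by linarith)
  have hsum : ((J : ℝ) + 1) * (1 / 2 * binomPmf n ε t) ≤ binomTail n ε t := by
    refine le_trans ?_ (sum_binomPmf_le_binomTail hI n t (J + 1))
    have : ((J : ℝ) + 1) * (1 / 2 * binomPmf n ε t) =
        ∑ _j ∈ Finset.range (J + 1), 1 / 2 * binomPmf n ε t := by
      rw [Finset.sum_const, Finset.card_range, nsmul_eq_mul]; push_cast; ring
    rw [this]
    refine Finset.sum_le_sum fun j hj => le_trans ?_ (hpow j (by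
      rw [Finset.mem_range] at hj; omega))
    apply mul_le_mul_of_nonneg_right _ hb
    have : (j : ℝ) ≤ J := by
      rw [Finset.mem_range] at hj; exact_mod_cast (by omega : j ≤ J)
    have := mul_le_mul_of_nonneg_right this hθ0
    linarith
  calc r * binomPmf n ε t ≤ (J + 1) * (8 * (1 + x)) * binomPmf n ε t :=
        mul_le_mul_of_nonneg_right hJ4.le hb
    _ = 16 * (1 + x) * (((J : ℝ) + 1) * (1 / 2 * binomPmf n ε t)) := by ring
    _ ≤ _ := mul_le_mul_of_nonneg_left hsum (by positivity)

theorem sqrt_mul_binomPmf_le_lower {n : ℕ} {ε x : ℝ} (hε : |ε| ≤ 1 / 2) (hn : 0 < n)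
    (hx : 0 ≤ x) {t : ℤ} (ht : -(x * Real.sqrt n) ≤ (t : ℝ) - ε * n) :
    Real.sqrt n * binomPmf n ε t ≤ 16 * (1 + x) * (1 - binomTail n ε (t + 1)) := by
  have h := sqrt_mul_binomPmf_le (ε := -ε) (by rwa [abs_neg]) hn hx (t := -t)
    (by push_cast; linarith)
  rw [binomPmf_neg, neg_neg] at h
  rw [one_sub_binomTail]
  have e : 1 - (t + 1) = -t := by ring
  rwa [e]

theorem sqrt_mul_binomPmf_le_const {n : ℕ} {ε : ℝ} (hε : |ε| ≤ 1 / 2) (t : ℤ) :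
    Real.sqrt n * binomPmf n ε t ≤ 16 := by
  obtain ⟨e1, e2⟩ := abs_le.mp hε
  have hI : ε ∈ Set.Icc (-1 : ℝ) 1 := ⟨by linarith, by linarith⟩
  rcases Nat.eq_zero_or_pos n with rfl | hn
  · simp
  rcases le_total ((t : ℝ) - ε * n) 0 with h | h
  · have := sqrt_mul_binomPmf_le hε hn le_rfl (t := t) (by linarith)
    linarith [binomTail_le_one hI n t]
  · have := sqrt_mul_binomPmf_le_lower hε hn le_rfl (t := t) (by linarith)
    linarith [binomTail_nonneg hI n (t + 1)]

theorem binomTail_le_exp {n : ℕ} {ε : ℝ} (hε : ε ∈ Set.Icc (-1 : ℝ) 1) {u s : ℝ}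
    (hu : 0 ≤ u) (hs : 0 < s) (hn : (n : ℝ) ≤ s) {t : ℤ} (ht : u ≤ (t : ℝ) - ε * n) :
    binomTail n ε t ≤ Real.exp (-(u ^ 2 / (8 * s))) := by
  classical
  rw [binomTail_eq_coinExp]
  refine (coinExp_mono hε n fun x => ?_).trans (coinExp_upper_tail_le hε n hu hs hn)
  by_cases h : t ≤ x
  · have : (t : ℝ) ≤ x := by exact_mod_cast h
    rw [if_pos h, if_pos (by linarith)]
  · rw [if_neg h]; split_ifs <;> norm_num

theorem one_sub_binomTail_le_exp {n : ℕ} {ε : ℝ} (hε : ε ∈ Set.Icc (-1 : ℝ) 1) {u s : ℝ}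
    (hu : 0 ≤ u) (hs : 0 < s) (hn : (n : ℝ) ≤ s) {t : ℤ} (ht : (t : ℝ) - ε * n ≤ 1 - u) :
    1 - binomTail n ε t ≤ Real.exp (-(u ^ 2 / (8 * s))) := by
  rw [one_sub_binomTail]
  refine binomTail_le_exp ⟨by linarith [hε.2], by linarith [hε.1]⟩ hu hs hn ?_
  push_cast
  linarith

section Scaled

variable {n : ℕ} {ε σ : ℝ}

/-- The hazard bound at an external scale `σ` comparable to `√n`, so that scales can later be
expressed by the number of remaining rounds. Since `σ ≤ 5 * √n`, it holds with `x = 5 * |t - ε * n|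
/ σ`. -/
theorem mul_binomPmf_le_tail (hε : |ε| ≤ 1 / 2) (hn : 0 < n) (hσ : 0 < σ)
    (hσ2 : σ ^ 2 ≤ 24 * n) (t : ℤ) :
    σ * binomPmf n ε t ≤ 400 * (1 + |(t : ℝ) - ε * n| / σ) * binomTail n ε t := by
  obtain ⟨e1, e2⟩ := abs_le.mp hε
  have hI : ε ∈ Set.Icc (-1 : ℝ) 1 := ⟨by linarith, by linarith⟩
  have hn' : (0 : ℝ) < n := by exact_mod_cast hn
  have hr0 : 0 < Real.sqrt n := Real.sqrt_pos.mpr hn'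
  have hr2 : Real.sqrt n * Real.sqrt n = n := Real.mul_self_sqrt hn'.le
  have hσr : σ ≤ 5 * Real.sqrt n := by nlinarith
  set a := |(t : ℝ) - ε * n| with ha
  have ha0 : 0 ≤ a := abs_nonneg _
  have h := sqrt_mul_binomPmf_le hε hn (x := 5 * (a / σ)) (by positivity) (t := t) (by
    have h1 : a ≤ 5 * (a / σ) * Real.sqrt n := by
      have : a = a / σ * σ := by field_simp
      have h2 : a / σ * σ ≤ a / σ * (5 * Real.sqrt n) := by gcongr
      linarith
    exact (le_abs_self _).trans h1)
  have hb := binomPmf_nonneg hI n t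
  have hT := binomTail_nonneg hI n t
  have hq : 0 ≤ a / σ := by positivity
  calc σ * binomPmf n ε t ≤ 5 * (Real.sqrt n * binomPmf n ε t) := by
        rw [← mul_assoc]; gcongr
    _ ≤ 5 * (16 * (1 + 5 * (a / σ)) * binomTail n ε t) := by gcongr
    _ = (80 + 400 * (a / σ)) * binomTail n ε t := by ring
    _ ≤ _ := by
        apply mul_le_mul_of_nonneg_right _ hT
        linarith

theorem mul_binomPmf_le_one_sub_tail (hε : |ε| ≤ 1 / 2) (hn : 0 < n) (hσ : 0 < σ)
    (hσ2 : σ ^ 2 ≤ 24 * n) (t : ℤ) :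
    σ * binomPmf n ε t ≤
      400 * (1 + |(t : ℝ) - ε * n| / σ) * (1 - binomTail n ε (t + 1)) := by
  have h := mul_binomPmf_le_tail (ε := -ε) (by rwa [abs_neg]) hn hσ hσ2 (-t)
  rw [binomPmf_neg, neg_neg] at h
  have e2 : |((-t : ℤ) : ℝ) - -ε * n| = |(t : ℝ) - ε * n| := by
    rw [← abs_neg]; congr 1; push_cast; ring
  rw [e2] at h
  rw [one_sub_binomTail]
  have e : 1 - (t + 1) = -t := by ring
  rwa [e]

theorem one_add_pow_four_mul_exp_le (y : ℝ) :
    (1 + y) ^ 4 * Real.exp (-(y ^ 2 / 8)) ≤ 1032 := by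
  have h1 : (1 + y) ^ 4 ≤ 8 * (1 + y ^ 4) := by
    nlinarith [sq_nonneg (y - 1), sq_nonneg (y ^ 2 - 1), sq_nonneg (y ^ 2 - y)]
  have h2 : 8 * (1 + y ^ 4) ≤ 1032 * Real.exp (y ^ 2 / 8) := by
    have := Real.quadratic_le_exp_of_nonneg (by positivity : 0 ≤ y ^ 2 / 8)
    nlinarith [sq_nonneg y]
  rw [Real.exp_neg, ← div_eq_mul_inv, div_le_iff₀ (Real.exp_pos _)]
  exact h1.trans h2

/-- Point probabilities of a binomial distribution decay fast away from the mean. -/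
theorem mul_binomPmf_mul_pow_le (hε : |ε| ≤ 1 / 2) (hn : 0 < n) (hσ : 0 < σ)
    (hσ1 : (n : ℝ) ≤ σ ^ 2) (hσ2 : σ ^ 2 ≤ 24 * n) (t : ℤ) :
    σ * binomPmf n ε t * (1 + |(t : ℝ) - ε * n| / σ) ^ 3 ≤ 412800 := by
  obtain ⟨e1, e2⟩ := abs_le.mp hε
  have hI : ε ∈ Set.Icc (-1 : ℝ) 1 := ⟨by linarith, by linarith⟩
  set a := |(t : ℝ) - ε * n| with ha
  have ha0 : 0 ≤ a := abs_nonneg _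
  have hq : 0 ≤ a / σ := by positivity
  have hexp : Real.exp (-(a ^ 2 / (8 * σ ^ 2))) = Real.exp (-((a / σ) ^ 2 / 8)) := by
    congr 2; field_simp
  -- The hazard bound turns the mass into the tail that points away from the mean, and Hoeffding's
  -- inequality bounds that tail.
  have key : σ * binomPmf n ε t ≤ 400 * (1 + a / σ) * Real.exp (-((a / σ) ^ 2 / 8)) := by
    rcases le_total 0 ((t : ℝ) - ε * n) with h | h
    · refine (mul_binomPmf_le_tail hε hn hσ hσ2 t).trans ?_
      refine mul_le_mul_of_nonneg_left ?_ (by positivity)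
      rw [← hexp]
      exact binomTail_le_exp hI ha0 (by positivity) hσ1 (by rw [ha, abs_of_nonneg h])
    · refine (mul_binomPmf_le_one_sub_tail hε hn hσ hσ2 t).trans ?_
      refine mul_le_mul_of_nonneg_left ?_ (by positivity)
      rw [← hexp]
      exact one_sub_binomTail_le_exp hI ha0 (by positivity) hσ1
        (by rw [ha, abs_of_nonpos h]; push_cast; linarith)
  calc _ ≤ 400 * (1 + a / σ) * Real.exp (-((a / σ) ^ 2 / 8)) * (1 + a / σ) ^ 3 := by gcongr
    _ = 400 * ((1 + a / σ) ^ 4 * Real.exp (-((a / σ) ^ 2 / 8))) := by ring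
    _ ≤ 400 * 1032 := by
        have := one_add_pow_four_mul_exp_le (a / σ)
        linarith
    _ = _ := by norm_num

end Scaled

/-! ### The effect of an observation on a mean -/

section Posterior

variable {α : Type*} [Fintype α]

open scoped Classical in
/-- The effect of conditioning on an observation with likelihood `q` on the mean of `V`, up to the
prior and posterior probabilities of the values outside of a set `T`. -/
theorem posterior_sub_prior_le (p q V : α → ℝ) (T : α → Prop) (hp : ∀ v, 0 ≤ p v)
    (hp1 : ∑ v, p v = 1) (hq : ∀ v, 0 ≤ q v) (hV0 : ∀ v, 0 ≤ V v) (hV1 : ∀ v, V v ≤ 1)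
    (hQ : 0 < ∑ v, p v * q v) :
    |(∑ v, p v * q v * V v) / (∑ v, p v * q v) - ∑ v, p v * V v| ≤
      |∑ v, ∑ w, if T v ∧ T w then p v * p w * q v * (V v - V w) else 0| / (∑ v, p v * q v) +
      (∑ v, if T v then 0 else p v * q v) / (∑ v, p v * q v) + ∑ v, if T v then 0 else p v := by
  set Q := ∑ v, p v * q v with hQdef
  -- As the prior has total mass one, both means become sums over pairs of independent draws from
  -- the prior.
  have hdiff : (∑ v, p v * q v * V v) / Q - ∑ v, p v * V v =
      (∑ v, ∑ w, p v * p w * q v * (V v - V w)) / Q := by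
    rw [eq_div_iff hQ.ne', sub_mul, div_mul_cancel₀ _ hQ.ne']
    have e1 : ∑ v, ∑ w, p v * p w * q v * (V v - V w) =
        (∑ v, p v * q v * V v) * (∑ w, p w) - (∑ v, p v * q v) * ∑ w, p w * V w := by
      rw [Finset.sum_mul_sum, Finset.sum_mul_sum, ← Finset.sum_sub_distrib]
      refine Finset.sum_congr rfl fun v _ => ?_
      rw [← Finset.sum_sub_distrib]
      exact Finset.sum_congr rfl fun w _ => by ring
    rw [e1, hp1, ← hQdef]
    ring
  have hpt : ∀ v w, |p v * p w * q v * (V v - V w) -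
      (if T v ∧ T w then p v * p w * q v * (V v - V w) else 0)| ≤
      (if T v then 0 else p v * q v) * p w + p v * q v * (if T w then 0 else p w) := by
    intro v w
    have hVV : |V v - V w| ≤ 1 := by
      rw [abs_le]; constructor <;> linarith [hV0 v, hV0 w, hV1 v, hV1 w]
    have hc : 0 ≤ p v * p w * q v := mul_nonneg (mul_nonneg (hp v) (hp w)) (hq v)
    have hb : |p v * p w * q v * (V v - V w)| ≤ p v * q v * p w := by
      rw [abs_mul, abs_of_nonneg hc]
      calc _ ≤ p v * p w * q v * 1 := mul_le_mul_of_nonneg_left hVV hc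
        _ = _ := by ring
    have hc' : 0 ≤ p v * q v * p w := mul_nonneg (mul_nonneg (hp v) (hq v)) (hp w)
    by_cases h1 : T v <;> by_cases h2 : T w <;> simp only [h1, h2, and_self, if_true, if_false,
      false_and, and_false, sub_zero, sub_self, abs_zero, zero_mul, mul_zero, add_zero,
      zero_add] <;> first | exact le_rfl | linarith
  have hsplit : |(∑ v, ∑ w, p v * p w * q v * (V v - V w)) -
      ∑ v, ∑ w, if T v ∧ T w then p v * p w * q v * (V v - V w) else 0| ≤
      (∑ v, if T v then 0 else p v * q v) + Q * ∑ v, if T v then 0 else p v := by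
    rw [← Finset.sum_sub_distrib]
    simp only [← Finset.sum_sub_distrib]
    refine (Finset.abs_sum_le_sum_abs _ _).trans ?_
    refine (Finset.sum_le_sum fun v _ => (Finset.abs_sum_le_sum_abs _ _).trans
      (Finset.sum_le_sum fun w _ => hpt v w)).trans (le_of_eq ?_)
    simp only [Finset.sum_add_distrib, ← Finset.mul_sum]
    rw [hp1, ← Finset.sum_mul, ← Finset.sum_mul, mul_one]
  rw [hdiff, abs_div, abs_of_pos hQ]
  set G := ∑ v, ∑ w, p v * p w * q v * (V v - V w)
  set G' := ∑ v, ∑ w, if T v ∧ T w then p v * p w * q v * (V v - V w) else 0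
  have h3 : |G| ≤ |G'| + |G - G'| := by
    have := abs_add_le G' (G - G')
    rwa [add_sub_cancel] at this
  rw [← add_div, div_add' _ _ _ hQ.ne']
  gcongr
  linarith

open scoped Classical in
-- No property of the likelihood is needed: both means average values of `V` that differ by at most
-- `B` inside `T`.
theorem posterior_sub_prior_le_of_osc (p q V : α → ℝ) (T : α → Prop) (hp : ∀ v, 0 ≤ p v)
    (hp1 : ∑ v, p v = 1) (hq : ∀ v, 0 ≤ q v) (hV0 : ∀ v, 0 ≤ V v) (hV1 : ∀ v, V v ≤ 1)
    (hQ : 0 < ∑ v, p v * q v) {B : ℝ} (hB0 : 0 ≤ B)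
    (hB : ∀ v w, T v → T w → |V v - V w| ≤ B) :
    |(∑ v, p v * q v * V v) / (∑ v, p v * q v) - ∑ v, p v * V v| ≤ B +
      (∑ v, if T v then 0 else p v * q v) / (∑ v, p v * q v) + ∑ v, if T v then 0 else p v := by
  refine (posterior_sub_prior_le p q V T hp hp1 hq hV0 hV1 hQ).trans ?_
  gcongr
  rw [div_le_iff₀ hQ]
  refine (Finset.abs_sum_le_sum_abs _ _).trans ?_
  calc _ ≤ ∑ v, ∑ w, B * (p v * q v) * p w := by
        refine Finset.sum_le_sum fun v _ => (Finset.abs_sum_le_sum_abs _ _).trans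
          (Finset.sum_le_sum fun w _ => ?_)
        have hc : 0 ≤ p v * p w * q v := mul_nonneg (mul_nonneg (hp v) (hp w)) (hq v)
        split_ifs with h
        · rw [abs_mul, abs_of_nonneg hc]
          have := mul_le_mul_of_nonneg_left (hB v w h.1 h.2) hc
          linarith
        · rw [abs_zero]
          have := mul_nonneg hB0 hc
          linarith
    _ = B * ∑ v, p v * q v := by
        simp only [← Finset.mul_sum, hp1, mul_one]

open scoped Classical in
-- Exchanging `v` and `w` in the double sum replaces `q v` by half of `q v - q w`. The summand is
-- then a product of two small differences, which costs only the second moment of the distance `a`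
-- to a reference point. All likelihoods are measured against `q₀`; the lower bound `γ * q₀` on `T`
-- and the mass of `T` keep the normaliser above `γ * q₀ / 2`.
theorem posterior_sub_prior_le_of_lipschitz (p q V a : α → ℝ) (T : α → Prop)
    (hp : ∀ v, 0 ≤ p v)
    (hp1 : ∑ v, p v = 1) (hq : ∀ v, 0 ≤ q v) (hV0 : ∀ v, 0 ≤ V v) (hV1 : ∀ v, V v ≤ 1)
    (hQ : 0 < ∑ v, p v * q v) {A β γ q₀ S : ℝ} (hA0 : 0 ≤ A) (hβ : 0 ≤ β)
    (hγ : 0 < γ) (hq₀ : 0 < q₀) (ha0 : ∀ v, 0 ≤ a v)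
    (hA : ∀ v w, T v → T w → |V v - V w| ≤ A * (a v + a w))
    (hqβ : ∀ v, T v → |q v - q₀| ≤ β * q₀ * a v)
    (hqγ : ∀ v, T v → γ * q₀ ≤ q v) (hT : 1 / 2 ≤ ∑ v, if T v then p v else 0)
    (hS : ∑ v, p v * a v ^ 2 ≤ S) :
    |(∑ v, p v * q v * V v) / (∑ v, p v * q v) - ∑ v, p v * V v| ≤ 4 * A * β * S / γ +
      (∑ v, if T v then 0 else p v * q v) / (∑ v, p v * q v) + ∑ v, if T v then 0 else p v := by
  refine (posterior_sub_prior_le p q V T hp hp1 hq hV0 hV1 hQ).trans ?_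
  refine add_le_add (add_le_add ?_ le_rfl) le_rfl
  have hQ2 : γ * q₀ / 2 ≤ ∑ v, p v * q v := by
    calc γ * q₀ / 2 = γ * q₀ * (1 / 2) := by ring
      _ ≤ γ * q₀ * ∑ v, if T v then p v else 0 := by gcongr
      _ = ∑ v, γ * q₀ * (if T v then p v else 0) := Finset.mul_sum _ _ _
      _ ≤ _ := by
        refine Finset.sum_le_sum fun v _ => ?_
        split_ifs with h
        · rw [mul_comm]; exact mul_le_mul_of_nonneg_left (hqγ v h) (hp v)
        · rw [mul_zero]; exact mul_nonneg (hp v) (hq v)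
  have hS0 : 0 ≤ S :=
    (Finset.sum_nonneg fun v _ => mul_nonneg (hp v) (sq_nonneg (a v))).trans hS
  set G := ∑ v, ∑ w, if T v ∧ T w then p v * p w * q v * (V v - V w) else 0 with hG
  have hsymm : 2 * G = ∑ v, ∑ w, if T v ∧ T w then p v * p w * (q v - q w) * (V v - V w)
      else 0 := by
    have hG' : G = ∑ v, ∑ w, if T v ∧ T w then p v * p w * q w * (V w - V v) else 0 := by
      rw [hG, Finset.sum_comm]
      refine Finset.sum_congr rfl fun v _ => Finset.sum_congr rfl fun w _ => ?_
      by_cases h1 : T v <;> by_cases h2 : T w <;> simp only [h1, h2, and_self, and_false,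
        false_and, if_true, if_false]
      ring
    rw [two_mul]
    conv_lhs => rw [hG']
    conv_lhs => enter [1]; rw [← hG', hG]
    rw [← Finset.sum_add_distrib]
    refine Finset.sum_congr rfl fun v _ => ?_
    rw [← Finset.sum_add_distrib]
    refine Finset.sum_congr rfl fun w _ => ?_
    split_ifs <;> ring
  have hGle : |2 * G| ≤ 4 * (A * β * q₀ * S) := by
    rw [hsymm]
    refine (Finset.abs_sum_le_sum_abs _ _).trans ?_
    calc _ ≤ ∑ v, ∑ w, 2 * (A * β * q₀) * ((p v * a v ^ 2) * p w + p v * (p w * a w ^ 2)) := by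
          refine Finset.sum_le_sum fun v _ => (Finset.abs_sum_le_sum_abs _ _).trans
            (Finset.sum_le_sum fun w _ => ?_)
          have hpp : 0 ≤ p v * p w := mul_nonneg (hp v) (hp w)
          have hABq : 0 ≤ A * β * q₀ := by positivity
          split_ifs with h
          · have h1 := hA v w h.1 h.2
            have h2 : |q v - q w| ≤ β * q₀ * (a v + a w) := by
              have := abs_sub_le (q v) q₀ (q w)
              have h3 := hqβ v h.1
              have h4 := hqβ w h.2
              rw [abs_sub_comm] at h4
              linarith
            have hs : 0 ≤ a v + a w := add_nonneg (ha0 v) (ha0 w)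
            rw [abs_mul, abs_mul, abs_of_nonneg hpp]
            calc p v * p w * |q v - q w| * |V v - V w|
                ≤ p v * p w * (β * q₀ * (a v + a w)) * (A * (a v + a w)) := by gcongr
              _ = (A * β * q₀) * (p v * p w * (a v + a w) ^ 2) := by ring
              _ ≤ (A * β * q₀) * (p v * p w * (2 * (a v ^ 2 + a w ^ 2))) := by
                  gcongr
                  nlinarith [sq_nonneg (a v - a w)]
              _ = _ := by ring
          · rw [abs_zero]
            have := hp v
            have := hp w
            positivity
      _ = 2 * (A * β * q₀) * (2 * ∑ v, p v * a v ^ 2) := by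
          simp only [← Finset.mul_sum, Finset.sum_add_distrib, ← Finset.sum_mul, hp1]
          ring
      _ ≤ 2 * (A * β * q₀) * (2 * S) := by gcongr
      _ = _ := by ring
  rw [abs_mul, abs_two] at hGle
  rw [div_le_iff₀ hQ]
  calc |G| ≤ 2 * (A * β * q₀ * S) := by linarith
    _ = 4 * A * β * S / γ * (γ * q₀ / 2) := by field_simp; ring
    _ ≤ _ := by gcongr

end Posterior

/-! ### The likelihood of a coin vector as a function of the bias -/

section Likelihood

variable {ι : Type*} [Fintype ι]

theorem exp_sub_two_mul_sq_le {u : ℝ} (hu : |u| ≤ 1 / 2) : Real.exp (u - 2 * u ^ 2) ≤ 1 + u := by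
  obtain ⟨h1, h2⟩ := abs_le.mp hu
  have h0 : 0 < 1 + u := by linarith
  rw [← Real.le_log_iff_exp_le h0]
  have := Real.one_sub_inv_le_log_of_pos h0
  refine le_trans ?_ this
  rw [← sub_nonneg]
  have : 1 - (1 + u)⁻¹ - (u - 2 * u ^ 2) = u ^ 2 * (1 + 2 * u) / (1 + u) := by
    field_simp
    ring
  rw [this]
  have : 0 ≤ 1 + 2 * u := by linarith
  positivity

/-- How the likelihood of a vector of coins depends on the bias. -/
theorem coinsProb_ratio {a b D : ℝ} (ha : |a| ≤ 1 / 2) (hab : |b - a| ≤ 1 / 4) (h : ι → ℤˣ)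
    (hD : |(∑ j, ((h j : ℤ) : ℝ)) - Fintype.card ι * a| ≤ D) :
    coinsProb b h ≤
        Real.exp (2 * |b - a| * D + 8 * (b - a) ^ 2 * Fintype.card ι) * coinsProb a h ∧
      Real.exp (-(2 * |b - a| * D + 8 * (b - a) ^ 2 * Fintype.card ι)) * coinsProb a h ≤
        coinsProb b h := by
  obtain ⟨a1, a2⟩ := abs_le.mp ha
  set δ := b - a with hδ
  have ha2 : a ^ 2 ≤ 1 / 4 := by nlinarith
  have hden : 0 < 1 - a ^ 2 := by linarith
  -- The relative change of the likelihood of coin `j`: the shift of the bias times the score at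
  -- `a`.
  set u : ι → ℝ := fun j => δ * (((h j : ℤ) : ℝ) - a) / (1 - a ^ 2) with hu
  have hpos : ∀ j, 0 < coinProb a (h j) := by
    intro j
    unfold coinProb
    rcases Int.units_eq_one_or (h j) with e | e <;> rw [e] <;> norm_num <;> linarith
  have hratio : ∀ j, coinProb b (h j) = (1 + u j) * coinProb a (h j) := by
    intro j
    unfold coinProb
    have hb : b = a + δ := by rw [hδ]; ring
    rcases Int.units_eq_one_or (h j) with e | e <;> simp only [hu, e, hb] <;>
      field_simp <;> push_cast <;> ring
  have hua : ∀ j, |u j| ≤ 2 * |δ| := by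
    intro j
    have h3 : |((h j : ℤ) : ℝ) - a| ≤ 3 / 2 := by
      rcases Int.units_eq_one_or (h j) with e | e <;> rw [e, abs_le] <;> push_cast <;>
        constructor <;> linarith
    simp only [hu]
    rw [abs_div, abs_mul, abs_of_pos hden, div_le_iff₀ hden]
    have := abs_nonneg δ
    nlinarith
  -- The first-order terms add up to the deviation of the vector from its mean, so `D` appears and
  -- not the number of coins. The squares give the second-order term.
  have hsum : ∑ j, u j = δ * ((∑ j, ((h j : ℤ) : ℝ)) - Fintype.card ι * a) / (1 - a ^ 2) := by
    simp only [hu]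
    rw [← Finset.sum_div, ← Finset.mul_sum, Finset.sum_sub_distrib, Finset.sum_const,
      Finset.card_univ, nsmul_eq_mul]
  have hD0 : 0 ≤ D := (abs_nonneg _).trans hD
  have hsumle : |∑ j, u j| ≤ 2 * |δ| * D := by
    rw [hsum, abs_div, abs_mul, abs_of_pos hden, div_le_iff₀ hden]
    have h4 : |δ| * |(∑ j, ((h j : ℤ) : ℝ)) - Fintype.card ι * a| ≤ |δ| * D := by gcongr
    have h5 : 0 ≤ |δ| * D := by positivity
    nlinarith
  have hsq : ∑ j, 2 * u j ^ 2 ≤ 8 * δ ^ 2 * Fintype.card ι := by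
    calc ∑ j, 2 * u j ^ 2 ≤ ∑ _j : ι, 8 * δ ^ 2 := by
          refine Finset.sum_le_sum fun j _ => ?_
          have := sq_le_sq' (by linarith [hua j, neg_abs_le (u j)])
            ((le_abs_self _).trans (hua j))
          rw [mul_pow, sq_abs] at this
          linarith
      _ = _ := by rw [Finset.sum_const, Finset.card_univ, nsmul_eq_mul]; ring
  have hsq0 : 0 ≤ 8 * δ ^ 2 * Fintype.card ι := by positivity
  have hprod : coinsProb b h = (∏ j, (1 + u j)) * coinsProb a h := by
    unfold coinsProb
    rw [← Finset.prod_mul_distrib]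
    exact Finset.prod_congr rfl fun j _ => hratio j
  have ha0 : 0 < coinsProb a h := Finset.prod_pos fun j _ => hpos j
  have hu1 : ∀ j, |u j| ≤ 1 / 2 := fun j => (hua j).trans (by linarith)
  rw [hprod]
  obtain ⟨b1, b2⟩ := abs_le.mp hsumle
  constructor
  · refine mul_le_mul_of_nonneg_right ?_ ha0.le
    calc ∏ j, (1 + u j) ≤ ∏ j, Real.exp (u j) :=
          Finset.prod_le_prod (fun j _ => by linarith [(abs_le.mp (hu1 j)).1])
            fun j _ => by linarith [Real.add_one_le_exp (u j)]
      _ = Real.exp (∑ j, u j) := (Real.exp_sum _ _).symm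
      _ ≤ _ := Real.exp_le_exp.mpr (by linarith)
  · refine mul_le_mul_of_nonneg_right ?_ ha0.le
    calc _ ≤ Real.exp (∑ j, (u j - 2 * u j ^ 2)) := by
          apply Real.exp_le_exp.mpr
          rw [Finset.sum_sub_distrib]
          linarith
      _ = ∏ j, Real.exp (u j - 2 * u j ^ 2) := Real.exp_sum _ _
      _ ≤ _ := Finset.prod_le_prod (fun j _ => (Real.exp_pos _).le)
          fun j _ => exp_sub_two_mul_sq_le (hu1 j)

/-- The cap `X` on the exponent makes the error linear in the exponent, via `e ^ Z - 1 ≤ Z * e ^ Z ≤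
Z * e ^ X`. -/
theorem abs_coinsProb_sub_le {a b D X : ℝ} (ha : |a| ≤ 1 / 2) (hab : |b - a| ≤ 1 / 4)
    (h : ι → ℤˣ) (hD : |(∑ j, ((h j : ℤ) : ℝ)) - Fintype.card ι * a| ≤ D)
    (hX : 2 * |b - a| * D + 8 * (b - a) ^ 2 * Fintype.card ι ≤ X) :
    |coinsProb b h - coinsProb a h| ≤
      (2 * |b - a| * D + 8 * (b - a) ^ 2 * Fintype.card ι) * Real.exp X * coinsProb a h := by
  have haI : a ∈ Set.Icc (-1 : ℝ) 1 := by
    obtain ⟨a1, a2⟩ := abs_le.mp ha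
    exact ⟨by linarith, by linarith⟩
  obtain ⟨h1, h2⟩ := coinsProb_ratio ha hab h hD
  have hD0 : 0 ≤ D := (abs_nonneg _).trans hD
  set Z := 2 * |b - a| * D + 8 * (b - a) ^ 2 * Fintype.card ι with hZ
  have hZ0 : 0 ≤ Z := by positivity
  have hc := coinsProb_nonneg haI h
  have e1 : Real.exp Z - 1 ≤ Z * Real.exp X := by
    have := Real.add_one_le_exp (-Z)
    have h3 : Real.exp Z * (-Z + 1) ≤ 1 := by
      calc _ ≤ Real.exp Z * Real.exp (-Z) := by gcongr
        _ = 1 := by rw [← Real.exp_add]; simp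
    have h4 : Z * Real.exp Z ≤ Z * Real.exp X := by gcongr
    linarith
  have e2 : 1 - Real.exp (-Z) ≤ Z * Real.exp X := by
    have := Real.add_one_le_exp (-Z)
    have h4 : Z * 1 ≤ Z * Real.exp X := by
      gcongr
      exact Real.one_le_exp (hZ0.trans hX)
    linarith
  rw [abs_le]
  constructor
  · have := mul_le_mul_of_nonneg_right e2 hc
    linarith
  · have := mul_le_mul_of_nonneg_right e1 hc
    linarith

end Likelihood

/-! ### The bias of the hint coins as a function of the threshold -/

theorem signBias_spec {n : ℕ} (hn : 1 ≤ n) {δ : ℝ} (hδ : δ ∈ Set.Icc (0 : ℝ) 1) :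
    signBias n δ ∈ Set.Icc (-1 : ℝ) 1 ∧ binomTail n (signBias n δ) 0 = δ := by
  have h := exists_binomTail_eq hn hδ
  unfold signBias
  rw [dif_pos h]
  exact h.choose_spec

theorem binomPmf_self_pos {ε : ℝ} (hε : |ε| ≤ 1 / 2) (n : ℕ) : 0 < binomPmf n ε n := by
  obtain ⟨e1, e2⟩ := abs_le.mp hε
  have hI : ε ∈ Set.Icc (-1 : ℝ) 1 := ⟨by linarith, by linarith⟩
  induction n with
  | zero => simp [binomPmf_zero]
  | succ n ih =>
    rw [binomPmf_succ]
    have e : ((n + 1 : ℕ) : ℤ) - 1 = n := by push_cast; ring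
    rw [e]
    have h1 : 0 < (1 + ε) / 2 * binomPmf n ε n := mul_pos (by linarith) ih
    have h2 := mul_nonneg (by linarith : 0 ≤ (1 - ε) / 2)
      (binomPmf_nonneg hI n (((n + 1 : ℕ) : ℤ) + 1))
    linarith

theorem binomTail_pos {n : ℕ} {ε : ℝ} (hε : |ε| ≤ 1 / 2) {t : ℤ} (ht : t ≤ n) :
    0 < binomTail n ε t := by
  obtain ⟨e1, e2⟩ := abs_le.mp hε
  have hI : ε ∈ Set.Icc (-1 : ℝ) 1 := ⟨by linarith, by linarith⟩
  have h := binomTail_eq_add n ε n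
  have h1 := binomPmf_self_pos hε n
  have h2 := binomTail_antitone hI n ht
  have h3 := binomTail_nonneg hI n (n + 1)
  linarith

theorem binomTail_lt_one {n : ℕ} {ε : ℝ} (hε : |ε| ≤ 1 / 2) {t : ℤ} (ht : -(n : ℤ) < t) :
    binomTail n ε t < 1 := by
  have := binomTail_pos (n := n) (ε := -ε) (by rwa [abs_neg]) (t := 1 - t) (by omega)
  rw [← one_sub_binomTail] at this
  linarith

/-- The bias of the hint coins, as a function of the threshold `t` that the remaining `M` coins
have to reach. -/
noncomputable def hintBias (M N : ℕ) (ε : ℝ) (t : ℤ) : ℝ := signBias N (binomTail M ε t)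

section HintBias

variable {M N : ℕ} {ε σ : ℝ}

theorem hintBias_mem (hε : ε ∈ Set.Icc (-1 : ℝ) 1) (hN : 1 ≤ N) (t : ℤ) :
    hintBias M N ε t ∈ Set.Icc (-1 : ℝ) 1 :=
  (signBias_spec hN ⟨binomTail_nonneg hε M t, binomTail_le_one hε M t⟩).1

theorem binomTail_hintBias (hε : ε ∈ Set.Icc (-1 : ℝ) 1) (hN : 1 ≤ N) (t : ℤ) :
    binomTail N (hintBias M N ε t) 0 = binomTail M ε t :=
  (signBias_spec hN ⟨binomTail_nonneg hε M t, binomTail_le_one hε M t⟩).2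

theorem hintBias_antitone (hε : ε ∈ Set.Icc (-1 : ℝ) 1) (hN : 1 ≤ N) :
    Antitone (hintBias M N ε) := by
  intro s t hst
  rcases (binomTail_antitone hε M hst).lt_or_eq with h | h
  · obtain ⟨k, rfl⟩ : ∃ k, N = k + 1 := ⟨N - 1, by omega⟩
    rw [← binomTail_hintBias hε hN t, ← binomTail_hintBias hε hN s] at h
    exact binomTail_strictMono_bias (hintBias_mem hε hN t) (hintBias_mem hε hN s) h
  · unfold hintBias
    rw [h]

/-- Moving the threshold by one changes the win probability by the point mass β, at most of order (s
/ σ) V (1 - V'), because the hazard bounds hold towards both tails. By `binomTail_sub_ge`, a change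
d of the bias of `N` coins changes the same probability by at least of order √N V (1 - V') d. The
factor V (1 - V') cancels, so no lower bound on the win probability is needed. -/
theorem hintBias_step (hε : |ε| ≤ 1 / 2) (hN : 1 ≤ N) (hM : 0 < M) (hσ : 0 < σ)
    (hσ2 : σ ^ 2 ≤ 24 * M) {t : ℤ} {s : ℝ} (ht1 : -(M : ℤ) < t) (ht2 : t < M)
    (hs : 1 + |(t : ℝ) - ε * M| / σ ≤ s) (hsσ : 800 * s ≤ σ) :
    hintBias M N ε t - hintBias M N ε (t + 1) ≤ 12800 * s / (σ * Real.sqrt N) := by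
  obtain ⟨e1, e2⟩ := abs_le.mp hε
  have hI : ε ∈ Set.Icc (-1 : ℝ) 1 := ⟨by linarith, by linarith⟩
  have hanti := hintBias_antitone (M := M) hI hN (by omega : t ≤ t + 1)
  have hV := binomTail_hintBias (M := M) hI hN (t + 1)
  have hV' := binomTail_hintBias (M := M) hI hN t
  have hm := hintBias_mem (M := M) hI hN t
  have hm' := hintBias_mem (M := M) hI hN (t + 1)
  obtain ⟨k, rfl⟩ : ∃ k, N = k + 1 := ⟨N - 1, by omega⟩
  have hge := binomTail_sub_ge (n := k) hm' hm hanti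
  rw [hV, hV'] at hge
  have hadd := binomTail_eq_add M ε t
  have hp := mul_binomPmf_le_tail hε hM hσ hσ2 t
  have hq := mul_binomPmf_le_one_sub_tail hε hM hσ hσ2 t
  have hV0 : 0 < binomTail M ε (t + 1) := binomTail_pos hε (by omega)
  have hV1 : binomTail M ε t < 1 := binomTail_lt_one hε ht1
  have hb := binomPmf_nonneg hI M t
  set V := binomTail M ε (t + 1)
  set V' := binomTail M ε t
  set β := binomPmf M ε t
  set d := hintBias M (k + 1) ε t - hintBias M (k + 1) ε (t + 1)
  have hs0 : 0 < s := lt_of_lt_of_le (by positivity) hs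
  set κ := 400 * s / σ with hκ
  have hκ0 : 0 < κ := by positivity
  have hκ1 : κ ≤ 1 / 2 := by
    rw [hκ, div_le_iff₀ hσ]; linarith
  have hV'0 : 0 ≤ V' := by linarith
  have hp' : β ≤ κ * V' := by
    have : σ * β ≤ 400 * s * V' := hp.trans (by gcongr)
    rw [hκ, div_mul_eq_mul_div, le_div_iff₀ hσ]
    linarith
  have hq' : β ≤ κ * (1 - V) := by
    have : σ * β ≤ 400 * s * (1 - V) := hq.trans (by
      have : 0 ≤ 1 - V := by linarith
      gcongr)
    rw [hκ, div_mul_eq_mul_div, le_div_iff₀ hσ]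
    linarith
  -- As `κ ≤ 1 / 2`, the single mass β is at most half of either tail containing it; tails with and
  -- without the point `t` agree up to a factor of two.
  have hV'V : V' ≤ 2 * V := by nlinarith
  have hVV' : 1 - V ≤ 2 * (1 - V') := by nlinarith
  have hβV : β ≤ 2 * κ * V := by nlinarith
  have hβV' : β ≤ 2 * κ * (1 - V') := by nlinarith
  have hmain : β ≤ 8 * κ * (V * (1 - V')) := by
    rcases le_total V (1 / 4) with h | h
    · have : 1 / 4 ≤ 1 - V' := by linarith
      nlinarith [mul_pos hκ0 hV0]
    · have : 0 < κ * (1 - V') := mul_pos hκ0 (by linarith)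
      nlinarith
  have hr0 : 0 < Real.sqrt ((k : ℝ) + 1) := Real.sqrt_pos.mpr (by positivity)
  have hVV0 : 0 < V * (1 - V') := mul_pos hV0 (by linarith)
  have h3 : V * (1 - V') * (Real.sqrt (k + 1) / 4 * d) ≤ V * (1 - V') * (8 * κ) := by
    have : V' - V = β := by linarith
    rw [this] at hge
    nlinarith
  have h4 := le_of_mul_le_mul_left h3 hVV0
  push_cast
  rw [le_div_iff₀ (by positivity)]
  have h5 : Real.sqrt (k + 1) * d ≤ 32 * κ := by linarith
  have h6 : κ * σ = 400 * s := by rw [hκ]; field_simp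
  calc d * (σ * Real.sqrt (k + 1)) = (Real.sqrt (k + 1) * d) * σ := by ring
    _ ≤ (32 * κ) * σ := by gcongr
    _ = 32 * (κ * σ) := by ring
    _ = 12800 * s := by rw [h6]; ring

theorem hintBias_sub_le (hε : |ε| ≤ 1 / 2) (hN : 1 ≤ N) (hM : 0 < M) (hσ : 0 < σ)
    (hσ2 : σ ^ 2 ≤ 24 * M) {t₁ t₂ : ℤ} {s : ℝ} (h12 : t₁ ≤ t₂) (ht1 : -(M : ℤ) < t₁)
    (ht2 : t₂ ≤ M) (hs : ∀ t : ℤ, t₁ ≤ t → t ≤ t₂ → 1 + |(t : ℝ) - ε * M| / σ ≤ s)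
    (hsσ : 800 * s ≤ σ) :
    hintBias M N ε t₁ - hintBias M N ε t₂ ≤ 12800 * s / (σ * Real.sqrt N) * ((t₂ : ℝ) - t₁) := by
  have key : ∀ k : ℕ, t₁ + k ≤ t₂ → hintBias M N ε t₁ - hintBias M N ε (t₁ + k) ≤
      12800 * s / (σ * Real.sqrt N) * k := by
    intro k
    induction k with
    | zero => simp
    | succ k ih =>
      intro hk
      push_cast at hk
      have h1 := ih (by omega)
      have h2 := hintBias_step hε hN hM hσ hσ2 (t := t₁ + k) (s := s) (by omega) (by omega)
        (hs _ (by omega) (by omega)) hsσ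
      push_cast
      rw [← add_assoc]
      linarith
  obtain ⟨k, rfl⟩ : ∃ k : ℕ, t₂ = t₁ + k := ⟨(t₂ - t₁).toNat, by omega⟩
  have := key k le_rfl
  push_cast
  rw [add_sub_cancel_left]
  exact this

theorem half_le_binomTail_fair (n : ℕ) : 1 / 2 ≤ binomTail n 0 0 := by
  have h := one_sub_binomTail n 0 0
  rw [neg_zero] at h
  have := binomTail_antitone (ε := 0) (by norm_num) n (by norm_num : (0 : ℤ) ≤ 1 - 0)
  linarith

/-- By symmetry the tail exceeds 1/2 by half the central mass, which is at most 16 / √n. -/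
theorem binomTail_fair_le {n : ℕ} (hn : 1024 ≤ n) : binomTail n 0 0 ≤ 3 / 4 := by
  have h := one_sub_binomTail n 0 0
  rw [neg_zero, sub_zero] at h
  have h1 := binomTail_eq_add n 0 0
  rw [zero_add] at h1
  have h2 := sqrt_mul_binomPmf_le_const (n := n) (ε := 0) (by norm_num) 0
  have h3 : (32 : ℝ) ≤ Real.sqrt n := by
    apply Real.le_sqrt_of_sq_le
    have : (1024 : ℝ) ≤ n := by exact_mod_cast hn
    linarith
  have h4 := binomPmf_nonneg (ε := 0) (by norm_num) n 0
  nlinarith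

theorem exp_neg_two_lt : Real.exp (-2) < 1 / 4 := by
  have h := Real.exp_one_gt_d9
  have h2 : Real.exp 2 = Real.exp 1 * Real.exp 1 := by rw [← Real.exp_add]; norm_num
  rw [Real.exp_neg, inv_lt_comm₀ (Real.exp_pos _) (by norm_num), h2]
  nlinarith

/-- At distance `4 * σ` Hoeffding's inequality leaves a win probability of at most e⁻² < 1/4, below
what fair coins achieve. This fixes the sign of the bias there. -/
theorem hintBias_nonpos (hε : ε ∈ Set.Icc (-1 : ℝ) 1) (hN : 1 ≤ N) (hσ : 0 < σ)
    (hσ1 : (M : ℝ) ≤ σ ^ 2) {t : ℤ} (ht : 4 * σ ≤ (t : ℝ) - ε * M) : hintBias M N ε t ≤ 0 := by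
  have h := binomTail_le_exp hε (by positivity) (by positivity : 0 < σ ^ 2) hσ1 ht
  have e : -((4 * σ) ^ 2 / (8 * σ ^ 2)) = (-2 : ℝ) := by field_simp; norm_num
  rw [e] at h
  have h2 := exp_neg_two_lt
  have h3 := half_le_binomTail_fair N
  rw [← binomTail_hintBias hε hN t] at h
  obtain ⟨k, rfl⟩ : ∃ k, N = k + 1 := ⟨N - 1, by omega⟩
  exact binomTail_strictMono_bias (hintBias_mem hε hN t) (by norm_num) (by linarith)

theorem hintBias_nonneg (hε : ε ∈ Set.Icc (-1 : ℝ) 1) (hN : 1024 ≤ N) (hσ : 0 < σ)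
    (hσ1 : (M : ℝ) ≤ σ ^ 2) {t : ℤ} (ht : (t : ℝ) - ε * M ≤ -(4 * σ)) :
    0 ≤ hintBias M N ε t := by
  have h := one_sub_binomTail_le_exp hε (by positivity) (by positivity : 0 < σ ^ 2) hσ1
    (by linarith : (t : ℝ) - ε * M ≤ 1 - 4 * σ)
  have e : -((4 * σ) ^ 2 / (8 * σ ^ 2)) = (-2 : ℝ) := by field_simp; norm_num
  rw [e] at h
  have h2 := exp_neg_two_lt
  have h3 := binomTail_fair_le hN
  have hN1 : 1 ≤ N := by omega
  rw [← binomTail_hintBias hε hN1 t] at h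
  obtain ⟨k, rfl⟩ : ∃ k, N = k + 1 := ⟨N - 1, by omega⟩
  by_contra hneg
  have hm := hintBias_mem (M := M) hε hN1 t
  have := binomTail_sub_ge (n := k) hm (by norm_num : (0 : ℝ) ∈ Set.Icc (-1 : ℝ) 1)
    (not_le.mp hneg).le
  have h5 : 0 ≤ Real.sqrt ((k : ℝ) + 1) / 4 * (binomTail (k + 1) (hintBias M (k + 1) ε t) 0 *
      (1 - binomTail (k + 1) 0 0)) * (0 - hintBias M (k + 1) ε t) := by
    have c1 := binomTail_nonneg hm (k + 1) 0
    have c2 : 0 ≤ 0 - hintBias M (k + 1) ε t := by linarith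
    have c3 : 0 ≤ 1 - binomTail (k + 1) 0 0 := by linarith
    positivity
  linarith

/-- The sign of the bias is known at distance `4 * σ` from the mean on either side; from there the
Lipschitz bound is integrated over a distance of at most `(B + 6) * σ`, rounding included. -/
theorem abs_hintBias_le (hε : |ε| ≤ 1 / 2) (hN : 1024 ≤ N) (hM : 0 < M) (hσ : 1 ≤ σ)
    (hσ1 : (M : ℝ) ≤ σ ^ 2) (hσ2 : σ ^ 2 ≤ 24 * M) {B : ℝ} (hB : 0 ≤ B)
    (hBM : 4 * ((B + 5) * σ) ≤ M) (hBσ : 800 * (B + 6) ≤ σ) {t : ℤ}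
    (ht : |(t : ℝ) - ε * M| ≤ B * σ) :
    |hintBias M N ε t| ≤ 12800 * (B + 6) ^ 2 / Real.sqrt N := by
  obtain ⟨e1, e2⟩ := abs_le.mp hε
  have hI : ε ∈ Set.Icc (-1 : ℝ) 1 := ⟨by linarith, by linarith⟩
  obtain ⟨t1, t2⟩ := abs_le.mp ht
  have hσ0 : 0 < σ := by linarith
  have hN1 : 1 ≤ N := by omega
  have hM0 : (0 : ℝ) < M := by exact_mod_cast hM
  have hr0 : 0 < Real.sqrt N := Real.sqrt_pos.mpr (by exact_mod_cast (by omega : 0 < N))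
  have hcon : ∀ u : ℤ, |(u : ℝ) - ε * M| ≤ (B + 5) * σ → -(M : ℤ) < u ∧ u ≤ M := by
    intro u hu
    obtain ⟨u1, u2⟩ := abs_le.mp hu
    have hεM : |ε * M| ≤ 1 / 2 * M := by
      rw [abs_mul, abs_of_pos hM0]; gcongr
    obtain ⟨m1, m2⟩ := abs_le.mp hεM
    constructor
    · have : -(M : ℝ) < u := by linarith
      exact_mod_cast this
    · have : (u : ℝ) ≤ M := by linarith
      exact_mod_cast this
  have hlip : ∀ u w : ℤ, u ≤ w → |(u : ℝ) - ε * M| ≤ (B + 5) * σ →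
      |(w : ℝ) - ε * M| ≤ (B + 5) * σ → (w : ℝ) - u ≤ (B + 6) * σ →
      hintBias M N ε u - hintBias M N ε w ≤ 12800 * (B + 6) ^ 2 / Real.sqrt N := by
    intro u w huw hu hw hd
    have h := hintBias_sub_le hε hN1 hM hσ0 hσ2 (s := B + 6) huw (hcon u hu).1 (hcon w hw).2
      (fun t ht1 ht2 => by
        have a1 : (u : ℝ) ≤ t := by exact_mod_cast ht1
        have a2 : (t : ℝ) ≤ w := by exact_mod_cast ht2
        obtain ⟨u1, u2⟩ := abs_le.mp hu
        obtain ⟨w1, w2⟩ := abs_le.mp hw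
        have : |(t : ℝ) - ε * M| / σ ≤ B + 5 := by
          rw [div_le_iff₀ hσ0, abs_le]
          constructor <;> linarith
        linarith) hBσ
    refine h.trans ?_
    calc 12800 * (B + 6) / (σ * Real.sqrt N) * ((w : ℝ) - u)
        ≤ 12800 * (B + 6) / (σ * Real.sqrt N) * ((B + 6) * σ) := by gcongr
      _ = _ := by field_simp
  have hnn : 0 ≤ 12800 * (B + 6) ^ 2 / Real.sqrt N := by positivity
  have hBσ' : (B + 5) * σ = B * σ + 5 * σ := by ring
  have hBσ'' : (B + 6) * σ = B * σ + 6 * σ := by ring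
  have hBσ0 : 0 ≤ B * σ := by positivity
  rw [abs_le]
  constructor
  · set w := ⌊ε * M - 4 * σ⌋ with hw
    have w1 : (w : ℝ) ≤ ε * M - 4 * σ := Int.floor_le _
    have w2 : ε * M - 4 * σ < w + 1 := Int.lt_floor_add_one _
    have hw0 := hintBias_nonneg (N := N) hI hN hσ0 hσ1 (t := w) (by linarith)
    rcases le_total t w with h | h
    · have := hintBias_antitone (M := M) hI hN1 h
      linarith
    · have := hlip w t h (by rw [abs_le]; constructor <;> linarith)
        (by rw [abs_le]; constructor <;> linarith) (by linarith)
      linarith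
  · set w := ⌈ε * M + 4 * σ⌉ with hw
    have w1 : ε * M + 4 * σ ≤ w := Int.le_ceil _
    have w2 : (w : ℝ) < ε * M + 4 * σ + 1 := Int.ceil_lt_add_one _
    have hw0 := hintBias_nonpos (N := N) hI hN1 hσ0 hσ1 (t := w) (by linarith)
    rcases le_total w t with h | h
    · have := hintBias_antitone (M := M) hI hN1 h
      linarith
    · have := hlip t w h (by rw [abs_le]; constructor <;> linarith)
        (by rw [abs_le]; constructor <;> linarith) (by linarith)
      linarith

end HintBias

/-! ### Bounds for one round with exceptional hints averaged out -/

section RoundError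

variable {α H : Type*} [Fintype α] [Fintype H]

theorem posterior_mem_unit {p q V : α → ℝ} (hp : ∀ v, 0 ≤ p v) (hq : ∀ v, 0 ≤ q v)
    (hV0 : ∀ v, 0 ≤ V v) (hV1 : ∀ v, V v ≤ 1) (hQ : 0 < ∑ v, p v * q v) :
    (∑ v, p v * q v * V v) / (∑ v, p v * q v) ∈ Set.Icc (0 : ℝ) 1 := by
  constructor
  · exact div_nonneg (Finset.sum_nonneg fun v _ => mul_nonneg (mul_nonneg (hp v) (hq v)) (hV0 v))
      hQ.le
  · rw [div_le_one hQ]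
    exact Finset.sum_le_sum fun v _ =>
      mul_le_of_le_one_right (mul_nonneg (hp v) (hq v)) (hV1 v)

theorem abs_posterior_sub_prior_le_one {p q V : α → ℝ} (hp : ∀ v, 0 ≤ p v)
    (hp1 : ∑ v, p v = 1) (hq : ∀ v, 0 ≤ q v)
    (hV0 : ∀ v, 0 ≤ V v) (hV1 : ∀ v, V v ≤ 1) (hQ : 0 < ∑ v, p v * q v) :
    |(∑ v, p v * q v * V v) / (∑ v, p v * q v) - ∑ v, p v * V v| ≤ 1 := by
  obtain ⟨h1, h2⟩ := posterior_mem_unit hp hq hV0 hV1 hQ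
  have h3 : 0 ≤ ∑ v, p v * V v := Finset.sum_nonneg fun v _ => mul_nonneg (hp v) (hV0 v)
  have h4 : ∑ v, p v * V v ≤ 1 := by
    rw [← hp1]
    exact Finset.sum_le_sum fun v _ => mul_le_of_le_one_right (hp v) (hV1 v)
  rw [abs_le]
  constructor <;> linarith

/-- Conditioning on the observation `h` with likelihood `q v h` changes the mean of `V` by at most
`W`, up to an error that is at most `δ` on average. -/
def ObservationBound (p : α → ℝ) (q : α → H → ℝ) (V : α → ℝ) (W δ : ℝ) : Prop :=
  ∃ e : H → ℝ, (∀ h, 0 ≤ e h) ∧ ∑ v, p v * ∑ h, q v h * e h ≤ δ ∧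
    ∀ h, 0 < ∑ v, p v * q v h →
      |(∑ v, p v * q v h * V v) / (∑ v, p v * q v h) - ∑ v, p v * V v| ≤ W + e h

theorem ObservationBound.mono {p : α → ℝ} {q : α → H → ℝ} {V : α → ℝ} {W W' δ : ℝ}
    (h : ObservationBound p q V W δ) (hW : W ≤ W') : ObservationBound p q V W' δ := by
  obtain ⟨e, h1, h2, h3⟩ := h
  exact ⟨e, h1, h2, fun x hx => (h3 x hx).trans (by linarith)⟩

theorem observationBound_one {p : α → ℝ} {q : α → H → ℝ} {V : α → ℝ} {δ : ℝ}
    (hp : ∀ v, 0 ≤ p v) (hp1 : ∑ v, p v = 1) (hq : ∀ v h, 0 ≤ q v h)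
    (hV0 : ∀ v, 0 ≤ V v) (hV1 : ∀ v, V v ≤ 1) (hδ : 0 ≤ δ) : ObservationBound p q V 1 δ :=
  ⟨fun _ => 0, fun _ => le_rfl, by simpa using hδ, fun h hh => by
    rw [add_zero]
    exact abs_posterior_sub_prior_le_one hp hp1 (fun v => hq v h) hV0 hV1 hh⟩

open scoped Classical in
-- The error at `h` is the posterior mass outside `T`, plus `3 * η`, plus one at bad hints. Averaged
-- over the hints, the posterior mass returns the prior mass, at most `2 * η`; bad hints cost `2 *
-- η` from values in `T` and at most `2 * η` from the others. The total is `9 * η`.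
theorem observationBound_of_good {p : α → ℝ} {q : α → H → ℝ} {V : α → ℝ} {W η : ℝ}
    (T : α → Prop) (bad : H → Prop) (hp : ∀ v, 0 ≤ p v) (hp1 : ∑ v, p v = 1)
    (hq : ∀ v h, 0 ≤ q v h) (hq1 : ∀ v, ∑ h, q v h = 1)
    (hV0 : ∀ v, 0 ≤ V v) (hV1 : ∀ v, V v ≤ 1) (hη : 0 ≤ η) (hW : 0 ≤ W)
    (hT : ∑ v, (if T v then 0 else p v) ≤ 2 * η)
    (hbad : ∀ v, T v → ∑ h, (if bad h then q v h else 0) ≤ 2 * η)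
    (hgood : ∀ h, ¬ bad h → 0 < ∑ v, p v * q v h →
      |(∑ v, p v * q v h * V v) / (∑ v, p v * q v h) - ∑ v, p v * V v| ≤ W + η +
      (∑ v, if T v then 0 else p v * q v h) / (∑ v, p v * q v h) + ∑ v, if T v then 0 else p v) :
    ObservationBound p q V W (9 * η) := by
  have hQ0 : ∀ h, 0 ≤ ∑ v, p v * q v h := fun h =>
    Finset.sum_nonneg fun v _ => mul_nonneg (hp v) (hq v h)
  set post : H → ℝ := fun h =>
    (∑ v, if T v then 0 else p v * q v h) / (∑ v, p v * q v h) with hpost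
  have hpost0 : ∀ h, 0 ≤ post h := fun h => div_nonneg (Finset.sum_nonneg fun v _ => by
    split_ifs
    · exact le_rfl
    · exact mul_nonneg (hp v) (hq v h)) (hQ0 h)
  refine ⟨fun h => post h + 3 * η + if bad h then 1 else 0, fun h => ?_, ?_, fun h hh => ?_⟩
  · have := hpost0 h
    beta_reduce
    split_ifs <;> positivity
  · have e1 : ∑ v, p v * ∑ h, q v h * (post h + 3 * η + if bad h then 1 else 0) =
        (∑ h, (∑ v, p v * q v h) * post h) + 3 * η +
          ∑ v, p v * ∑ h, if bad h then q v h else 0 := by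
      have a1 : ∀ v, p v * ∑ h, q v h * (post h + 3 * η + if bad h then 1 else 0) =
          (∑ h, p v * q v h * post h) + 3 * η * p v +
            p v * ∑ h, if bad h then q v h else 0 := by
        intro v
        have : ∀ h, q v h * (post h + 3 * η + if bad h then 1 else 0) =
            q v h * post h + q v h * (3 * η) + if bad h then q v h else 0 := by
          intro h; split_ifs <;> ring
        simp only [this, Finset.sum_add_distrib]
        rw [← Finset.sum_mul, hq1, mul_add, mul_add, Finset.mul_sum]
        congr 2
        · exact Finset.sum_congr rfl fun h _ => by ring
        · ring
      simp only [a1, Finset.sum_add_distrib]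
      rw [← Finset.mul_sum, hp1, mul_one, Finset.sum_comm]
      congr 2
      exact Finset.sum_congr rfl fun h _ => by rw [Finset.sum_mul]
    rw [e1]
    have b1 : ∑ h, (∑ v, p v * q v h) * post h ≤ 2 * η := by
      calc _ ≤ ∑ h, ∑ v, (if T v then 0 else p v) * q v h := by
            refine Finset.sum_le_sum fun h _ => ?_
            rcases (hQ0 h).lt_or_eq with hpos | hz
            · simp only [hpost]
              rw [mul_div_cancel₀ _ hpos.ne']
              exact Finset.sum_le_sum fun v _ => by split_ifs <;> simp
            · rw [← hz, zero_mul]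
              refine Finset.sum_nonneg fun v _ => ?_
              split_ifs
              · simp
              · exact mul_nonneg (hp v) (hq v h)
        _ = ∑ v, if T v then 0 else p v := by
            rw [Finset.sum_comm]
            exact Finset.sum_congr rfl fun v _ => by rw [← Finset.mul_sum, hq1, mul_one]
        _ ≤ _ := hT
    have b2 : ∑ v, p v * ∑ h, (if bad h then q v h else 0) ≤ 4 * η := by
      calc _ ≤ ∑ v, (p v * (2 * η) + if T v then 0 else p v) := by
            refine Finset.sum_le_sum fun v _ => ?_
            split_ifs with h
            · rw [add_zero]
              exact mul_le_mul_of_nonneg_left (hbad v h) (hp v)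
            · have h1 : ∑ h, (if bad h then q v h else 0) ≤ 1 := by
                rw [← hq1 v]
                refine Finset.sum_le_sum fun h _ => ?_
                split_ifs
                · exact le_rfl
                · exact hq v h
              have h2 := mul_le_mul_of_nonneg_left h1 (hp v)
              have h3 := mul_nonneg (hp v) (by positivity : 0 ≤ 2 * η)
              linarith
        _ ≤ _ := by
            rw [Finset.sum_add_distrib, ← Finset.sum_mul, hp1]
            linarith
    linarith
  · by_cases hb : bad h
    · have h1 := abs_posterior_sub_prior_le_one hp hp1 (fun v => hq v h) hV0 hV1 hh
      have := hpost0 h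
      simp only [hb, if_true]
      linarith
    · have h1 := hgood h hb hh
      simp only [hb, if_false]
      simp only [hpost]
      linarith

end RoundError

/-! ### Sensitivity of the winning probability and of the hint bias within a round -/

section Osc

variable {M N : ℕ} {ε σ : ℝ}

theorem binomTail_sub_le {A : ℝ} {t₁ t₂ : ℤ} (h12 : t₁ ≤ t₂)
    (hA : ∀ t : ℤ, t₁ ≤ t → t ≤ t₂ → binomPmf M ε t ≤ A) :
    binomTail M ε t₁ - binomTail M ε t₂ ≤ A * ((t₂ : ℝ) - t₁) := by
  have key : ∀ k : ℕ, t₁ + k ≤ t₂ → binomTail M ε t₁ - binomTail M ε (t₁ + k) ≤ A * k := by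
    intro k
    induction k with
    | zero => simp
    | succ k ih =>
      intro hk
      push_cast at hk
      have h1 := ih (by omega)
      have h2 := hA (t₁ + k) (by omega) (by omega)
      have h3 := binomTail_eq_add M ε (t₁ + k)
      push_cast
      rw [← add_assoc]
      linarith
  obtain ⟨k, rfl⟩ : ∃ k : ℕ, t₂ = t₁ + k := ⟨(t₂ - t₁).toNat, by omega⟩
  have := key k le_rfl
  push_cast
  rw [add_sub_cancel_left]
  exact this

/-- A displacement of at most `4 * σ` changes the scale factor by at most 5, so `1 + |Y| / σ` can be
frozen at the start of a round. -/
theorem scale_le {a Y : ℝ} (hσ : 0 < σ) (h : |a + Y| ≤ 4 * σ) :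
    1 + |Y| / σ ≤ 5 * (1 + |a| / σ) := by
  have h1 : |Y| ≤ |a| + 4 * σ := by
    have := abs_sub (a + Y) a
    rw [add_sub_cancel_left] at this
    linarith
  have h2 : |Y| / σ ≤ |a| / σ + 4 := by
    rw [div_add' _ _ _ hσ.ne']
    gcongr
  have : 0 ≤ |a| / σ := by positivity
  linarith

/-- In the game `Y` is the expected final sum, and `t - ε * M + Y` is minus the deviation of the
round's coins from their mean. Freezing the scale factor in the cubic decay of the point masses
costs 5³, whence 51600000 = 125 · 412800. -/
theorem abs_binomTail_sub_le (hε : |ε| ≤ 1 / 2) (hM : 0 < M) (hσ : 0 < σ)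
    (hσ1 : (M : ℝ) ≤ σ ^ 2) (hσ2 : σ ^ 2 ≤ 24 * M) {Y : ℝ} {t₁ t₂ : ℤ}
    (h1 : |(t₁ : ℝ) - ε * M + Y| ≤ 4 * σ) (h2 : |(t₂ : ℝ) - ε * M + Y| ≤ 4 * σ) :
    |binomTail M ε t₁ - binomTail M ε t₂| ≤
      51600000 / (σ * (1 + |Y| / σ) ^ 3) * |(t₁ : ℝ) - t₂| := by
  obtain ⟨e1, e2⟩ := abs_le.mp hε
  have hI : ε ∈ Set.Icc (-1 : ℝ) 1 := ⟨by linarith, by linarith⟩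
  wlog h12 : t₁ ≤ t₂ generalizing t₁ t₂
  · rw [abs_sub_comm, abs_sub_comm (t₁ : ℝ)]
    exact this h2 h1 (by omega)
  have h12' : (t₁ : ℝ) ≤ t₂ := by exact_mod_cast h12
  rw [abs_of_nonneg (sub_nonneg.mpr (binomTail_antitone hI M h12)), abs_sub_comm,
    abs_of_nonneg (sub_nonneg.mpr h12')]
  refine binomTail_sub_le h12 fun t ht1 ht2 => ?_
  have ht1' : (t₁ : ℝ) ≤ t := by exact_mod_cast ht1
  have ht2' : (t : ℝ) ≤ t₂ := by exact_mod_cast ht2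
  have ht : |(t : ℝ) - ε * M + Y| ≤ 4 * σ := by
    obtain ⟨a1, a2⟩ := abs_le.mp h1
    obtain ⟨b1, b2⟩ := abs_le.mp h2
    rw [abs_le]
    constructor <;> linarith
  have hs := scale_le hσ ht
  have hb := mul_binomPmf_mul_pow_le hε hM hσ hσ1 hσ2 t
  have hbn := binomPmf_nonneg hI M t
  set s := 1 + |Y| / σ
  set s' := 1 + |(t : ℝ) - ε * M| / σ
  have hs0 : 0 < s := by positivity
  have hs3 : s ^ 3 ≤ (5 * s') ^ 3 := by gcongr
  rw [le_div_iff₀ (by positivity)]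
  calc binomPmf M ε t * (σ * s ^ 3) ≤ binomPmf M ε t * (σ * (5 * s') ^ 3) := by gcongr
    _ = 125 * (σ * binomPmf M ε t * s' ^ 3) := by ring
    _ ≤ 125 * 412800 := by gcongr
    _ = _ := by norm_num

theorem abs_hintBias_sub_le (hε : |ε| ≤ 1 / 2) (hN : 1 ≤ N) (hM : 0 < M) (hσ : 0 < σ)
    (hσ2 : σ ^ 2 ≤ 24 * M) {Y B : ℝ} (hY : |Y| ≤ B * σ)
    (hBM : 4 * ((B + 5) * σ) ≤ M) (hsσ : 4000 * (1 + |Y| / σ) ≤ σ) {t₁ t₂ : ℤ}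
    (h1 : |(t₁ : ℝ) - ε * M + Y| ≤ 4 * σ) (h2 : |(t₂ : ℝ) - ε * M + Y| ≤ 4 * σ) :
    |hintBias M N ε t₁ - hintBias M N ε t₂| ≤
      64000 * (1 + |Y| / σ) / (σ * Real.sqrt N) * |(t₁ : ℝ) - t₂| := by
  obtain ⟨e1, e2⟩ := abs_le.mp hε
  have hI : ε ∈ Set.Icc (-1 : ℝ) 1 := ⟨by linarith, by linarith⟩
  have hM0 : (0 : ℝ) < M := by exact_mod_cast hM
  have hcon : ∀ u : ℤ, |(u : ℝ) - ε * M + Y| ≤ 4 * σ → -(M : ℤ) < u ∧ u ≤ M := by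
    intro u hu
    obtain ⟨u1, u2⟩ := abs_le.mp hu
    obtain ⟨y1, y2⟩ := abs_le.mp hY
    have hεM : |ε * M| ≤ 1 / 2 * M := by
      rw [abs_mul, abs_of_pos hM0]; gcongr
    obtain ⟨m1, m2⟩ := abs_le.mp hεM
    constructor
    · have : -(M : ℝ) < u := by linarith
      exact_mod_cast this
    · have : (u : ℝ) ≤ M := by linarith
      exact_mod_cast this
  wlog h12 : t₁ ≤ t₂ generalizing t₁ t₂
  · rw [abs_sub_comm, abs_sub_comm (t₁ : ℝ)]
    exact this h2 h1 (by omega)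
  have h12' : (t₁ : ℝ) ≤ t₂ := by exact_mod_cast h12
  rw [abs_of_nonneg (sub_nonneg.mpr (hintBias_antitone hI hN h12)), abs_sub_comm,
    abs_of_nonneg (sub_nonneg.mpr h12')]
  have := hintBias_sub_le (s := 5 * (1 + |Y| / σ)) hε hN hM hσ hσ2 h12 (hcon _ h1).1 (hcon _ h2).2
    (fun t ht1 ht2 => by
      have ht1' : (t₁ : ℝ) ≤ t := by exact_mod_cast ht1
      have ht2' : (t : ℝ) ≤ t₂ := by exact_mod_cast ht2
      have ht : |(t : ℝ) - ε * M + Y| ≤ 4 * σ := by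
        obtain ⟨a1, a2⟩ := abs_le.mp h1
        obtain ⟨b1, b2⟩ := abs_le.mp h2
        rw [abs_le]
        constructor <;> linarith
      rw [add_comm] at ht
      exact scale_le hσ ht) (by linarith)
  refine this.trans (le_of_eq ?_)
  ring

end Osc

/-! ### One round: undecided results and the bound by oscillation -/

/-- The winning probability once the current round's coins `v` are known, if the sum of the coins
of the earlier rounds is `b` and `M` coins are tossed in the later rounds. -/
noncomputable def roundValue {r : ℕ} (M : ℕ) (ε : ℝ) (b : ℤ) (v : Fin r → ℤˣ) : ℝ :=
  binomTail M ε (-b - ∑ j, (v j : ℤ))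

/-- The probability of the vector hint `h` once the current round's coins `v` are known. -/
noncomputable def roundHint {r : ℕ} (M N l : ℕ) (ε : ℝ) (b : ℤ) (v : Fin r → ℤˣ)
    (h : Fin l → ℤˣ) : ℝ :=
  coinsProb (hintBias M N ε (-b - ∑ j, (v j : ℤ))) h

/-- A bump of height one and width `n ^ (3 / 2)`. -/
noncomputable def bump (n y : ℝ) : ℝ := 1 / (1 + y ^ 2 / n ^ 3)

theorem bump_nonneg {n : ℝ} (hn : 0 ≤ n) (y : ℝ) : 0 ≤ bump n y := by
  unfold bump; positivity

theorem bump_le_one {n : ℝ} (hn : 0 ≤ n) (y : ℝ) : bump n y ≤ 1 := by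
  unfold bump
  rw [div_le_one (by positivity)]
  have : 0 ≤ y ^ 2 / n ^ 3 := by positivity
  linarith

theorem mul_sqrt_sq {n : ℝ} (hn : 0 ≤ n) : (n * Real.sqrt n) ^ 2 = n ^ 3 := by
  rw [mul_pow, Real.sq_sqrt hn]; ring

theorem inv_scale_sq_le_bump {n : ℝ} (hn : 0 < n) (y : ℝ) :
    1 / (1 + |y| / (n * Real.sqrt n)) ^ 2 ≤ bump n y := by
  unfold bump
  have h0 : 0 < Real.sqrt n := Real.sqrt_pos.mpr hn
  have h1 : y ^ 2 / n ^ 3 = (|y| / (n * Real.sqrt n)) ^ 2 := by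
    rw [div_pow, sq_abs, mul_sqrt_sq hn.le]
  rw [h1]
  have h2 : 0 ≤ |y| / (n * Real.sqrt n) := by positivity
  gcongr
  nlinarith

section Round

variable {r M N l : ℕ} {ε n L : ℝ} {b : ℤ}

theorem roundValue_nonneg (hε : ε ∈ Set.Icc (-1 : ℝ) 1) (v : Fin r → ℤˣ) :
    0 ≤ roundValue M ε b v := binomTail_nonneg hε _ _

theorem roundValue_le_one (hε : ε ∈ Set.Icc (-1 : ℝ) 1) (v : Fin r → ℤˣ) :
    roundValue M ε b v ≤ 1 := binomTail_le_one hε _ _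

theorem roundHint_nonneg (hε : ε ∈ Set.Icc (-1 : ℝ) 1) (hN : 1 ≤ N) (v : Fin r → ℤˣ)
    (h : Fin l → ℤˣ) : 0 ≤ roundHint M N l ε b v h :=
  coinsProb_nonneg (hintBias_mem hε hN _) h

theorem sum_roundHint (v : Fin r → ℤˣ) : ∑ h, roundHint M N l ε b v h = 1 :=
  sum_coinsProb _

open scoped Classical in
theorem sum_atypical_le (hε : ε ∈ Set.Icc (-1 : ℝ) 1) (hn : 0 < n) (hr : (r : ℝ) = n ^ 2)
    (hL : 0 ≤ L) :
    ∑ v : Fin r → ℤˣ, (if |((∑ j, (v j : ℤ) : ℤ) : ℝ) - ε * r| < 4 * n * Real.sqrt L then 0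
      else coinsProb ε v) ≤ 2 * Real.exp (-(2 * L)) := by
  have h := coinExp_abs_tail_le hε r (u := 4 * n * Real.sqrt L) (s := n ^ 2) (by positivity)
    (by positivity) hr.le
  have e : (4 * n * Real.sqrt L) ^ 2 / (8 * n ^ 2) = 2 * L := by
    rw [mul_pow, Real.sq_sqrt hL]; field_simp; ring
  rw [e] at h
  refine le_of_eq_of_le ?_ h
  unfold coinExp
  refine Finset.sum_congr rfl fun v _ => ?_
  by_cases hv : |((∑ j, (v j : ℤ) : ℤ) : ℝ) - ε * r| < 4 * n * Real.sqrt L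
  · simp only [hv, not_le.mpr hv, if_true, if_false, mul_zero]
  · simp only [hv, not_lt.mp hv, if_true, if_false, mul_one]

/-- Typical coins of the round use up at most half of the distance `8 * σ * √L`. By Hoeffding's
inequality, the win probability is then within `exp (-(2 * L))` of 0, or of 1, simultaneously for
all typical values. -/
theorem observationBound_of_far (hε : ε ∈ Set.Icc (-1 : ℝ) 1) (hN : 1 ≤ N) (hn : 1 ≤ n)
    (hr : (r : ℝ) = n ^ 2) (hM : (M : ℝ) ≤ n ^ 3) (hL : 0 ≤ L)
    (hY : 8 * (n * Real.sqrt n) * Real.sqrt L ≤ |(b : ℝ) + ε * (M + r)|) :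
    ObservationBound (coinsProb ε : (Fin r → ℤˣ) → ℝ) (roundHint M N l ε b) (roundValue M ε b)
      0 (9 * Real.exp (-(2 * L))) := by
  classical
  have hn0 : 0 < n := by linarith
  have hσ1 : n ≤ n * Real.sqrt n := le_mul_of_one_le_right hn0.le (Real.one_le_sqrt.mpr hn)
  set σ := n * Real.sqrt n with hσ
  have hσ0 : 0 < σ := by linarith
  have hσ2 : σ ^ 2 = n ^ 3 := mul_sqrt_sq hn0.le
  have hsL : 0 ≤ Real.sqrt L := Real.sqrt_nonneg _
  have hnσL : n * Real.sqrt L ≤ σ * Real.sqrt L := by gcongr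
  have hexp : Real.exp (-((4 * σ * Real.sqrt L) ^ 2 / (8 * σ ^ 2))) = Real.exp (-(2 * L)) := by
    congr 2; rw [mul_pow, Real.sq_sqrt hL]; field_simp; ring
  refine observationBound_of_good
    (fun v => |((∑ j, (v j : ℤ) : ℤ) : ℝ) - ε * r| < 4 * n * Real.sqrt L) (fun _ => False)
    (coinsProb_nonneg hε) (sum_coinsProb ε) (roundHint_nonneg hε hN) sum_roundHint
    (roundValue_nonneg hε) (roundValue_le_one hε) (Real.exp_pos _).le le_rfl
    (sum_atypical_le hε hn0 hr hL) (fun v _ => by simp; positivity) fun h _ hQ => ?_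
  rw [zero_add]
  refine posterior_sub_prior_le_of_osc _ _ _ _ (coinsProb_nonneg hε) (sum_coinsProb ε)
    (fun v => roundHint_nonneg hε hN v h) (roundValue_nonneg hε) (roundValue_le_one hε) hQ
    (Real.exp_pos _).le ?_
  have hcase : (∀ v : Fin r → ℤˣ, |((∑ j, (v j : ℤ) : ℤ) : ℝ) - ε * r| < 4 * n * Real.sqrt L →
      roundValue M ε b v ≤ Real.exp (-(2 * L))) ∨
      (∀ v : Fin r → ℤˣ, |((∑ j, (v j : ℤ) : ℤ) : ℝ) - ε * r| < 4 * n * Real.sqrt L →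
      1 - roundValue M ε b v ≤ Real.exp (-(2 * L))) := by
    rcases le_abs.mp hY with h | h
    · right
      intro v hv
      rw [← hexp]
      refine one_sub_binomTail_le_exp hε (by positivity) (by positivity) (hM.trans hσ2.ge) ?_
      have := (abs_lt.mp hv).1
      push_cast at this ⊢
      linarith
    · left
      intro v hv
      rw [← hexp]
      refine binomTail_le_exp hε (by positivity) (by positivity) (hM.trans hσ2.ge) ?_
      have := (abs_lt.mp hv).2
      push_cast at this ⊢
      linarith
  intro v w hv hw
  have v0 := roundValue_nonneg (M := M) (b := b) hε v
  have w0 := roundValue_nonneg (M := M) (b := b) hε w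
  have v1 := roundValue_le_one (M := M) (b := b) hε v
  have w1 := roundValue_le_one (M := M) (b := b) hε w
  rw [abs_le]
  rcases hcase with h | h
  · have := h v hv
    have := h w hw
    constructor <;> linarith
  · have := h v hv
    have := h w hw
    constructor <;> linarith

theorem observationBound_trivial (hε : ε ∈ Set.Icc (-1 : ℝ) 1) (hN : 1 ≤ N) {δ : ℝ}
    (hδ : 0 ≤ δ) :
    ObservationBound (coinsProb ε : (Fin r → ℤˣ) → ℝ) (roundHint M N l ε b) (roundValue M ε b)
      1 δ :=
  observationBound_one (coinsProb_nonneg hε) (sum_coinsProb ε) (roundHint_nonneg hε hN)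
    (roundValue_nonneg hε) (roundValue_le_one hε) hδ

theorem typical_le_scale (hn : 1 ≤ n) (hnL : L ≤ n) {x : ℝ}
    (hx : |x| < 4 * n * Real.sqrt L) : |x| ≤ 4 * (n * Real.sqrt n) := by
  have : Real.sqrt L ≤ Real.sqrt n := Real.sqrt_le_sqrt hnL
  have : n * Real.sqrt L ≤ n * Real.sqrt n := by gcongr
  linarith

/-- The hint is treated as arbitrary: the slope of order 1 / (σ s³) of the win probability is
multiplied by the spread `8 * n * √L` of typical coins. -/
theorem observationBound_mid (hε : |ε| ≤ 1 / 2) (hN : 1 ≤ N) (hn : 1 ≤ n)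
    (hr : (r : ℝ) = n ^ 2) (hM : (M : ℝ) ≤ n ^ 3) (hM' : n ^ 3 ≤ 24 * M) (hL : 0 ≤ L)
    (hnL : L ≤ n) :
    ObservationBound (coinsProb ε : (Fin r → ℤˣ) → ℝ) (roundHint M N l ε b) (roundValue M ε b)
      (412800000 * Real.sqrt L * (1 / Real.sqrt n) * bump n (b + ε * (M + r)))
      (9 * Real.exp (-(2 * L))) := by
  classical
  obtain ⟨e1, e2⟩ := abs_le.mp hε
  have hI : ε ∈ Set.Icc (-1 : ℝ) 1 := ⟨by linarith, by linarith⟩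
  have hn0 : 0 < n := by linarith
  have hM0 : 0 < M := by
    have : (0 : ℝ) < M := by have : 0 < n ^ 3 := by positivity
                             linarith
    exact_mod_cast this
  have hb := inv_scale_sq_le_bump hn0 ((b : ℝ) + ε * (M + r))
  have hb0 := bump_nonneg hn0.le ((b : ℝ) + ε * (M + r))
  have hsn : 0 < Real.sqrt n := Real.sqrt_pos.mpr hn0
  have hsL : 0 ≤ Real.sqrt L := Real.sqrt_nonneg _
  refine ObservationBound.mono ?_ (mul_le_mul_of_nonneg_left hb (by positivity))
  set Y := (b : ℝ) + ε * (M + r) with hYdef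
  set σ := n * Real.sqrt n with hσ
  have hσ0 : 0 < σ := by positivity
  have hσ2 : σ ^ 2 = n ^ 3 := mul_sqrt_sq hn0.le
  have hs0 : 0 ≤ |Y| / σ := by positivity
  refine observationBound_of_good
    (fun v => |((∑ j, (v j : ℤ) : ℤ) : ℝ) - ε * r| < 4 * n * Real.sqrt L) (fun _ => False)
    (coinsProb_nonneg hI) (sum_coinsProb ε) (roundHint_nonneg hI hN) sum_roundHint
    (roundValue_nonneg hI) (roundValue_le_one hI) (Real.exp_pos _).le (by positivity)
    (sum_atypical_le hI hn0 hr hL) (fun v _ => by simp; positivity) fun h _ hQ => ?_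
  refine posterior_sub_prior_le_of_osc _ _ _ _ (coinsProb_nonneg hI) (sum_coinsProb ε)
    (fun v => roundHint_nonneg hI hN v h) (roundValue_nonneg hI) (roundValue_le_one hI) hQ
    (by positivity) fun v w hv hw => ?_
  have hlip := abs_binomTail_sub_le hε hM0 hσ0 (hM.trans hσ2.ge) (hσ2.le.trans hM') (Y := Y)
    (t₁ := -b - ∑ j, (v j : ℤ)) (t₂ := -b - ∑ j, (w j : ℤ))
    (by
      have := typical_le_scale hn hnL hv
      rw [← abs_neg] at this
      refine le_trans (le_of_eq ?_) this
      congr 1; rw [hYdef]; push_cast; ring)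
    (by
      have := typical_le_scale hn hnL hw
      rw [← abs_neg] at this
      refine le_trans (le_of_eq ?_) this
      congr 1; rw [hYdef]; push_cast; ring)
  have hd : |((-b - ∑ j, (v j : ℤ) : ℤ) : ℝ) - ((-b - ∑ j, (w j : ℤ) : ℤ) : ℝ)| ≤
      8 * n * Real.sqrt L := by
    obtain ⟨v1, v2⟩ := abs_lt.mp hv
    obtain ⟨w1, w2⟩ := abs_lt.mp hw
    rw [abs_le]
    push_cast at v1 v2 w1 w2 ⊢
    constructor <;> linarith
  have hstep : 51600000 / (σ * (1 + |Y| / σ) ^ 3) * (8 * n * Real.sqrt L) ≤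
      412800000 * Real.sqrt L * (1 / Real.sqrt n) * (1 / (1 + |Y| / σ) ^ 2) := by
    have e : 51600000 / (σ * (1 + |Y| / σ) ^ 3) * (8 * n * Real.sqrt L) =
        412800000 * Real.sqrt L * (1 / Real.sqrt n) * (1 / (1 + |Y| / σ) ^ 3) := by
      have : (1 + |Y| / σ) ≠ 0 := by positivity
      generalize 1 + |Y| / σ = s at *
      rw [hσ]; field_simp; ring
    rw [e]
    gcongr
    · linarith
    · norm_num
  calc |roundValue M ε b v - roundValue M ε b w| ≤ _ := hlip
    _ ≤ 51600000 / (σ * (1 + |Y| / σ) ^ 3) * (8 * n * Real.sqrt L) := by gcongr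
    _ ≤ _ := hstep
    _ ≤ _ := le_add_of_nonneg_right (Real.exp_pos _).le

end Round

/-! ### One round: the bound when many rounds remain -/

/-- A lower bound for the range of `log₂ m` in which the asymptotic estimates hold. -/
abbrev logThreshold : ℝ := 256

theorem sqrt_mul_rate_le {L n k : ℝ} (hL : 0 ≤ L) (hk : 0 ≤ k) (hkn : k * L ^ 3 ≤ n) :
    Real.sqrt k * L * Real.sqrt L ≤ Real.sqrt n := by
  apply Real.le_sqrt_of_sq_le
  rw [mul_pow, mul_pow, Real.sq_sqrt hk, Real.sq_sqrt hL]
  linarith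

section Main

variable {n L k σ s : ℝ} {M N : ℕ}

/-- There are `n` rounds left including the current one, `M` coins after it and `N` coins in the
whole game. The condition `k_le` is what keeps the likelihood ratios of typical hints bounded. -/
structure HintRegime (M N : ℕ) (n L k : ℝ) : Prop where
  L_ge : logThreshold ≤ L
  k_ge : 1 ≤ k
  k_le : k * L ^ 3 ≤ n
  M_le : (M : ℝ) ≤ n ^ 3
  le_M : n ^ 3 ≤ 24 * M
  M_le_N : M ≤ N

namespace HintRegime

theorem n_ge (h : HintRegime M N n L k) : L ^ 3 ≤ n := by
  have h1 := h.L_ge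
  have h2 := h.k_ge
  have h3 := h.k_le
  have : 0 ≤ L ^ 3 := by
    have : (0 : ℝ) ≤ L := by linarith [h.L_ge]
    positivity
  nlinarith

theorem L_le (h : HintRegime M N n L k) : L ≤ n := by
  have h1 : (256 : ℝ) ≤ L := h.L_ge
  have h2 := h.n_ge
  have : 1 ≤ L ^ 2 := by nlinarith
  have : L * 1 ≤ L * L ^ 2 := by gcongr
  nlinarith

theorem sqrt_L_ge (h : HintRegime M N n L k) : 16 ≤ Real.sqrt L :=
  Real.le_sqrt_of_sq_le (by have h1 : (256 : ℝ) ≤ L := h.L_ge; linarith)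

/-- The scale `n ^ (3 / 2)` dominates the logarithmic factors. -/
theorem scale_ge (h : HintRegime M N n L k) : 100000000 * L ≤ n * Real.sqrt n := by
  have h1 : (256 : ℝ) ≤ L := h.L_ge
  have h2 := h.n_ge
  have hL0 : 0 ≤ L := by linarith
  have hn0 : 0 ≤ n := le_trans (by positivity) h2
  have h3 : L * 16 ≤ Real.sqrt n := by
    apply Real.le_sqrt_of_sq_le
    nlinarith [pow_nonneg hL0 2]
  have h4 : 256 ^ 2 * L ≤ n := by
    refine le_trans ?_ h2
    have : (256 : ℝ) ^ 2 ≤ L ^ 2 := by gcongr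
    nlinarith
  calc 100000000 * L ≤ (256 ^ 2 * L) * (256 * 16) := by linarith
    _ ≤ n * Real.sqrt n := by
      apply mul_le_mul h4 _ (by norm_num) hn0
      linarith

theorem sqrt_N_ge (h : HintRegime M N n L k) : n * Real.sqrt n ≤ 5 * Real.sqrt N := by
  have h2 := h.n_ge
  have h1 : (256 : ℝ) ≤ L := h.L_ge
  have hn0 : 0 ≤ n := le_trans (by positivity) h2
  have hMN : (M : ℝ) ≤ N := by exact_mod_cast h.M_le_N
  apply abs_le_of_sq_le_sq' _ (by positivity) |>.2
  rw [mul_sqrt_sq hn0, mul_pow, Real.sq_sqrt (by positivity)]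
  have := h.le_M
  have : (0 : ℝ) ≤ N := by positivity
  linarith

theorem N_ge (h : HintRegime M N n L k) : 1024 ≤ N := by
  have h1 := h.sqrt_N_ge
  have h2 := h.scale_ge
  have h3 : (256 : ℝ) ≤ L := h.L_ge
  have h4 : (1024 : ℝ) ≤ Real.sqrt N := by linarith
  have h5 : Real.sqrt N * Real.sqrt N = N := Real.mul_self_sqrt (by positivity)
  have : (1024 : ℝ) ≤ N := by nlinarith
  exact_mod_cast this

theorem N_pos (h : HintRegime M N n L k) : 1 ≤ N := le_trans (by norm_num) h.N_ge

theorem n_ge_one (h : HintRegime M N n L k) : 1 ≤ n := by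
  have h1 : (256 : ℝ) ≤ L := h.L_ge
  linarith [h.L_le]

theorem M_pos (h : HintRegime M N n L k) : 0 < M := by
  have h1 := h.n_ge_one
  have h2 := h.le_M
  have : 0 < n ^ 3 := by positivity
  have : (0 : ℝ) < M := by linarith
  exact_mod_cast this

theorem scale_le_M (h : HintRegime M N n L k) :
    4 * ((12 * Real.sqrt L + 5) * (n * Real.sqrt n)) ≤ M := by
  have h1 := h.sqrt_L_ge
  have h2 := h.scale_ge
  have h3 := h.le_M
  have h4 : (256 : ℝ) ≤ L := h.L_ge
  have hn0 : 0 ≤ n := by linarith [h.n_ge_one]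
  rw [← mul_sqrt_sq hn0] at h3
  have h5 : Real.sqrt L * Real.sqrt L = L := Real.mul_self_sqrt (by linarith)
  have h6 : Real.sqrt L ≤ L := by nlinarith
  set σ := n * Real.sqrt n
  have hσ0 : 0 ≤ σ := by positivity
  have h7 : 96 * (12 * Real.sqrt L + 5) ≤ σ := by linarith
  nlinarith

theorem scale_ge' (h : HintRegime M N n L k) : 800 * (12 * Real.sqrt L + 6) ≤ n * Real.sqrt n := by
  have h1 := h.sqrt_L_ge
  have h2 := h.scale_ge
  have h4 : (256 : ℝ) ≤ L := h.L_ge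
  have h5 : Real.sqrt L * Real.sqrt L = L := Real.mul_self_sqrt (by linarith)
  have h6 : Real.sqrt L ≤ L := by nlinarith
  linarith

theorem abs_hintBias_le_half (h : HintRegime M N n L k) {ε : ℝ} (hε : |ε| ≤ 1 / 2) {t : ℤ}
    (ht : |(t : ℝ) - ε * M| ≤ 12 * Real.sqrt L * (n * Real.sqrt n)) :
    |hintBias M N ε t| ≤ 1 / 2 := by
  have h1 := h.sqrt_L_ge
  have h2 := h.scale_ge
  have h3 := h.sqrt_N_ge
  have h4 : (256 : ℝ) ≤ L := h.L_ge
  have hn0 : 0 ≤ n := by linarith [h.n_ge_one]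
  have hσ : 1 ≤ n * Real.sqrt n := by linarith
  refine (abs_hintBias_le hε h.N_ge h.M_pos hσ ((mul_sqrt_sq hn0).symm ▸ h.M_le)
    ((mul_sqrt_sq hn0).symm ▸ h.le_M) (by positivity) h.scale_le_M h.scale_ge' ht).trans ?_
  have hN : 0 < Real.sqrt N := by linarith
  rw [div_le_iff₀ hN]
  have h5 : Real.sqrt L * Real.sqrt L = L := Real.mul_self_sqrt (by linarith)
  nlinarith

end HintRegime

end Main

/-- Here `d` is the shift of the bias and `ρ` bounds that shift in units of 1 / √l. The exponent of
`coinsProb_ratio` is needed in two forms: linear in `ρ`, to give the Lipschitz constant of the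
likelihood, and bounded by a constant, to control its size. -/
theorem hint_exponent_le {d ρ L R l : ℝ} (hd : 0 ≤ d) (hL : 1 ≤ L) (hl : 0 ≤ l)
    (hdρ : Real.sqrt l * d ≤ ρ) (hρR : ρ * Real.sqrt L ≤ R) :
    2 * d * ((4 + R) * (Real.sqrt l * Real.sqrt L)) + 8 * d ^ 2 * l ≤
        (8 + 10 * R) * Real.sqrt L * ρ ∧ (8 + 10 * R) * Real.sqrt L * ρ ≤ (8 + 10 * R) * R := by
  have hsL : 1 ≤ Real.sqrt L := Real.one_le_sqrt.mpr hL
  have hsl : 0 ≤ Real.sqrt l := Real.sqrt_nonneg l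
  have hρ : 0 ≤ ρ := le_trans (by positivity) hdρ
  have hR : 0 ≤ R := le_trans (by positivity) hρR
  have hρ' : ρ ≤ R := by nlinarith
  have hl2 : Real.sqrt l * Real.sqrt l = l := Real.mul_self_sqrt hl
  constructor
  · have h1 : 2 * d * ((4 + R) * (Real.sqrt l * Real.sqrt L)) ≤ 2 * (4 + R) * Real.sqrt L * ρ := by
      calc _ = 2 * (4 + R) * Real.sqrt L * (Real.sqrt l * d) := by ring
        _ ≤ _ := by gcongr
    have h2 : 8 * d ^ 2 * l ≤ 8 * R * Real.sqrt L * ρ := by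
      calc 8 * d ^ 2 * l = 8 * ((Real.sqrt l * d) * (Real.sqrt l * d)) := by
            linear_combination (-8 * d ^ 2) * hl2
        _ ≤ 8 * (ρ * ρ) := by gcongr
        _ ≤ 8 * (R * (Real.sqrt L * ρ)) := by
            gcongr
            exact le_mul_of_one_le_left hρ hsL
        _ = _ := by ring
    linarith
  · calc _ = (8 + 10 * R) * (ρ * Real.sqrt L) := by ring
      _ ≤ _ := by gcongr

/-- The scaled sensitivity of the hint to the current round's coins. -/
abbrev sensConst : ℝ := 2880000

/-- A bound for the exponent of the likelihood ratios of typical hints. -/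
noncomputable abbrev exponentConst : ℝ := (8 + 10 * sensConst) * sensConst

section

variable {r M N : ℕ} {k : ℕ} {ε n L : ℝ} {b : ℤ}

open scoped Classical in
-- The radius `D` around the reference mean `l * e` leaves room for the shift from the true mean `l
-- * a` and for a deviation of `4 * √l * √L` around it.
theorem sum_bad_hint_le {l : ℕ} {a e D : ℝ} (ha : a ∈ Set.Icc (-1 : ℝ) 1) (hL : 0 ≤ L)
    (hl : 0 < l) (hD : 4 * (Real.sqrt l * Real.sqrt L) + l * |a - e| ≤ D)
    (bad : (Fin l → ℤˣ) → Prop) (hbad : ∀ h, bad h → D < |(∑ j, ((h j : ℤ) : ℝ)) - l * e|) :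
    ∑ h : Fin l → ℤˣ, (if bad h then coinsProb a h else 0) ≤
      2 * Real.exp (-(2 * L)) := by
  have hl0 : (0 : ℝ) < l := by exact_mod_cast hl
  have h := coinExp_abs_tail_le ha l (u := 4 * (Real.sqrt l * Real.sqrt L)) (s := l)
    (by positivity) hl0 le_rfl
  have e1 : (4 * (Real.sqrt l * Real.sqrt L)) ^ 2 / (8 * l) = 2 * L := by
    rw [mul_pow, mul_pow, Real.sq_sqrt hL, Real.sq_sqrt hl0.le]; field_simp; ring
  rw [e1] at h
  refine le_trans ?_ h
  unfold coinExp
  refine Finset.sum_le_sum fun v _ => ?_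
  have hc := coinsProb_nonneg ha v
  by_cases hv : bad v
  swap
  · rw [if_neg hv]
    refine mul_nonneg hc ?_
    beta_reduce
    split_ifs <;> norm_num
  · beta_reduce
    rw [if_pos hv, if_pos, mul_one]
    have h1 : |(∑ j, ((v j : ℤ) : ℝ)) - l * e| ≤
        |(∑ j, ((v j : ℤ) : ℝ)) - a * l| + l * |a - e| := by
      have := abs_add_le ((∑ j, ((v j : ℤ) : ℝ)) - a * l) (l * (a - e))
      rw [abs_mul, abs_of_pos hl0] at this
      refine le_trans (le_of_eq ?_) this
      congr 1; ring
    push_cast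
    linarith [hbad v hv]

/-- Rounding the mean to an integer adds less than one to the variance. -/
theorem coinExp_sq_floor_le (hr : (r : ℝ) = n ^ 2) (hn : 1 ≤ n) :
    ∑ v : Fin r → ℤˣ, coinsProb ε v * |((∑ j, (v j : ℤ) : ℤ) : ℝ) - ⌊ε * r⌋| ^ 2 ≤ 2 * n ^ 2 := by
  have h := coinExp_sq ε r (ε * r - ⌊ε * r⌋)
  have e : (fun x : ℤ => ((x : ℝ) - ε * r + (ε * r - ⌊ε * r⌋)) ^ 2) =
      fun x : ℤ => |(x : ℝ) - ⌊ε * r⌋| ^ 2 := by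
    funext x; rw [sq_abs]; ring
  rw [e] at h
  unfold coinExp at h
  rw [h, hr]
  have h1 := Int.floor_le (ε * n ^ 2)
  have h2 := Int.lt_floor_add_one (ε * n ^ 2)
  nlinarith [sq_nonneg ε, sq_nonneg n]

set_option maxHeartbeats 2000000 in
-- The Lipschitz bound for posteriors, with slope 1 / (σ s³) for the win probability, relative slope
-- √L s √k / σ for the likelihood, and second moment `n ^ 2` of the round's coins. The last factor s
-- is lost to the hint, so s³ becomes s².
theorem observationBound_main_of_near (hR : HintRegime M N n L k) (hε : |ε| ≤ 1 / 2)
    (hr : (r : ℝ) = n ^ 2)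
    (hY : |(b : ℝ) + ε * (M + r)| < 8 * (n * Real.sqrt n) * Real.sqrt L) :
    ObservationBound (coinsProb ε : (Fin r → ℤˣ) → ℝ) (roundHint M N (k * N) ε b)
      (roundValue M ε b)
      ((8 * 51600000 * 64000 * (8 + 10 * sensConst) * Real.exp exponentConst *
        Real.exp exponentConst) * (Real.sqrt L * (Real.sqrt k / n) *
          (1 / (1 + |(b : ℝ) + ε * (M + r)| / (n * Real.sqrt n)) ^ 2)))
      (9 * Real.exp (-(2 * L))) := by
  classical
  obtain ⟨e1, e2⟩ := abs_le.mp hε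
  have hI : ε ∈ Set.Icc (-1 : ℝ) 1 := ⟨by linarith, by linarith⟩
  have hN := hR.N_pos
  have hn := hR.n_ge_one
  have hM0 := hR.M_pos
  have hnL := hR.L_le
  have hL256 : (256 : ℝ) ≤ L := hR.L_ge
  have hL0 : 0 ≤ L := by linarith
  have hL1 : 1 ≤ L := by linarith
  have hsL16 := hR.sqrt_L_ge
  have hn0 : 0 < n := by linarith
  have hk1 := hR.k_ge
  have hk0 : 0 < k := by
    have : (0 : ℝ) < k := by linarith
    exact_mod_cast this
  have hrate := sqrt_mul_rate_le hL0 (by positivity) hR.k_le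
  have hscale := hR.scale_ge
  have hscaleN := hR.sqrt_N_ge
  have hscaleM := hR.scale_le_M
  have hσ2 : (n * Real.sqrt n) ^ 2 = n ^ 3 := mul_sqrt_sq hn0.le
  have hsn : 0 < Real.sqrt n := Real.sqrt_pos.mpr hn0
  have hsk : 1 ≤ Real.sqrt k := Real.one_le_sqrt.mpr hk1
  have hN0 : (0 : ℝ) < N := by exact_mod_cast hN
  have hsN : 0 < Real.sqrt N := Real.sqrt_pos.mpr hN0
  have hhalf := fun t ht => hR.abs_hintBias_le_half hε (t := t) ht
  set Y := (b : ℝ) + ε * (M + r) with hYdef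
  set σ := n * Real.sqrt n with hσ
  have hσ0 : 0 < σ := by positivity
  have hs1 : 0 ≤ |Y| / σ := by positivity
  have hs9 : 1 + |Y| / σ ≤ 9 * Real.sqrt L := by
    have : |Y| / σ ≤ 8 * Real.sqrt L := by
      rw [div_le_iff₀ hσ0]; linarith
    linarith
  set s := 1 + |Y| / σ with hs
  have hs0 : 0 < s := by positivity
  have hsL : Real.sqrt L * Real.sqrt L = L := Real.mul_self_sqrt hL0
  have hsL1 : 1 ≤ Real.sqrt L := by linarith
  have hsLL : Real.sqrt L ≤ L :=
    (le_mul_of_one_le_right (Real.sqrt_nonneg L) hsL1).trans hsL.le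
  have hnL1 : 1 ≤ n * Real.sqrt L := one_le_mul_of_one_le_of_one_le hn hsL1
  have hσsL : σ ≤ σ * Real.sqrt L := le_mul_of_one_le_right hσ0.le hsL1
  -- typical outcomes
  set c₀ := ⌊ε * r⌋ with hc₀
  have hc1 : (c₀ : ℝ) ≤ ε * r := Int.floor_le _
  have hc2 : ε * r < c₀ + 1 := Int.lt_floor_add_one _
  set t₀ : ℤ := -b - c₀ with ht₀
  set X : (Fin r → ℤˣ) → ℤ := fun v => ∑ j, (v j : ℤ) with hX
  set T : (Fin r → ℤˣ) → Prop := fun v => |(X v : ℝ) - ε * r| < 4 * n * Real.sqrt L with hT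
  have hshift0 : |(t₀ : ℝ) - ε * M + Y| ≤ 4 * σ := by
    have : (t₀ : ℝ) - ε * M + Y = ε * r - c₀ := by rw [ht₀, hYdef]; push_cast; ring
    rw [this, abs_le]
    constructor <;> linarith
  have hshift : ∀ v, T v → |((-b - X v : ℤ) : ℝ) - ε * M + Y| ≤ 4 * σ := by
    intro v hv
    have := typical_le_scale hn hnL hv
    rw [← abs_neg] at this
    refine le_trans (le_of_eq ?_) this
    congr 1; rw [hYdef]; push_cast; ring
  have hrange : ∀ t : ℤ, |(t : ℝ) - ε * M + Y| ≤ 4 * σ →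
      |(t : ℝ) - ε * M| ≤ 12 * Real.sqrt L * σ := by
    intro t ht
    have h1 : |(t : ℝ) - ε * M| ≤ |(t : ℝ) - ε * M + Y| + |Y| := by
      have := abs_sub ((t : ℝ) - ε * M + Y) Y
      rwa [add_sub_cancel_right] at this
    linarith
  set a : (Fin r → ℤˣ) → ℝ := fun v => |(X v : ℝ) - c₀| with ha
  have ha0 : ∀ v, 0 ≤ a v := fun v => abs_nonneg _
  have haT : ∀ v, T v → a v ≤ 5 * (n * Real.sqrt L) := by
    intro v hv
    obtain ⟨v1, v2⟩ := abs_lt.mp hv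
    simp only [ha]
    rw [abs_le]
    constructor <;> linarith
  -- sensitivity of the hint
  set Λ := 64000 * s * Real.sqrt k / σ with hΛ
  have hΛ0 : 0 ≤ Λ := by positivity
  have hYB : |Y| ≤ 12 * Real.sqrt L * σ := by linarith
  have hsσ : 4000 * s ≤ σ := by linarith
  have hsql : Real.sqrt ((k * N : ℕ) : ℝ) = Real.sqrt k * Real.sqrt N := by
    push_cast; exact Real.sqrt_mul (by positivity) _
  have hδ : ∀ v, T v → Real.sqrt ((k * N : ℕ) : ℝ) *
      |hintBias M N ε (-b - X v) - hintBias M N ε t₀| ≤ Λ * a v := by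
    intro v hv
    have h := abs_hintBias_sub_le hε hN hM0 hσ0 (hσ2.le.trans hR.le_M) hYB hscaleM hsσ
      (hshift v hv) hshift0
    have e : |((-b - X v : ℤ) : ℝ) - (t₀ : ℝ)| = a v := by
      simp only [ha, ht₀]
      rw [← abs_neg]; congr 1; push_cast; ring
    rw [e] at h
    rw [hsql]
    calc _ ≤ Real.sqrt k * Real.sqrt N * (64000 * s / (σ * Real.sqrt N) * a v) := by gcongr
      _ = _ := by rw [hΛ]; field_simp
  -- The only place where `k * L ^ 3 ≤ n` limits the sensitivity: `s ≤ 9 * √L`, `a v ≤ 5 * n * √L`,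
  -- and 2880000 = 64000 · 9 · 5.
  have hρ : ∀ v, T v → Λ * a v * Real.sqrt L ≤ sensConst := by
    intro v hv
    calc Λ * a v * Real.sqrt L
        ≤ (64000 * (9 * Real.sqrt L) * Real.sqrt k / σ) * (5 * (n * Real.sqrt L)) *
          Real.sqrt L := by
          rw [hΛ]
          have := haT v hv
          have := ha0 v
          gcongr
      _ = 2880000 * (Real.sqrt k * (Real.sqrt L * Real.sqrt L) * Real.sqrt L / Real.sqrt n) := by
          rw [hσ]; field_simp; ring
      _ ≤ 2880000 * 1 := by
          rw [hsL]
          gcongr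
          rw [div_le_one hsn]
          exact hrate
      _ = _ := by norm_num
  have hsql1 : 1000000000 ≤ Real.sqrt ((k * N : ℕ) : ℝ) := by
    rw [hsql]
    have : 1000000000 ≤ Real.sqrt N := by linarith
    exact this.trans (le_mul_of_one_le_left hsN.le hsk)
  have hδ4 : ∀ v, T v → |hintBias M N ε (-b - X v) - hintBias M N ε t₀| ≤ 1 / 4 := by
    intro v hv
    have h1 := hδ v hv
    have h2 := hρ v hv
    have h3 : Λ * a v ≤ 2880000 := by
      have := mul_nonneg hΛ0 (ha0 v)
      exact (le_mul_of_one_le_right this hsL1).trans h2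
    have := mul_le_mul_of_nonneg_right hsql1
      (abs_nonneg (hintBias M N ε (-b - X v) - hintBias M N ε t₀))
    linarith
  have hl0 : (0 : ℝ) ≤ ((k * N : ℕ) : ℝ) := by positivity
  have hlpos : 0 < k * N := Nat.mul_pos hk0 hN
  have hlsq : Real.sqrt ((k * N : ℕ) : ℝ) * Real.sqrt ((k * N : ℕ) : ℝ) = ((k * N : ℕ) : ℝ) :=
    Real.mul_self_sqrt hl0
  have hexp := fun v (hv : T v) =>
    hint_exponent_le (abs_nonneg _) hL1 hl0 (hδ v hv) (hρ v hv)
  set D := (4 + sensConst) * (Real.sqrt ((k * N : ℕ) : ℝ) * Real.sqrt L) with hD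
  set E := Real.exp exponentConst with hE
  have hE0 : 0 < E := Real.exp_pos _
  have h0half := hhalf t₀ (hrange _ hshift0)
  refine observationBound_of_good T
    (fun h => ¬ |(∑ j, ((h j : ℤ) : ℝ)) - ((k * N : ℕ) : ℝ) * hintBias M N ε t₀| ≤ D)
    (coinsProb_nonneg hI) (sum_coinsProb ε) (roundHint_nonneg hI hN) sum_roundHint
    (roundValue_nonneg hI) (roundValue_le_one hI) (Real.exp_pos _).le (by positivity)
    (sum_atypical_le hI hn0 hr hL0) (fun v hv => ?_) fun h hh hQ => ?_
  · refine sum_bad_hint_le (hintBias_mem (M := M) hI hN (-b - X v)) hL0 hlpos ?_ _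
      fun h hh => not_le.mp hh
    have h1 := hδ v hv
    have h2 := hρ v hv
    have h3 : ((k * N : ℕ) : ℝ) * |hintBias M N ε (-b - X v) - hintBias M N ε t₀| ≤
        Real.sqrt ((k * N : ℕ) : ℝ) * (Λ * a v) := by
      calc _ = Real.sqrt ((k * N : ℕ) : ℝ) * (Real.sqrt ((k * N : ℕ) : ℝ) *
            |hintBias M N ε (-b - X v) - hintBias M N ε t₀|) := by
            rw [← mul_assoc, hlsq]
        _ ≤ _ := by gcongr
    have h4 : Λ * a v ≤ sensConst * Real.sqrt L := by
      have := mul_nonneg hΛ0 (ha0 v)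
      have h5 : Λ * a v ≤ Λ * a v * Real.sqrt L := le_mul_of_one_le_right this (by linarith)
      have h6 : sensConst ≤ sensConst * Real.sqrt L :=
        le_mul_of_one_le_right (by norm_num) (by linarith)
      linarith
    have h5 : Real.sqrt ((k * N : ℕ) : ℝ) * (Λ * a v) ≤
        Real.sqrt ((k * N : ℕ) : ℝ) * (sensConst * Real.sqrt L) := by gcongr
    rw [hD]
    linarith
  · have hgood := not_not.mp hh
    have hcard : ((Fintype.card (Fin (k * N)) : ℕ) : ℝ) = ((k * N : ℕ) : ℝ) := by
      rw [Fintype.card_fin]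
    have hgood' : |(∑ j, ((h j : ℤ) : ℝ)) -
        ((Fintype.card (Fin (k * N)) : ℕ) : ℝ) * hintBias M N ε t₀| ≤ D := by rwa [hcard]
    have hq0pos : 0 < coinsProb (hintBias M N ε t₀) h := by
      obtain ⟨b1, b2⟩ := abs_le.mp h0half
      refine Finset.prod_pos fun j _ => ?_
      unfold coinProb
      rcases Int.units_eq_one_or (h j) with e | e <;> rw [e] <;> norm_num <;> linarith
    have hprob : ∑ v, (if T v then coinsProb ε v else 0) =
        1 - ∑ v, if T v then 0 else coinsProb ε v := by
      rw [eq_sub_iff_add_eq, ← Finset.sum_add_distrib, ← sum_coinsProb (ι := Fin r) ε]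
      exact Finset.sum_congr rfl fun v _ => by split_ifs <;> simp
    have hη : Real.exp (-(2 * L)) ≤ 1 / 4 := by
      refine le_trans (Real.exp_le_exp.mpr (by linarith)) exp_neg_two_lt.le
    have hmain := posterior_sub_prior_le_of_lipschitz (coinsProb ε)
      (fun v => roundHint M N (k * N) ε b v h) (roundValue M ε b) a T (coinsProb_nonneg hI)
      (sum_coinsProb ε) (fun v => roundHint_nonneg hI hN v h) (roundValue_nonneg hI)
      (roundValue_le_one hI) hQ (A := 51600000 / (σ * s ^ 3))
      (β := (8 + 10 * sensConst) * Real.sqrt L * Λ * E) (γ := E⁻¹)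
      (q₀ := coinsProb (hintBias M N ε t₀) h) (S := 2 * n ^ 2) (by positivity) (by positivity)
      (by positivity) hq0pos ha0
      (fun v w hv hw => by
        have h1 := abs_binomTail_sub_le hε hM0 hσ0 (hR.M_le.trans hσ2.ge)
          (hσ2.le.trans hR.le_M) (hshift v hv) (hshift w hw)
        refine h1.trans (mul_le_mul_of_nonneg_left ?_ (by positivity))
        have := abs_sub_le (X w : ℝ) c₀ (X v)
        rw [abs_sub_comm (c₀ : ℝ)] at this
        have e : |((-b - X v : ℤ) : ℝ) - ((-b - X w : ℤ) : ℝ)| = |(X w : ℝ) - X v| := by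
          congr 1; push_cast; ring
        rw [e]
        simp only [ha]
        linarith)
      (fun v hv => by
        obtain ⟨h1, h2⟩ := hexp v hv
        have h3 := abs_coinsProb_sub_le (X := exponentConst) h0half (hδ4 v hv) h hgood' (by
          rw [hcard, ← sq_abs]
          exact h1.trans h2)
        refine h3.trans ?_
        rw [hcard, ← sq_abs (hintBias M N ε (-b - X v) - hintBias M N ε t₀)]
        calc _ ≤ ((8 + 10 * sensConst) * Real.sqrt L * (Λ * a v)) * Real.exp exponentConst *
              coinsProb (hintBias M N ε t₀) h := by
              gcongr
          _ = _ := by ring)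
      (fun v hv => by
        obtain ⟨h1, h2⟩ := hexp v hv
        have h3 := (coinsProb_ratio h0half (hδ4 v hv) h hgood').2
        refine le_trans ?_ h3
        refine mul_le_mul_of_nonneg_right ?_ hq0pos.le
        rw [hE, ← Real.exp_neg, hcard, ← sq_abs (hintBias M N ε (-b - X v) - hintBias M N ε t₀)]
        exact Real.exp_le_exp.mpr (neg_le_neg (h1.trans h2)))
      (by
        rw [hprob]
        have := sum_atypical_le (n := n) hI hn0 hr hL0
        linarith)
      (coinExp_sq_floor_le hr hn)
    refine hmain.trans ?_
    -- The power count: 1 / (σ s³) · √L s √k / σ · n², with σ² = n³.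
    have hval : 4 * (51600000 / (σ * s ^ 3)) * ((8 + 10 * sensConst) * Real.sqrt L * Λ * E) *
        (2 * n ^ 2) / E⁻¹ = (8 * 51600000 * 64000 * (8 + 10 * sensConst) * E * E) *
        (Real.sqrt L * (Real.sqrt k / n) * (1 / s ^ 2)) := by
      have hσ3 : σ * σ = n ^ 3 := by rw [← hσ2]; ring
      rw [hΛ]
      have : 4 * (51600000 / (σ * s ^ 3)) * ((8 + 10 * sensConst) * Real.sqrt L *
          (64000 * s * Real.sqrt k / σ) * E) * (2 * n ^ 2) / E⁻¹ =
          8 * 51600000 * 64000 * (8 + 10 * sensConst) * E * E * (Real.sqrt L * Real.sqrt k) *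
            (n ^ 2 / (σ * σ)) * (1 / s ^ 2) := by
        field_simp
        ring
      rw [this, hσ3]
      field_simp
    rw [hval]
    have := (Real.exp_pos (-(2 * L))).le
    gcongr
    linarith

end

/-- Once many rounds remain, a vector hint changes the winning probability only slightly. -/
theorem exists_observationBound_main : ∃ K : ℝ, 0 < K ∧ ∀ (r M N k : ℕ) (ε n L : ℝ) (b : ℤ),
    HintRegime M N n L k → |ε| ≤ 1 / 2 → (r : ℝ) = n ^ 2 →
    ObservationBound (coinsProb ε : (Fin r → ℤˣ) → ℝ) (roundHint M N (k * N) ε b)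
      (roundValue M ε b) (K * Real.sqrt L * (Real.sqrt k / n) * bump n (b + ε * (M + r)))
      (9 * Real.exp (-(2 * L))) := by
  refine ⟨8 * 51600000 * 64000 * (8 + 10 * sensConst) * Real.exp exponentConst *
    Real.exp exponentConst, by positivity, fun r M N k ε n L b hR hε hr => ?_⟩
  have hn := hR.n_ge_one
  have hn0 : 0 < n := by linarith
  have hL0 : 0 ≤ L := by have : (256 : ℝ) ≤ L := hR.L_ge
                         linarith
  obtain ⟨e1, e2⟩ := abs_le.mp hε
  have hb0 := bump_nonneg hn0.le ((b : ℝ) + ε * (M + r))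
  rcases le_or_gt (8 * (n * Real.sqrt n) * Real.sqrt L) |(b : ℝ) + ε * (M + r)| with h | h
  · exact (observationBound_of_far ⟨by linarith, by linarith⟩ hR.N_pos hn hr hR.M_le hL0 h).mono
      (by positivity)
  · refine (observationBound_main_of_near hR hε hr h).mono ?_
    rw [← mul_assoc (_ * _) _ (1 / _), ← mul_assoc (_ * _) (Real.sqrt L)]
    gcongr
    exact inv_scale_sq_le_bump hn0 _

/-! ### Resampling coordinates of product distributions -/

section Resample

variable {ι : Type*} [Fintype ι] [DecidableEq ι] {X : ι → Type*} [∀ i, Fintype (X i)]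

/-- One coordinate of a product distribution can be resampled. -/
theorem sum_prod_mul_eq_sum_update (p : ∀ i, X i → ℝ) (i : ι) (hi : ∑ y, p i y = 1)
    (Φ : (∀ i, X i) → ℝ) :
    ∑ x : ∀ i, X i, (∏ j, p j (x j)) * Φ x =
      ∑ x : ∀ i, X i, (∏ j, p j (x j)) * ∑ y, p i y * Φ (Function.update x i y) := by
  have h1 : ∑ x : ∀ i, X i, (∏ j, p j (x j)) * ∑ y, p i y * Φ (Function.update x i y) =
      ∑ z : (∀ i, X i) × X i, (∏ j, p j (z.1 j)) * p i z.2 * Φ (Function.update z.1 i z.2) := by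
    rw [Fintype.sum_prod_type]
    refine Finset.sum_congr rfl fun x _ => ?_
    rw [Finset.mul_sum]
    exact Finset.sum_congr rfl fun y _ => by ring
  have h2 : ∑ x : ∀ i, X i, (∏ j, p j (x j)) * Φ x =
      ∑ z : (∀ i, X i) × X i, (∏ j, p j (z.1 j)) * p i z.2 * Φ z.1 := by
    rw [Fintype.sum_prod_type]
    refine Finset.sum_congr rfl fun x _ => ?_
    simp only
    rw [← Finset.sum_mul, ← Finset.mul_sum, hi, mul_one]
  -- Swapping coordinate `i` with an independent fresh copy preserves the product weight.
  let τ : (∀ i, X i) × X i → (∀ i, X i) × X i := fun z => (Function.update z.1 i z.2, z.1 i)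
  have hτ : Function.Involutive τ := by
    rintro ⟨x, y⟩
    simp [τ]
  rw [h1, h2]
  refine Fintype.sum_equiv hτ.toPerm _ _ ?_
  rintro ⟨x, y⟩
  change (∏ j, p j (x j)) * p i y * Φ x = (∏ j, p j (Function.update x i y j)) * p i (x i) *
    Φ (Function.update (Function.update x i y) i (x i))
  rw [Function.update_idem, Function.update_eq_self]
  congr 1
  rw [← Finset.mul_prod_erase Finset.univ _ (Finset.mem_univ i),
    ← Finset.mul_prod_erase Finset.univ (fun j => p j (Function.update x i y j))
      (Finset.mem_univ i), Function.update_self]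
  have : ∏ j ∈ Finset.univ.erase i, p j (Function.update x i y j) =
      ∏ j ∈ Finset.univ.erase i, p j (x j) := by
    refine Finset.prod_congr rfl fun j hj => ?_
    rw [Function.update_of_ne (Finset.ne_of_mem_erase hj)]
  rw [this]
  ring

theorem sum_prod_eq_one (p : ∀ i, X i → ℝ) (hp : ∀ i, ∑ y, p i y = 1) :
    ∑ x : ∀ i, X i, ∏ j, p j (x j) = 1 := by
  rw [← Fintype.prod_sum]
  exact Finset.prod_eq_one fun i _ => hp i

theorem sum_prod_mul_eq_single (p : ∀ i, X i → ℝ) (hp : ∀ i, ∑ y, p i y = 1) (i : ι)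
    (φ : X i → ℝ) :
    ∑ x : ∀ i, X i, (∏ j, p j (x j)) * φ (x i) = ∑ y, p i y * φ y := by
  rw [sum_prod_mul_eq_sum_update p i (hp i)]
  simp only [Function.update_self]
  rw [← Finset.sum_mul, sum_prod_eq_one p hp, one_mul]

/-- The expectation of a function that depends on the coordinates in `s` only depends on the
marginal distributions of these coordinates. -/
theorem sum_prod_mul_congr (s : ι → Prop) [DecidablePred s] (p p' : ∀ i, X i → ℝ)
    (hp : ∀ i, ∑ y, p i y = 1) (hp' : ∀ i, ∑ y, p' i y = 1) (hpp : ∀ i, s i → p i = p' i)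
    (A : (∀ i, X i) → ℝ) (hA : ∀ x y, (∀ i, s i → x i = y i) → A x = A y) :
    ∑ x : ∀ i, X i, (∏ j, p j (x j)) * A x = ∑ x : ∀ i, X i, (∏ j, p' j (x j)) * A x := by
  let e := Equiv.piEquivPiSubtypeProd s X
  have hs : ∀ (q : ∀ i, X i → ℝ), ∑ x : ∀ i, X i, (∏ j, q j (x j)) * A x =
      ∑ y : ∀ i : {i // s i}, X i, (∏ j : {i // s i}, q j (y j)) *
        ∑ z : ∀ i : {i // ¬ s i}, X i, (∏ j : {i // ¬ s i}, q j (z j)) * A (e.symm (y, z)) := by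
    intro q
    rw [← e.symm.sum_comp, Fintype.sum_prod_type]
    refine Finset.sum_congr rfl fun y _ => ?_
    rw [Finset.mul_sum]
    refine Finset.sum_congr rfl fun z _ => ?_
    rw [← mul_assoc]
    congr 1
    rw [← Fintype.prod_subtype_mul_prod_subtype s]
    congr 1
    · refine Finset.prod_congr rfl fun j _ => ?_
      simp [e, Equiv.piEquivPiSubtypeProd, j.2]
    · refine Finset.prod_congr rfl fun j _ => ?_
      simp [e, Equiv.piEquivPiSubtypeProd, j.2]
  rw [hs, hs]
  refine Finset.sum_congr rfl fun y _ => ?_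
  congr 1
  · exact Finset.prod_congr rfl fun j _ => by rw [hpp j j.2]
  · rcases isEmpty_or_nonempty (∀ i : {i // ¬ s i}, X i) with h | ⟨⟨z₀⟩⟩
    · simp
    · have hc : ∀ z, A (e.symm (y, z)) = A (e.symm (y, z₀)) := by
        intro z
        refine hA _ _ fun i hi => ?_
        simp [e, Equiv.piEquivPiSubtypeProd, hi]
      simp only [hc]
      rw [← Finset.sum_mul, ← Finset.sum_mul,
        sum_prod_eq_one (fun i : {i // ¬ s i} => p i) (fun i => hp i),
        sum_prod_eq_one (fun i : {i // ¬ s i} => p' i) (fun i => hp' i)]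

end Resample

/-! ### The joint law of the coins and hints -/

section GameLaw

/-- The coins of all rounds of the game. -/
abbrev Coins (m : ℕ) : Type := (i : Fin m) → Fin (roundSize m ((i : ℕ) + 1)) → ℤˣ

/-- The sum of the coins of the first `t` rounds. -/
def coinSum {m : ℕ} (x : Coins m) (t : ℕ) : ℤ :=
  ∑ i : Fin m, if (i : ℕ) < t then ∑ j, (x i j : ℤ) else 0

variable {m : ℕ} {H : Type} [Fintype H] {ε : ℝ} {f : HintFunction m H}

/-- The expectation of a function of all coins of the game. -/
noncomputable def coinsExp (ε : ℝ) (Φ : Coins m → ℝ) : ℝ :=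
  ∑ x : Coins m, (∏ i, coinsProb ε (x i)) * Φ x

/-- The expectation of a function of the outcome of the game. -/
noncomputable def gameExp (ε : ℝ) (f : HintFunction m H) (Ψ : Outcome m H → ℝ) : ℝ :=
  ∑ ω, gameProb ε f ω * Ψ ω

theorem coinSum_zero (x : Coins m) : coinSum x 0 = 0 := by simp [coinSum]

theorem coinSum_succ (x : Coins m) (i : Fin m) :
    coinSum x ((i : ℕ) + 1) = coinSum x i + ∑ j, (x i j : ℤ) := by
  unfold coinSum
  have : ∑ j, (x i j : ℤ) = ∑ k : Fin m, if k = i then ∑ j, (x k j : ℤ) else 0 := by simp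
  rw [this, ← Finset.sum_add_distrib]
  refine Finset.sum_congr rfl fun k _ => ?_
  rcases lt_trichotomy k i with h | h | h
  · have h' : (k : ℕ) < i := h
    rw [if_pos (by omega), if_pos h', if_neg h.ne, add_zero]
  · subst h; simp
  · have h' : (i : ℕ) < k := h
    rw [if_neg (by omega), if_neg (by omega), if_neg h.ne', add_zero]

theorem coinSum_update (x : Coins m) (i : Fin m) (y) {t : ℕ} (h : t ≤ i) :
    coinSum (Function.update x i y) t = coinSum x t := by
  unfold coinSum
  refine Finset.sum_congr rfl fun k _ => ?_
  split_ifs with hk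
  · rw [Function.update_of_ne]
    rintro rfl
    omega
  · rfl

theorem coinsExp_resample (i : Fin m) (Φ : Coins m → ℝ) :
    coinsExp ε Φ =
      coinsExp ε fun x => ∑ y, coinsProb ε y * Φ (Function.update x i y) :=
  sum_prod_mul_eq_sum_update (fun _ => coinsProb ε) i (sum_coinsProb ε) Φ

theorem coinsExp_nonneg (hε : ε ∈ Set.Icc (-1 : ℝ) 1) {Φ : Coins m → ℝ} (h : ∀ x, 0 ≤ Φ x) :
    0 ≤ coinsExp ε Φ :=
  Finset.sum_nonneg fun x _ =>
    mul_nonneg (Finset.prod_nonneg fun _ _ => coinsProb_nonneg hε _) (h x)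

theorem coinsExp_mono (hε : ε ∈ Set.Icc (-1 : ℝ) 1) {Φ Ψ : Coins m → ℝ} (h : ∀ x, Φ x ≤ Ψ x) :
    coinsExp ε Φ ≤ coinsExp ε Ψ :=
  Finset.sum_le_sum fun x _ =>
    mul_le_mul_of_nonneg_left (h x) (Finset.prod_nonneg fun _ _ => coinsProb_nonneg hε _)

theorem coinsExp_const (a : ℝ) : coinsExp ε (fun _ : Coins m => a) = a := by
  unfold coinsExp
  rw [← Finset.sum_mul, sum_prod_eq_one (fun _ : Fin m => coinsProb ε) fun _ => sum_coinsProb ε,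
    one_mul]

theorem coinsExp_mul_const (Φ : Coins m → ℝ) (a : ℝ) :
    coinsExp ε (fun x => Φ x * a) = coinsExp ε Φ * a := by
  unfold coinsExp
  rw [Finset.sum_mul]
  exact Finset.sum_congr rfl fun x _ => by ring

/-- The number of coins tossed in the rounds with (zero-based) index in `[t, t')`. -/
def blockSize (m t t' : ℕ) : ℕ := ∑ j ∈ Finset.Ico t t', roundSize m (j + 1)

theorem blockSize_self (m t : ℕ) : blockSize m t t = 0 := by simp [blockSize]

theorem blockSize_succ {m t t' : ℕ} (h : t ≤ t') :
    blockSize m t (t' + 1) = blockSize m t t' + roundSize m (t' + 1) :=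
  Finset.sum_Ico_succ_top h _

theorem blockSize_eq_remSize (m t : ℕ) : blockSize m t m = remSize m (t + 1) := by
  unfold blockSize remSize
  rw [← Finset.Ico_add_one_right_eq_Icc,
    ← Finset.sum_Ico_add' (fun j => roundSize m j) t m 1]

/-- The coins of later rounds are independent of those of the first `t` rounds. -/
theorem coinsExp_mul_future {t t' : ℕ} (htt' : t ≤ t') (ht' : t' ≤ m) (F : Coins m → ℝ)
    (hF : ∀ (x : Coins m) (i : Fin m) y, t ≤ (i : ℕ) → F (Function.update x i y) = F x) (g : ℤ → ℝ) :
    coinsExp ε (fun x => F x * g (coinSum x t')) =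
      coinsExp ε fun x => F x * coinExp ε (blockSize m t t') fun c => g (coinSum x t + c) := by
  induction t', htt' using Nat.le_induction generalizing g with
  | base => simp [blockSize_self, coinExp_zero]
  | succ t' htt' ih =>
    let i : Fin m := ⟨t', ht'⟩
    have h1 : coinsExp ε (fun x => F x * g (coinSum x (t' + 1))) =
        coinsExp ε fun x => F x * coinExp ε (roundSize m (t' + 1))
          fun c => g (coinSum x t' + c) := by
      rw [coinsExp_resample i]
      congr 1
      funext x
      unfold coinExp
      rw [Finset.mul_sum]
      refine Finset.sum_congr rfl fun y _ => ?_
      have e := coinSum_succ (Function.update x i y) i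
      rw [Function.update_self, coinSum_update x i y le_rfl] at e
      rw [hF x i y htt']
      change coinsProb ε y * (F x * g (coinSum (Function.update x i y) ((i : ℕ) + 1))) = _
      rw [e]
      ring
    rw [h1, ih (by omega) (fun s => coinExp ε (roundSize m (t' + 1)) fun c => g (s + c)),
      blockSize_succ htt']
    congr 1
    funext x
    rw [coinExp_add]
    simp only [add_assoc]

theorem coinsExp_coinSum {t : ℕ} (ht : t ≤ m) (g : ℤ → ℝ) :
    coinsExp ε (fun x : Coins m => g (coinSum x t)) = coinExp ε (blockSize m 0 t) g := by
  have h := coinsExp_mul_future (ε := ε) (Nat.zero_le t) ht (fun _ => 1) (fun _ _ _ _ => rfl) g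
  simp only [one_mul, coinSum_zero, zero_add] at h
  rw [h, coinsExp_const]

theorem gameExp_eq (Ψ : Outcome m H → ℝ) :
    gameExp ε f Ψ = coinsExp ε fun x =>
      ∑ h : Fin m → H, (∏ i : Fin m, f i (coinSum x i) (∑ j, (x i j : ℤ)) (h i)) * Ψ (x, h) := by
  unfold gameExp coinsExp
  rw [Fintype.sum_prod_type]
  refine Finset.sum_congr rfl fun x _ => ?_
  rw [Finset.mul_sum]
  refine Finset.sum_congr rfl fun h _ => ?_
  rw [← mul_assoc]
  rfl

end GameLaw

/-! ### Stopping rules and the reduction to single rounds -/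

section Stopping

variable {m : ℕ} {H : Type}

theorem abortProb_mem (B : Player m H) (ω : Outcome m H) (i : Fin m) :
    abortProb B ω i ∈ Set.Icc (0 : ℝ) 1 := (B i _).2

/-- The probability, over the player's randomness, that it stops in round `i`. -/
noncomputable def stopProb (B : Player m H) (i : Fin m) (ω : Outcome m H) : ℝ :=
  (∏ j ∈ Finset.Iio i, (1 - abortProb B ω j)) * abortProb B ω i

theorem stopProb_nonneg (B : Player m H) (i : Fin m) (ω : Outcome m H) : 0 ≤ stopProb B i ω :=
  mul_nonneg (Finset.prod_nonneg fun j _ => by linarith [(abortProb_mem B ω j).2])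
    (abortProb_mem B ω i).1

theorem sum_stopProb_le_one (B : Player m H) (ω : Outcome m H) :
    ∑ i, stopProb B i ω ≤ 1 := by
  have h := Finset.prod_one_sub_ordered Finset.univ (fun i => abortProb B ω i)
  have h2 : 0 ≤ ∏ i, (1 - abortProb B ω i) :=
    Finset.prod_nonneg fun j _ => by linarith [(abortProb_mem B ω j).2]
  have h3 : ∑ i, stopProb B i ω =
      ∑ i, abortProb B ω i * ∏ j ∈ Finset.univ with j < i, (1 - abortProb B ω j) := by
    refine Finset.sum_congr rfl fun i _ => ?_
    rw [stopProb, mul_comm]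
    congr 2
    ext j
    simp
  rw [h] at h2
  linarith

theorem stopProb_le_one (B : Player m H) (i : Fin m) (ω : Outcome m H) : stopProb B i ω ≤ 1 :=
  (Finset.single_le_sum (f := fun i => stopProb B i ω) (fun i _ => stopProb_nonneg B i ω)
    (Finset.mem_univ i)).trans (sum_stopProb_le_one B ω)

end Stopping

section GameValues

variable {m : ℕ} {H : Type} [Fintype H] {ε : ℝ} {f : HintFunction m H}

/-- `f` returns a probability distribution on every input. -/
structure HintFunction.IsProb (f : HintFunction m H) : Prop where
  nonneg : ∀ i b c h, 0 ≤ f i b c h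
  sum_eq : ∀ i b c, ∑ h, f i b c h = 1

theorem gameExp_single (hf : f.IsProb) (i : Fin m) (Ψ : Coins m → H → ℝ) :
    gameExp ε f (fun ω => Ψ ω.1 (ω.2 i)) = coinsExp ε fun x =>
      ∑ h, f i (coinSum x i) (∑ j, (x i j : ℤ)) h * Ψ x h := by
  classical
  rw [gameExp_eq]
  congr 1
  funext x
  exact sum_prod_mul_eq_single (fun i : Fin m => f i (coinSum x i) (∑ j, (x i j : ℤ)))
    (fun i => hf.sum_eq _ _ _) i (Ψ x)

theorem gameExp_coins (hf : f.IsProb) (Ψ : Coins m → ℝ) :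
    gameExp ε f (fun ω => Ψ ω.1) = coinsExp ε Ψ := by
  classical
  rw [gameExp_eq]
  congr 1
  funext x
  change ∑ h : Fin m → H, (∏ i, f i (coinSum x i) (∑ j, (x i j : ℤ)) (h i)) * Ψ x = Ψ x
  rw [← Finset.sum_mul]
  exact (congrArg (· * Ψ x) (sum_prod_eq_one
    (fun i : Fin m => f i (coinSum x i) (∑ j, (x i j : ℤ)))
    (fun i => hf.sum_eq _ _ _))).trans (one_mul _)

theorem gameProb_nonneg (hε : ε ∈ Set.Icc (-1 : ℝ) 1) (hf : f.IsProb) (ω : Outcome m H) :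
    0 ≤ gameProb ε f ω :=
  mul_nonneg (Finset.prod_nonneg fun _ _ => coinsProb_nonneg hε _)
    (Finset.prod_nonneg fun _ _ => hf.nonneg _ _ _ _)

theorem gameExp_mono (hε : ε ∈ Set.Icc (-1 : ℝ) 1) (hf : f.IsProb) {Φ Ψ : Outcome m H → ℝ}
    (h : ∀ ω, Φ ω ≤ Ψ ω) : gameExp ε f Φ ≤ gameExp ε f Ψ :=
  Finset.sum_le_sum fun ω _ => mul_le_mul_of_nonneg_left (h ω) (gameProb_nonneg hε hf ω)

theorem gameExp_sum {α : Type*} (s : Finset α) (Φ : α → Outcome m H → ℝ) :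
    gameExp ε f (fun ω => ∑ a ∈ s, Φ a ω) = ∑ a ∈ s, gameExp ε f (Φ a) := by
  simp only [gameExp, Finset.mul_sum]
  exact Finset.sum_comm

theorem gameExp_add (Φ Ψ : Outcome m H → ℝ) :
    gameExp ε f (fun ω => Φ ω + Ψ ω) = gameExp ε f Φ + gameExp ε f Ψ := by
  simp [gameExp, mul_add, Finset.sum_add_distrib]

theorem gameExp_const_mul (a : ℝ) (Φ : Outcome m H → ℝ) :
    gameExp ε f (fun ω => a * Φ ω) = a * gameExp ε f Φ := by
  simp only [gameExp, Finset.mul_sum]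
  exact Finset.sum_congr rfl fun ω _ => by ring

theorem gameExp_const (hf : f.IsProb) (a : ℝ) : gameExp ε f (fun _ => a) = a :=
  (gameExp_coins hf fun _ => a).trans (coinsExp_const a)

open scoped Classical in
theorem prob_gameProb (A : Outcome m H → Prop) :
    prob (gameProb ε f) A = gameExp ε f fun ω => if A ω then 1 else 0 := by
  unfold prob gameExp
  exact Finset.sum_congr rfl fun ω _ => by by_cases h : A ω <;> simp [h]

open scoped Classical in
/-- The probability that the coins of the rounds before `i` add up to `b`. -/
noncomputable def reachProb (ε : ℝ) (i : Fin m) (b : ℤ) : ℝ :=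
  coinsExp ε fun x : Coins m => if coinSum x i = b then 1 else 0

/-- The probability of a hint in round `i` if its coins are `y`. -/
abbrev hintAt (f : HintFunction m H) (i : Fin m) (b : ℤ)
    (y : Fin (roundSize m ((i : ℕ) + 1)) → ℤˣ) (h : H) : ℝ :=
  f i b (∑ j, (y j : ℤ)) h

/-- The winning probability if the coins of round `i` are `y`. -/
noncomputable abbrev valueAt (ε : ℝ) (i : Fin m) (b : ℤ)
    (y : Fin (roundSize m ((i : ℕ) + 1)) → ℤˣ) : ℝ :=
  roundValue (remSize m ((i : ℕ) + 2)) ε b y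

theorem coinsExp_reach (i : Fin m) (b : ℤ)
    (φ : (Fin (roundSize m ((i : ℕ) + 1)) → ℤˣ) → ℝ) :
    (open scoped Classical in
      coinsExp ε fun x : Coins m => if coinSum x i = b then φ (x i) else 0) =
      reachProb ε i b * ∑ y, coinsProb ε y * φ y := by
  classical
  rw [coinsExp_resample i, reachProb, ← coinsExp_mul_const]
  congr 1
  funext x
  simp only [coinSum_update x i _ le_rfl, Function.update_self]
  split_ifs <;> simp

theorem coinsExp_reach_win (i : Fin m) (b : ℤ)
    (φ : (Fin (roundSize m ((i : ℕ) + 1)) → ℤˣ) → ℝ) :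
    (open scoped Classical in
      coinsExp ε fun x : Coins m => (if coinSum x i = b then φ (x i) else 0) *
        (if 0 ≤ coinSum x m then 1 else 0)) =
      reachProb ε i b * ∑ y, coinsProb ε y * φ y * valueAt ε i b y := by
  classical
  have h := coinsExp_mul_future (ε := ε) (t := (i : ℕ) + 1) (t' := m) (by omega) le_rfl
    (fun x : Coins m => if coinSum x i = b then φ (x i) else 0)
    (fun x k y hk => by
      have hki : k ≠ i := by rintro rfl; omega
      rw [coinSum_update x k y (by omega), Function.update_of_ne hki.symm])
    (fun s => if 0 ≤ s then 1 else 0)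
  have h2 := coinsExp_reach (ε := ε) i b (fun y => φ y * valueAt ε i b y)
  simp only [← mul_assoc] at h2
  rw [← h2]
  refine (Eq.trans ?_ (h.trans ?_))
  · congr 1
  · congr 1
    funext x
    by_cases hb : coinSum x i = b
    · rw [if_pos hb, if_pos hb, blockSize_eq_remSize, coinSum_succ, hb]
      congr 1
      unfold valueAt roundValue
      rw [binomTail_eq_coinExp]
      congr 1
      funext c
      exact if_congr ⟨fun h => by omega, fun h => by omega⟩ rfl rfl
    · rw [if_neg hb, if_neg hb, zero_mul]

/-- Bayes' rule: the probability of reaching `b` factors out of numerator and denominator, because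
earlier coins, the current coins and later coins are independent. -/
theorem gameValueHint_eq (hf : f.IsProb) (i : Fin m) (b : ℤ) (h : H)
    (hb : reachProb ε i b ≠ 0) :
    gameValueHint ε f i b h =
      (∑ y, coinsProb ε y * hintAt f i b y h * valueAt ε i b y) /
        ∑ y, coinsProb ε y * hintAt f i b y h := by
  classical
  unfold gameValueHint condProb
  rw [prob_gameProb, prob_gameProb]
  have h1 : gameExp ε f (fun ω => if 0 ≤ partialSum ω m ∧ partialSum ω i = b ∧ ω.2 i = h
      then 1 else 0) = reachProb ε i b *
        ∑ y, coinsProb ε y * hintAt f i b y h * valueAt ε i b y := by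
    rw [← coinsExp_reach_win]
    refine (gameExp_single hf i (fun x h' => if 0 ≤ coinSum x m ∧ coinSum x i = b ∧ h' = h
      then 1 else 0)).trans ?_
    congr 1
    funext x
    by_cases h1 : 0 ≤ coinSum x m <;> by_cases h2 : coinSum x i = b <;> simp [h1, h2, hintAt]
  have h2 : gameExp ε f (fun ω => if partialSum ω i = b ∧ ω.2 i = h then 1 else 0) =
      reachProb ε i b * ∑ y, coinsProb ε y * hintAt f i b y h := by
    rw [← coinsExp_reach]
    refine (gameExp_single hf i (fun x h' => if coinSum x i = b ∧ h' = h
      then 1 else 0)).trans ?_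
    congr 1
    funext x
    by_cases h2 : coinSum x i = b <;> simp [h2, hintAt]
  rw [← mul_div_mul_left (∑ y, coinsProb ε y * hintAt f i b y h * valueAt ε i b y) _ hb, ← h1, ← h2]
  congr!

theorem gameValue_eq (hf : f.IsProb) (i : Fin m) (b : ℤ) (hb : reachProb ε i b ≠ 0) :
    gameValue ε f i b = ∑ y, coinsProb ε y * valueAt ε i b y := by
  classical
  unfold gameValue condProb
  rw [prob_gameProb, prob_gameProb]
  have h1 : gameExp ε f (fun ω => if 0 ≤ partialSum ω m ∧ partialSum ω i = b
      then 1 else 0) = reachProb ε i b * ∑ y, coinsProb ε y * valueAt ε i b y := by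
    have := coinsExp_reach_win (ε := ε) i b (fun _ => 1)
    simp only [mul_one] at this
    rw [← this]
    refine (gameExp_coins hf (fun x => if 0 ≤ coinSum x m ∧ coinSum x i = b
      then 1 else 0)).trans ?_
    congr 1
    funext x
    by_cases h1 : 0 ≤ coinSum x m <;> by_cases h2 : coinSum x i = b <;> simp [h1, h2]
  have h2 : gameExp ε f (fun ω => if partialSum ω i = b then 1 else 0) = reachProb ε i b :=
    gameExp_coins hf (fun x => if coinSum x i = b then 1 else 0)
  rw [eq_comm, ← mul_div_cancel_left₀ (∑ y, coinsProb ε y * valueAt ε i b y) hb, ← h1]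
  conv_lhs => rw [← h2]
  congr!

/-- An outcome of positive weight lies in the conditioning event, so the conditional probabilities
occurring with nonzero weight have nonzero denominators. -/
theorem reach_pos_of_gameProb_pos (hε : ε ∈ Set.Icc (-1 : ℝ) 1) (hf : f.IsProb)
    {ω : Outcome m H} (hω : 0 < gameProb ε f ω) (i : Fin m) :
    reachProb ε i (partialSum ω i) ≠ 0 ∧
      0 < ∑ y, coinsProb ε y * hintAt f i (partialSum ω i) y (ω.2 i) := by
  classical
  have h2 : gameExp ε f (fun ω' => if partialSum ω' i = partialSum ω i ∧ ω'.2 i = ω.2 i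
      then 1 else 0) = reachProb ε i (partialSum ω i) *
        ∑ y, coinsProb ε y * hintAt f i (partialSum ω i) y (ω.2 i) := by
    rw [← coinsExp_reach]
    refine (gameExp_single hf i (fun x h' => if coinSum x i = partialSum ω i ∧ h' = ω.2 i
      then 1 else 0)).trans ?_
    congr 1
    funext x
    by_cases h2 : coinSum x i = partialSum ω i <;> simp [h2, hintAt]
  have h3 : 0 < gameExp ε f (fun ω' => if partialSum ω' i = partialSum ω i ∧ ω'.2 i = ω.2 i
      then 1 else 0) := by
    refine lt_of_lt_of_le hω ?_
    unfold gameExp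
    refine le_trans (le_of_eq ?_) (Finset.single_le_sum (f := fun ω' => gameProb ε f ω' *
      (if partialSum ω' i = partialSum ω i ∧ ω'.2 i = ω.2 i then (1 : ℝ) else 0))
      (fun ω' _ => mul_nonneg (gameProb_nonneg hε hf ω') (by split_ifs <;> norm_num))
      (Finset.mem_univ ω))
    simp
  rw [h2] at h3
  have h4 : 0 ≤ reachProb ε i (partialSum ω i) :=
    coinsExp_nonneg hε fun x => by split_ifs <;> norm_num
  have h5 := pos_of_mul_pos_right h3 h4
  exact ⟨fun h0 => by rw [h0, zero_mul] at h3; exact lt_irrefl _ h3, h5⟩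

/-- Reduction of the bias of a game to the effect of the hints in the single rounds. -/
theorem playerBias_le (hε : ε ∈ Set.Icc (-1 : ℝ) 1) (hf : f.IsProb) (B : Player m H)
    (W : Fin m → ℤ → ℝ) {δ : ℝ}
    (hW : ∀ i b, ObservationBound (coinsProb ε) (hintAt f i b) (valueAt ε i b) (W i b) δ) :
    playerBias ε f B ≤
      (∑ i, gameExp ε f fun ω => stopProb B i ω * W i (partialSum ω i)) + m * δ := by
  choose e he0 heδ he using hW
  have hpt : ∀ ω, |gameProb ε f ω *
      (stoppedValue B (fun i => gameValueHint ε f i (partialSum ω i) (ω.2 i)) ω -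
      stoppedValue B (fun i => gameValue ε f i (partialSum ω i)) ω)| ≤
      gameProb ε f ω * (∑ i, (stopProb B i ω * W i (partialSum ω i) +
        e i (partialSum ω i) (ω.2 i))) := by
    intro ω
    have hω := gameProb_nonneg hε hf ω
    rw [abs_mul, abs_of_nonneg hω]
    rcases hω.lt_or_eq with hpos | hz
    · refine mul_le_mul_of_nonneg_left ?_ hω
      unfold stoppedValue
      -- If the player never stops, both values are the final result, and the terms cancel.
      rw [add_sub_add_right_eq_sub, ← Finset.sum_sub_distrib]
      refine (Finset.abs_sum_le_sum_abs _ _).trans (Finset.sum_le_sum fun i _ => ?_)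
      rw [← mul_sub, abs_mul]
      have h0 := stopProb_nonneg B i ω
      have h1 := stopProb_le_one B i ω
      change |stopProb B i ω| * _ ≤ _
      rw [abs_of_nonneg h0]
      obtain ⟨hr, hQ⟩ := reach_pos_of_gameProb_pos hε hf hpos i
      beta_reduce
      rw [gameValueHint_eq hf i _ _ hr, gameValue_eq hf i _ hr]
      have h2 := mul_le_mul_of_nonneg_left (he i (partialSum ω i) (ω.2 i) hQ) h0
      -- In the error term the stopping probability is dropped, so that the error can be averaged
      -- over the hint of the round independently of the player.
      have h3 : stopProb B i ω * e i (partialSum ω i) (ω.2 i) ≤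
          e i (partialSum ω i) (ω.2 i) :=
        mul_le_of_le_one_left (he0 _ _ _) h1
      rw [mul_add] at h2
      linarith
    · rw [← hz, zero_mul, zero_mul]
  unfold playerBias
  refine (Finset.abs_sum_le_sum_abs _ _).trans ((Finset.sum_le_sum fun ω _ => hpt ω).trans ?_)
  change gameExp ε f (fun ω => ∑ i, (stopProb B i ω * W i (partialSum ω i) +
        e i (partialSum ω i) (ω.2 i))) ≤ _
  rw [gameExp_sum]
  simp only [gameExp_add]
  rw [Finset.sum_add_distrib]
  refine add_le_add le_rfl ?_
  have hone : ∀ i : Fin m, gameExp ε f (fun ω => e i (partialSum ω i) (ω.2 i)) ≤ δ := by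
    intro i
    refine (gameExp_single hf i (fun x h => e i (coinSum x i) h)).trans_le ?_
    rw [coinsExp_resample i]
    refine (coinsExp_mono hε (Ψ := fun _ => δ) fun x => ?_).trans_eq (coinsExp_const δ)
    simp only [coinSum_update x i _ le_rfl, Function.update_self]
    exact heδ i (coinSum x i)
  refine (Finset.sum_le_sum fun i _ => hone i).trans (le_of_eq ?_)
  rw [Finset.sum_const, Finset.card_univ, Fintype.card_fin, nsmul_eq_mul]

/-- The future coins are independent of the decision to stop. -/
theorem gameExp_stopProb_mul (hf : f.IsProb) (B : Player m H) (i : Fin m) {t' : ℕ}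
    (hit : (i : ℕ) + 1 ≤ t') (ht' : t' ≤ m) (F : Coins m → ℝ)
    (hF : ∀ (x : Coins m) (k : Fin m) y, (i : ℕ) + 1 ≤ (k : ℕ) →
      F (Function.update x k y) = F x) (g : ℤ → ℝ) :
    gameExp ε f (fun ω => stopProb B i ω * (F ω.1 * g (partialSum ω t'))) =
      gameExp ε f fun ω => stopProb B i ω * (F ω.1 *
        coinExp ε (blockSize m ((i : ℕ) + 1) t') fun c => g (partialSum ω ((i : ℕ) + 1) + c)) := by
  classical
  -- The probability of stopping in this round given all coins. It depends on the coins up to and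
  -- including this round, since the hint carries information about the current ones.
  set A : Coins m → ℝ := fun x => ∑ h : Fin m → H,
    (∏ j : Fin m, f j (coinSum x j) (∑ k, (x j k : ℤ)) (h j)) * stopProb B i (x, h) with hA
  have habort : ∀ (x x' : Coins m) (h h' : Fin m → H) (j : Fin m),
      (∀ k ≤ j, coinSum x k = coinSum x' k) → (∀ k ≤ j, h k = h' k) →
      abortProb B (x, h) j = abortProb B (x', h') j := by
    intro x x' h h' j h1 h2
    unfold abortProb
    congr 2
    funext k
    have hk : (k : Fin m) ≤ j := k.2
    exact Prod.ext (h1 k hk) (h2 k hk)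
  have hagree : ∀ (x x' : Coins m) (h h' : Fin m → H),
      (∀ k ≤ i, coinSum x k = coinSum x' k) → (∀ k ≤ i, h k = h' k) →
      stopProb B i (x, h) = stopProb B i (x', h') := by
    intro x x' h h' h1 h2
    unfold stopProb
    rw [habort x x' h h' i h1 h2]
    congr 1
    refine Finset.prod_congr rfl fun j hj => ?_
    rw [Finset.mem_Iio] at hj
    rw [habort x x' h h' j (fun k hk => h1 k (hk.trans hj.le)) fun k hk => h2 k (hk.trans hj.le)]
  have hAupd : ∀ (x : Coins m) (k : Fin m) y, (i : ℕ) + 1 ≤ (k : ℕ) →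
      A (Function.update x k y) = A x := by
    intro x k y hk
    simp only [hA]
    have hs : ∀ j : Fin m, j ≤ i → coinSum (Function.update x k y) j = coinSum x j := by
      intro j hj
      have : (j : ℕ) ≤ i := hj
      exact coinSum_update x k y (by omega)
    have e1 : ∀ h : Fin m → H, stopProb B i (Function.update x k y, h) = stopProb B i (x, h) :=
      fun h => hagree _ _ h h hs fun _ _ => rfl
    simp only [e1]
    -- Changing a later coin alters the laws of later hints only, and these integrate to one.
    refine sum_prod_mul_congr (fun j : Fin m => j ≤ i)
      (fun j => f j (coinSum (Function.update x k y) j) (∑ l, (Function.update x k y j l : ℤ)))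
      (fun j => f j (coinSum x j) (∑ l, (x j l : ℤ)))
      (fun j => hf.sum_eq _ _ _) (fun j => hf.sum_eq _ _ _) (fun j hj => ?_)
      (fun h => stopProb B i (x, h)) (fun h h' hh => hagree x x h h' (fun _ _ => rfl) hh)
    have hjk : j ≠ k := by
      rintro rfl
      have : (j : ℕ) ≤ i := hj
      omega
    rw [hs j hj, Function.update_of_ne hjk]
  have hpull : ∀ G : Coins m → ℝ, gameExp ε f (fun ω => stopProb B i ω * G ω.1) =
      coinsExp ε fun x => A x * G x := by
    intro G
    rw [gameExp_eq]
    congr 1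
    funext x
    simp only [hA, Finset.sum_mul]
    exact Finset.sum_congr rfl fun h _ => by ring
  have e1 := hpull (fun x => F x * g (coinSum x t'))
  have e2 := hpull (fun x => F x * coinExp ε (blockSize m ((i : ℕ) + 1) t')
    fun c => g (coinSum x ((i : ℕ) + 1) + c))
  refine e1.trans (Eq.trans ?_ e2.symm)
  simp only [← mul_assoc]
  exact coinsExp_mul_future hit ht' (fun x => A x * F x)
    (fun x k y hk => by rw [hAupd x k y hk, hF x k y hk]) g

end GameValues

/-! ### Anticoncentration of sums of coins -/

theorem abs_sum_units_le {n : ℕ} (v : Fin n → ℤˣ) : |∑ j, (v j : ℤ)| ≤ n := by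
  refine (Finset.abs_sum_le_sum_abs _ _).trans (le_of_eq ?_)
  have : ∀ u : ℤˣ, |(u : ℤ)| = 1 := fun u => by
    rcases Int.units_eq_one_or u with rfl | rfl <;> simp
  simp [this]

/-- The largest point mass times the total of `g` over integer intervals. -/
theorem coinExp_le_of_binomPmf_le {n : ℕ} {ε P A : ℝ} {g : ℤ → ℝ} (hP0 : 0 ≤ P)
    (hP : ∀ t, binomPmf n ε t ≤ P) (hg : ∀ x, 0 ≤ g x)
    (hA : ∀ (x : ℤ) (J : ℕ), ∑ j ∈ Finset.range J, g (x + j) ≤ A) :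
    coinExp ε n g ≤ P * A := by
  classical
  have h1 : coinExp ε n g = coinExp ε n fun x => if |x| ≤ n then g x else 0 := by
    unfold coinExp
    exact Finset.sum_congr rfl fun v _ => by simp only [abs_sum_units_le v, if_true]
  have h2 := coinExp_eq_sum_binomPmf (Finset.range (2 * n + 1)) n ε
    (fun x => if |x| ≤ n then g x else 0) (fun j : ℕ => -(n : ℤ) + j)
    (fun a b h => by simpa using h) (fun x hx => by
      rw [if_neg]
      intro h
      rw [abs_le] at h
      refine hx ⟨(x + n).toNat, ?_, ?_⟩
      · simp only [Finset.coe_range, Set.mem_Iio]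
        omega
      · simp only
        omega)
  rw [h1, h2]
  calc _ ≤ ∑ j ∈ Finset.range (2 * n + 1), P * g (-(n : ℤ) + j) := by
        refine Finset.sum_le_sum fun j _ => mul_le_mul (hP _) ?_ ?_ hP0
        · split_ifs
          · exact le_rfl
          · exact hg _
        · split_ifs
          · exact hg _
          · exact le_rfl
    _ ≤ P * A := by
        rw [← Finset.mul_sum]
        exact mul_le_mul_of_nonneg_left (hA _ _) hP0

/-- The function that bounds the partial sums of `1 / (1 + x ^ 2 / R ^ 2)`. -/
noncomputable def lorentzSum (R : ℝ) (x : ℤ) : ℝ :=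
  if 0 ≤ x then 8 * R - 4 * R ^ 2 / (R + x) else 4 * R ^ 2 / (R - x)

theorem lorentzSum_nonneg {R : ℝ} (hR : 0 < R) (x : ℤ) : 0 ≤ lorentzSum R x := by
  unfold lorentzSum
  split_ifs with h
  · have hx : (0 : ℝ) ≤ x := by exact_mod_cast h
    rw [sub_nonneg, div_le_iff₀ (by positivity)]
    nlinarith [mul_nonneg hR.le hx]
  · have hx : (x : ℝ) < 0 := by exact_mod_cast not_le.mp h
    have : 0 < R - x := by linarith
    positivity

theorem lorentzSum_le {R : ℝ} (hR : 0 < R) (x : ℤ) : lorentzSum R x ≤ 8 * R := by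
  unfold lorentzSum
  split_ifs with h
  · have hx : (0 : ℝ) ≤ x := by exact_mod_cast h
    have : 0 ≤ 4 * R ^ 2 / (R + x) := by positivity
    linarith
  · have hx : (x : ℝ) < 0 := by exact_mod_cast not_le.mp h
    have : 0 < R - x := by linarith
    rw [div_le_iff₀ this]
    nlinarith

/-- A telescoping majorant, the discrete counterpart of integrating `(R + v) ^ (-2)`. -/
theorem lorentz_le_step {R u v : ℝ} (hR : 1 ≤ R) (hv : 0 ≤ v) (huv : v ≤ |u|) :
    1 / (1 + u ^ 2 / R ^ 2) ≤ 4 * R ^ 2 / (R + v) - 4 * R ^ 2 / (R + v + 1) := by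
  have h1 : 0 < R := by linarith
  have e1 : 4 * R ^ 2 / (R + v) - 4 * R ^ 2 / (R + v + 1) =
      4 * R ^ 2 / ((R + v) * (R + v + 1)) := by
    field_simp
    ring
  have e2 : 1 / (1 + u ^ 2 / R ^ 2) = R ^ 2 / (R ^ 2 + u ^ 2) := by
    field_simp
  rw [e1, e2, div_le_div_iff₀ (by positivity) (by positivity)]
  have h2 : v ^ 2 ≤ u ^ 2 := by
    rw [← sq_abs u]; gcongr
  have h3 : (R + v) * (R + v + 1) ≤ 4 * (R ^ 2 + u ^ 2) := by
    nlinarith [sq_nonneg (R - v)]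
  calc R ^ 2 * ((R + v) * (R + v + 1)) ≤ R ^ 2 * (4 * (R ^ 2 + u ^ 2)) := by gcongr
    _ = _ := by ring

theorem lorentz_le_lorentzSum_sub {R : ℝ} (hR : 1 ≤ R) (a : ℝ) (x : ℤ) :
    1 / (1 + ((x : ℝ) + a) ^ 2 / R ^ 2) ≤
      lorentzSum R (x + 1 - ⌈-a⌉) - lorentzSum R (x - ⌈-a⌉) := by
  have c1 := Int.le_ceil (-a)
  have c2 := Int.ceil_lt_add_one (-a)
  set z := ⌈-a⌉ with hz
  rcases le_or_gt z x with h | h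
  · have hx : (z : ℝ) ≤ x := by exact_mod_cast h
    have h1 := lorentz_le_step (u := (x : ℝ) + a) (v := (x : ℝ) - z) hR (by linarith)
      (le_trans (by linarith) (le_abs_self _))
    unfold lorentzSum
    rw [if_pos (by omega), if_pos (by omega)]
    push_cast
    have e : R + ((x : ℝ) + 1 - z) = R + (x - z) + 1 := by ring
    rw [e]
    linarith
  · have hx : (x : ℝ) + 1 ≤ z := by exact_mod_cast h
    have h1 := lorentz_le_step (u := (x : ℝ) + a) (v := (z : ℝ) - x - 1) hR (by linarith)
      (le_trans (by linarith) (neg_le_abs _))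
    unfold lorentzSum
    rw [if_neg (show ¬ 0 ≤ x - z by omega)]
    push_cast
    have e : R - ((x : ℝ) - z) = R + (z - x - 1) + 1 := by ring
    rw [e]
    split_ifs with h0
    · have hxz : x + 1 = z := by omega
      have hxz' : (z : ℝ) = x + 1 := by exact_mod_cast hxz.symm
      have hR0 : R ≠ 0 := by linarith
      have e2 : 8 * R - 4 * R ^ 2 / (R + ((x : ℝ) + 1 - z)) = 4 * R ^ 2 / (R + (z - x - 1)) := by
        rw [hxz']
        have f1 : R + ((x : ℝ) + 1 - (x + 1)) = R := by ring
        have f2 : R + ((x : ℝ) + 1 - x - 1) = R := by ring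
        rw [f1, f2]
        field_simp
        ring
      rw [e2]
      exact h1
    · have e2 : R - ((x : ℝ) + 1 - z) = R + (z - x - 1) := by ring
      rw [e2]
      exact h1

theorem sum_lorentz_le {R : ℝ} (hR : 1 ≤ R) (a : ℝ) (x : ℤ) (J : ℕ) :
    ∑ j ∈ Finset.range J, 1 / (1 + (((x + j : ℤ) : ℝ) + a) ^ 2 / R ^ 2) ≤ 8 * R := by
  have h1 : ∀ j ∈ Finset.range J, 1 / (1 + (((x + j : ℤ) : ℝ) + a) ^ 2 / R ^ 2) ≤
      (fun j : ℕ => lorentzSum R (x + j - ⌈-a⌉)) (j + 1) -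
        (fun j : ℕ => lorentzSum R (x + j - ⌈-a⌉)) j := by
    intro j _
    refine (lorentz_le_lorentzSum_sub hR a (x + j)).trans (le_of_eq ?_)
    simp only
    push_cast
    rw [add_assoc]
  refine (Finset.sum_le_sum h1).trans
    ((Finset.sum_range_sub (fun j : ℕ => lorentzSum R (x + j - ⌈-a⌉)) J).trans_le ?_)
  have h2 := lorentzSum_le (by linarith : 0 < R) (x + J - ⌈-a⌉)
  have h3 := lorentzSum_nonneg (by linarith : 0 < R) (x + (0 : ℕ) - ⌈-a⌉)
  linarith

/-- A sum of coins is spread out. -/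
theorem coinExp_lorentz_le {n : ℕ} {ε R : ℝ} (hε : |ε| ≤ 1 / 2) (hn : 0 < n) (hR : 1 ≤ R) (a : ℝ) :
    coinExp ε n (fun x => 1 / (1 + ((x : ℝ) + a) ^ 2 / R ^ 2)) ≤ 16 / Real.sqrt n * (8 * R) := by
  have hs : 0 < Real.sqrt n := Real.sqrt_pos.mpr (by exact_mod_cast hn)
  refine coinExp_le_of_binomPmf_le (by positivity) (fun t => ?_) (fun x => by positivity)
    (fun x J => sum_lorentz_le hR a x J)
  rw [le_div_iff₀ hs, mul_comm]
  exact sqrt_mul_binomPmf_le_const hε t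

theorem bump_eq_lorentz {n : ℝ} (hn : 0 ≤ n) (y : ℝ) :
    bump n y = 1 / (1 + y ^ 2 / (n * Real.sqrt n) ^ 2) := by
  rw [bump, mul_sqrt_sq hn]

/-- Jensen's inequality for `bump`. -/
theorem le_coinExp_bump {ε n : ℝ} (hε : ε ∈ Set.Icc (-1 : ℝ) 1) (hn : 0 < n) (N : ℕ) (a : ℝ) :
    1 / (1 + (N + a ^ 2) / n ^ 3) ≤ coinExp ε N fun c => bump n ((c : ℝ) - ε * N + a) := by
  have hn3 : 0 < n ^ 3 := by positivity
  set q := 1 + (N * (1 - ε ^ 2) + a ^ 2) / n ^ 3 with hq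
  have hε2 : ε ^ 2 ≤ 1 := by nlinarith [hε.1, hε.2]
  have hN : (0 : ℝ) ≤ N := Nat.cast_nonneg N
  have hE : 0 ≤ N * (1 - ε ^ 2) + a ^ 2 := by
    have := mul_nonneg hN (sub_nonneg.mpr hε2)
    positivity
  have hq0 : 0 < q := by positivity
  -- The tangent of `1 / x` at the expectation `q`. Being linear in `x`, it reduces the claim to a
  -- second moment.
  have h1 : ∀ x : ℝ, 0 < x → 2 / q - x / q ^ 2 ≤ 1 / x := by
    intro x hx
    have : 1 / x - (2 / q - x / q ^ 2) = (q - x) ^ 2 / (x * q ^ 2) := by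
      field_simp
      ring
    have h2 : 0 ≤ (q - x) ^ 2 / (x * q ^ 2) := by positivity
    linarith
  calc 1 / (1 + (N + a ^ 2) / n ^ 3) ≤ 1 / q := by
        refine one_div_le_one_div_of_le hq0 ?_
        rw [hq]
        gcongr
        nlinarith [mul_nonneg hN (sq_nonneg ε)]
    _ = coinExp ε N fun c => (2 / q - 1 / q ^ 2) - (1 / q ^ 2 / n ^ 3) *
          ((c : ℝ) - ε * N + a) ^ 2 := by
        rw [coinExp_sub_fun, coinExp_const, coinExp_const_mul, coinExp_sq]
        have : N * (1 - ε ^ 2) + a ^ 2 = (q - 1) * n ^ 3 := by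
          rw [hq]; field_simp; ring
        rw [this]
        field_simp
        ring
    _ ≤ _ := by
        refine coinExp_mono hε N fun c => ?_
        have := h1 (1 + ((c : ℝ) - ε * N + a) ^ 2 / n ^ 3) (by positivity)
        unfold bump
        refine le_trans (le_of_eq ?_) this
        field_simp
        ring

/-! ### The numbers of coins in blocks of rounds -/

section Sizes

variable {m : ℕ}

theorem roundSize_cast {t : ℕ} (ht : t ≤ m) :
    ((roundSize m (t + 1) : ℕ) : ℝ) = ((m : ℝ) - t) ^ 2 := by
  unfold roundSize
  have : m + 1 - (t + 1) = m - t := by omega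
  rw [this, Nat.cast_pow, Nat.cast_sub ht]

theorem blockSize_add_remSize {t t' : ℕ} (htt' : t ≤ t') (ht' : t' ≤ m) :
    blockSize m t t' + remSize m (t' + 1) = remSize m (t + 1) := by
  rw [← blockSize_eq_remSize, ← blockSize_eq_remSize]
  exact Finset.sum_Ico_consecutive _ htt' ht'

theorem remSize_cast {t : ℕ} (ht : t ≤ m) : ((remSize m (t + 1) : ℕ) : ℝ) =
    ((m : ℝ) - t) * (m - t + 1) * (2 * (m - t) + 1) / 6 := by
  obtain ⟨d, rfl⟩ := Nat.exists_eq_add_of_le ht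
  induction d generalizing t with
  | zero => simp [← blockSize_eq_remSize, blockSize_self]
  | succ d ih =>
    have h := ih (t := t + 1) (by omega)
    have e : t + 1 + d = t + (d + 1) := by omega
    rw [e] at h
    rw [← blockSize_add_remSize (t := t) (t' := t + 1) (by omega) (by omega),
      blockSize_succ le_rfl, blockSize_self, zero_add, Nat.cast_add, h, roundSize_cast (by omega)]
    push_cast
    ring

theorem remSize_le_cube {t : ℕ} (ht : t ≤ m) :
    ((remSize m (t + 1) : ℕ) : ℝ) ≤ ((m : ℝ) - t) ^ 3 := by
  rw [remSize_cast ht]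
  rcases ht.eq_or_lt with rfl | h
  · simp
  · have : (t : ℝ) + 1 ≤ m := by exact_mod_cast h
    have h1 : 0 ≤ (m : ℝ) - t - 1 := by linarith
    generalize (m : ℝ) - t = n at *
    have h2 : 0 ≤ n := by linarith
    nlinarith [mul_nonneg h1 h2, mul_nonneg (mul_nonneg h1 h2) h2]

theorem cube_le_remSize_one : (m : ℝ) ^ 3 / 3 ≤ (remSize m 1 : ℕ) := by
  have h := remSize_cast (m := m) (t := 0) (Nat.zero_le _)
  simp only [Nat.cast_zero, sub_zero, zero_add] at h
  rw [h]
  have : (0 : ℝ) ≤ m := Nat.cast_nonneg m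
  nlinarith [mul_nonneg this this]

/-- With at most half of the rounds left, a constant fraction of all coins has been tossed, because
the early rounds are the largest. -/
theorem cube_le_blockSize {t : ℕ} (ht : t ≤ m) (h2 : 2 * ((m : ℝ) - t) ≤ m) :
    (m : ℝ) ^ 3 / 4 ≤ (blockSize m 0 t : ℕ) := by
  have h := blockSize_add_remSize (m := m) (Nat.zero_le t) ht
  have h1 := cube_le_remSize_one (m := m)
  have e : ((blockSize m 0 t : ℕ) : ℝ) = (remSize m 1 : ℕ) - (remSize m (t + 1) : ℕ) := by
    rw [eq_sub_iff_add_eq]; exact_mod_cast h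
  have h0 := remSize_cast (m := m) (t := 0) (Nat.zero_le _)
  simp only [Nat.cast_zero, sub_zero, zero_add] at h0
  rw [e, h0, remSize_cast ht]
  have hn : (0 : ℝ) ≤ (m : ℝ) - t := by
    have : (t : ℝ) ≤ m := by exact_mod_cast ht
    linarith
  generalize (m : ℝ) - t = n at *
  have hnm : n ≤ m / 2 := by linarith
  have h3 : n * (n + 1) * (2 * n + 1) ≤ (m / 2) * (m / 2 + 1) * (2 * (m / 2 : ℝ) + 1) := by gcongr
  have hm : (0 : ℝ) ≤ m := Nat.cast_nonneg m
  nlinarith [mul_nonneg hm hm, mul_nonneg (mul_nonneg hm hm) hm]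

end Sizes

/-! ### The potential argument: a stop is paid for by later bumps -/

section Potential

variable {m : ℕ} {ε L : ℝ}

/-- The bump of round `t + 1`, at the expected final sum given that the sum so far is `s`. -/
noncomputable def roundBump (m : ℕ) (ε : ℝ) (t : ℕ) (s : ℤ) : ℝ :=
  bump ((m : ℝ) - t) ((s : ℝ) + ε * (remSize m (t + 1) : ℕ))

theorem roundBump_nonneg {t : ℕ} (ht : t ≤ m) (s : ℤ) : 0 ≤ roundBump m ε t s :=
  bump_nonneg (by have : (t : ℝ) ≤ m := by exact_mod_cast ht
                  linarith) _

theorem roundBump_le_one {t : ℕ} (ht : t ≤ m) (s : ℤ) : roundBump m ε t s ≤ 1 :=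
  bump_le_one (by have : (t : ℝ) ≤ m := by exact_mod_cast ht
                  linarith) _

/-- As long as at least half of the rounds remain, the bumps stay large on average. -/
theorem roundBump_le_future (hε : ε ∈ Set.Icc (-1 : ℝ) 1) {i t : ℕ} (hi : i + 1 ≤ t)
    (ht : 2 * t ≤ m + i) (htm : t < m) (hL : L ≤ (m : ℝ) - i) (s c : ℤ)
    (hc : |(c : ℝ) - ε * ((m : ℝ) - i) ^ 2| < 4 * ((m : ℝ) - i) * Real.sqrt L) :
    roundBump m ε i s ≤ 265 * coinExp ε (blockSize m (i + 1) t)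
      fun x => roundBump m ε t (s + c + x) := by
  have h1 := blockSize_add_remSize (m := m) hi htm.le
  have h2 := blockSize_add_remSize (m := m) (Nat.le_succ i) (by omega : i + 1 ≤ m)
  rw [blockSize_succ le_rfl, blockSize_self, zero_add] at h2
  have h1' : ((remSize m (i + 1 + 1) : ℕ) : ℝ) =
    (blockSize m (i + 1) t : ℕ) + (remSize m (t + 1) : ℕ) := by exact_mod_cast h1.symm
  have h2' : ((remSize m (i + 1) : ℕ) : ℝ) =
    ((m : ℝ) - i) ^ 2 + (remSize m (i + 1 + 1) : ℕ) := by
    rw [← roundSize_cast (by omega : i ≤ m)]; exact_mod_cast h2.symm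
  have h3 := remSize_le_cube (m := m) (t := i) (by omega)
  have hR0 : (0 : ℝ) ≤ (remSize m (t + 1) : ℕ) := Nat.cast_nonneg _
  have ht' : 2 * (t : ℝ) ≤ m + i := by exact_mod_cast ht
  have htm' : (t : ℝ) + 1 ≤ m := by exact_mod_cast htm
  have hi' : (i : ℝ) + 1 ≤ t := by exact_mod_cast hi
  set n : ℝ := (m : ℝ) - i with hn
  have hn1 : 1 ≤ n := by linarith
  set n' : ℝ := (m : ℝ) - t with hn'
  have hn'0 : 0 < n' := by linarith
  have hnn : n ≤ 2 * n' := by linarith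
  set B : ℝ := ((blockSize m (i + 1) t : ℕ) : ℝ) with hB
  have hB0 : 0 ≤ B := Nat.cast_nonneg _
  set y : ℝ := (s : ℝ) + ε * (remSize m (i + 1) : ℕ) with hy
  set a : ℝ := (s : ℝ) + c + ε * (remSize m (i + 1 + 1) : ℕ) with ha
  have hay : a = y + (c - ε * n ^ 2) := by rw [ha, hy, h2']; ring
  -- The current coins enter by a worst-case bound over typical values, because the decision to stop
  -- may be correlated with them through the hint.
  have hcn : (c - ε * n ^ 2) ^ 2 ≤ 16 * n ^ 3 := by
    have h4 := typical_le_scale hn1 hL hc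
    rw [← sq_abs]
    calc |(c : ℝ) - ε * n ^ 2| ^ 2 ≤ (4 * (n * Real.sqrt n)) ^ 2 := by gcongr
      _ = 16 * n ^ 3 := by rw [mul_pow, mul_sqrt_sq (by linarith)]; ring
  have ha2 : a ^ 2 ≤ 2 * y ^ 2 + 32 * n ^ 3 := by
    rw [hay]; nlinarith [sq_nonneg (y - (c - ε * n ^ 2))]
  have hBn : B ≤ n ^ 3 := by nlinarith [sq_nonneg n]
  have hn3 : 0 < n ^ 3 := by positivity
  have hn'3 : n ^ 3 ≤ 8 * n' ^ 3 := by
    calc n ^ 3 ≤ (2 * n') ^ 3 := by gcongr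
      _ = 8 * n' ^ 3 := by ring
  have hJ := le_coinExp_bump hε hn'0 (blockSize m (i + 1) t) a
  have hfun : (fun x : ℤ => roundBump m ε t (s + c + x)) =
      fun x : ℤ => bump n' ((x : ℝ) - ε * (blockSize m (i + 1) t : ℕ) + a) := by
    funext x
    unfold roundBump
    congr 1
    rw [ha, h1']
    push_cast
    ring
  rw [hfun]
  -- Since n³ ≤ 8 n'³, the later width costs a factor 8; the constant is 265 = 1 + 8 · 33.
  have hq : 1 + (B + a ^ 2) / n' ^ 3 ≤ 265 * (1 + y ^ 2 / n ^ 3) := by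
    have e1 : (B + a ^ 2) / n' ^ 3 ≤ (2 * y ^ 2 + 33 * n ^ 3) / (n ^ 3 / 8) := by
      apply div_le_div₀ (by positivity) (by linarith) (by positivity) (by linarith)
    have e2 : (2 * y ^ 2 + 33 * n ^ 3) / (n ^ 3 / 8) = 16 * (y ^ 2 / n ^ 3) + 264 := by
      field_simp
      ring
    have e3 : 0 ≤ y ^ 2 / n ^ 3 := by positivity
    linarith
  have hq0 : 0 < 1 + (B + a ^ 2) / n' ^ 3 := by positivity
  calc roundBump m ε i s = 1 / (1 + y ^ 2 / n ^ 3) := rfl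
    _ ≤ 265 * (1 / (1 + (B + a ^ 2) / n' ^ 3)) := by
        rw [mul_one_div, div_le_div_iff₀ (by positivity) hq0]
        linarith
    _ ≤ _ := by gcongr

/-- The window used to pay for a stop in round `i + 1`: at least a third of the remaining rounds,
all early enough that half of the remaining rounds are still to come. -/
theorem card_half_rounds_ge {i : ℕ} (hi : i + 2 ≤ m) :
    (m : ℝ) - i ≤ 3 * (Finset.Ico (i + 1) ((m + i) / 2 + 1)).card := by
  rw [Nat.card_Ico]
  have : m ≤ 3 * ((m + i) / 2 + 1 - (i + 1)) + i := by omega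
  have h : (m : ℝ) ≤ 3 * (((m + i) / 2 + 1 - (i + 1) : ℕ) : ℝ) + i := by exact_mod_cast this
  linarith

variable {H : Type} [Fintype H] {f : HintFunction m H}

/-- One stopping round is paid for by the bumps of the next rounds. -/
theorem gameExp_stopProb_bump_le (hε : ε ∈ Set.Icc (-1 : ℝ) 1) (hf : f.IsProb) (B : Player m H)
    {w : ℕ → ℝ} (hw0 : ∀ t ≤ m, 0 ≤ w t) (hw : ∀ s t, s ≤ t → t < m → w s ≤ w t) (hL0 : 0 ≤ L)
    {i : Fin m} (hi : (i : ℕ) + 2 ≤ m) (hL : L ≤ (m : ℝ) - (i : ℕ)) :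
    gameExp ε f (fun ω => stopProb B i ω * (w i * roundBump m ε i (partialSum ω i))) ≤
      gameExp ε f (fun ω => stopProb B i ω * ∑ t ∈ Finset.range m,
        795 * (w t / ((m : ℝ) - t)) * roundBump m ε t (partialSum ω t)) +
      w i * (2 * Real.exp (-(2 * L))) := by
  classical
  have hin : (0 : ℝ) < (m : ℝ) - (i : ℕ) := by
    have : ((i : ℕ) : ℝ) + 2 ≤ m := by exact_mod_cast hi
    linarith
  -- The indicator of typical coins in the stopping round. Only the later coins are independent of
  -- the stop, so these coins have to be controlled separately.
  set F : Coins m → ℝ := fun x => if |((∑ j, (x i j : ℤ) : ℤ) : ℝ) - ε * ((m : ℝ) - (i : ℕ)) ^ 2| <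
    4 * ((m : ℝ) - (i : ℕ)) * Real.sqrt L then 1 else 0 with hF
  have hF0 : ∀ x, 0 ≤ F x := fun x => by simp only [hF]; split_ifs <;> norm_num
  have hF1 : ∀ x, F x ≤ 1 := fun x => by simp only [hF]; split_ifs <;> norm_num
  have hFE : gameExp ε f (fun ω => 1 - F ω.1) ≤ 2 * Real.exp (-(2 * L)) := by
    rw [gameExp_coins hf (fun x => 1 - F x), coinsExp_resample i]
    refine (coinsExp_mono hε (Ψ := fun _ => 2 * Real.exp (-(2 * L))) fun x => ?_).trans_eq
      (coinsExp_const _)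
    refine le_trans (le_of_eq ?_) (sum_atypical_le hε hin (roundSize_cast (by omega)) hL0)
    refine Finset.sum_congr rfl fun y _ => ?_
    simp only [hF, Function.update_self]
    rw [roundSize_cast (by omega : (i : ℕ) ≤ m)]
    split_ifs <;> simp
  set T := Finset.Ico ((i : ℕ) + 1) ((m + i) / 2 + 1) with hT
  have hTmem : ∀ t ∈ T, (i : ℕ) + 1 ≤ t ∧ 2 * t ≤ m + i ∧ t < m := by
    intro t ht
    rw [hT, Finset.mem_Ico] at ht
    omega
  set cf : ℕ → ℝ := fun t => 795 * (w t / ((m : ℝ) - t)) with hcf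
  have hcf0 : ∀ t < m, 0 ≤ cf t := by
    intro t ht
    have : (t : ℝ) < m := by exact_mod_cast ht
    have h2 := div_nonneg (hw0 t (by omega)) (by linarith : 0 ≤ (m : ℝ) - t)
    simp only [hcf]
    positivity
  have hpt : ∀ ω : Outcome m H, stopProb B i ω * (w i * roundBump m ε i (partialSum ω i)) ≤
      (∑ t ∈ T, cf t * (stopProb B i ω * (F ω.1 * coinExp ε (blockSize m ((i : ℕ) + 1) t)
        fun c => roundBump m ε t (partialSum ω ((i : ℕ) + 1) + c)))) + w i * (1 - F ω.1) := by
    intro ω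
    have hs0 := stopProb_nonneg B i ω
    have hs1 := stopProb_le_one B i ω
    have hb0 := roundBump_nonneg (ε := ε) (by omega : (i : ℕ) ≤ m) (partialSum ω i)
    have hb1 := roundBump_le_one (ε := ε) (by omega : (i : ℕ) ≤ m) (partialSum ω i)
    by_cases hc : |((∑ j, (ω.1 i j : ℤ) : ℤ) : ℝ) - ε * ((m : ℝ) - (i : ℕ)) ^ 2| <
      4 * ((m : ℝ) - (i : ℕ)) * Real.sqrt L
    · have hFω : F ω.1 = 1 := by simp only [hF]; rw [if_pos hc]
      rw [hFω, sub_self, mul_zero, add_zero]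
      simp only [one_mul]
      -- Each round of the window pays a share `3 / n` of the present bump, and there are at least
      -- `n / 3` of them; 795 = 3 · 265. Weights do not decrease with time, so the later weight
      -- suffices.
      have hterm : ∀ t ∈ T, 3 * (w i * roundBump m ε i (partialSum ω i)) / ((m : ℝ) - (i : ℕ)) ≤
          cf t * coinExp ε (blockSize m ((i : ℕ) + 1) t)
            fun c => roundBump m ε t (partialSum ω ((i : ℕ) + 1) + c) := by
        intro t ht
        obtain ⟨h1, h2, h3⟩ := hTmem t ht
        have h4 := roundBump_le_future hε h1 h2 h3 hL (partialSum ω i) _ hc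
        have h5 : partialSum ω ((i : ℕ) + 1) = partialSum ω i + ∑ j, (ω.1 i j : ℤ) :=
          coinSum_succ ω.1 i
        rw [h5]
        have h6 : (t : ℝ) + 1 ≤ m := by exact_mod_cast h3
        have h7 : ((i : ℕ) : ℝ) ≤ t := by exact_mod_cast (by omega : (i : ℕ) ≤ t)
        have h8 : w i / ((m : ℝ) - (i : ℕ)) ≤ w t / ((m : ℝ) - t) :=
          div_le_div₀ (hw0 t h3.le) (hw _ _ (by omega) h3) (by linarith) (by linarith)
        have h9 : 0 ≤ w i / ((m : ℝ) - (i : ℕ)) := div_nonneg (hw0 _ i.2.le) hin.le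
        calc 3 * (w i * roundBump m ε i (partialSum ω i)) / ((m : ℝ) - (i : ℕ))
            = 3 * (w i / ((m : ℝ) - (i : ℕ))) * roundBump m ε i (partialSum ω i) := by ring
          _ ≤ 3 * (w t / ((m : ℝ) - t)) * (265 * _) :=
              mul_le_mul (by linarith) h4 hb0 (by linarith)
          _ = _ := by simp only [hcf]; ring
      have hcard := card_half_rounds_ge hi
      have hsum := Finset.card_nsmul_le_sum T _ _ hterm
      rw [nsmul_eq_mul] at hsum
      have hwb : 0 ≤ w i * roundBump m ε i (partialSum ω i) := mul_nonneg (hw0 _ i.2.le) hb0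
      have hle : w i * roundBump m ε i (partialSum ω i) ≤
          (T.card : ℝ) * (3 * (w i * roundBump m ε i (partialSum ω i)) / ((m : ℝ) - (i : ℕ))) := by
        rw [mul_div_assoc', le_div_iff₀ hin]
        nlinarith [mul_le_mul_of_nonneg_left hcard hwb]
      have := mul_le_mul_of_nonneg_left (hle.trans hsum) hs0
      rw [Finset.mul_sum] at this
      refine this.trans (le_of_eq (Finset.sum_congr rfl fun t _ => by ring))
    · have hFω : F ω.1 = 0 := by simp only [hF]; rw [if_neg hc]
      rw [hFω]
      simp only [zero_mul, mul_zero, Finset.sum_const_zero, zero_add, sub_zero]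
      calc stopProb B i ω * (w i * roundBump m ε i (partialSum ω i)) ≤ 1 * (w i * 1) :=
            mul_le_mul hs1 (mul_le_mul_of_nonneg_left hb1 (hw0 _ i.2.le)) (mul_nonneg (hw0 _ i.2.le) hb0)
              zero_le_one
        _ = w i * 1 := one_mul _
  refine (gameExp_mono hε hf hpt).trans ?_
  rw [gameExp_add, gameExp_sum, gameExp_const_mul]
  refine add_le_add ?_ (mul_le_mul_of_nonneg_left hFE (hw0 _ i.2.le))
  have hFupd : ∀ (x : Coins m) (k : Fin m) y, (i : ℕ) + 1 ≤ (k : ℕ) →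
      F (Function.update x k y) = F x := by
    intro x k y hk
    have hki : i ≠ k := by rintro rfl; omega
    simp only [hF, Function.update_of_ne hki]
  have hstep : ∀ t ∈ T, gameExp ε f (fun ω => cf t * (stopProb B i ω * (F ω.1 *
      coinExp ε (blockSize m ((i : ℕ) + 1) t)
        fun c => roundBump m ε t (partialSum ω ((i : ℕ) + 1) + c)))) ≤
      gameExp ε f (fun ω => stopProb B i ω * (cf t * roundBump m ε t (partialSum ω t))) := by
    intro t ht
    obtain ⟨h1, h2, h3⟩ := hTmem t ht
    rw [gameExp_const_mul, ← gameExp_stopProb_mul hf B i h1 h3.le F hFupd, ← gameExp_const_mul]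
    refine gameExp_mono hε hf fun ω => ?_
    have hs0 := stopProb_nonneg B i ω
    have hb0 := roundBump_nonneg (ε := ε) h3.le (partialSum ω t)
    calc cf t * (stopProb B i ω * (F ω.1 * roundBump m ε t (partialSum ω t)))
        ≤ cf t * (stopProb B i ω * (1 * roundBump m ε t (partialSum ω t))) := by
          have := hcf0 t h3
          gcongr
          exact hF1 _
      _ = _ := by ring
  refine (Finset.sum_le_sum hstep).trans ?_
  rw [← gameExp_sum]
  refine gameExp_mono hε hf fun ω => ?_
  rw [← Finset.mul_sum]
  refine mul_le_mul_of_nonneg_left ?_ (stopProb_nonneg B i ω)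
  refine Finset.sum_le_sum_of_subset_of_nonneg ?_ fun t ht _ => ?_
  · intro t ht
    exact Finset.mem_range.mpr (hTmem t ht).2.2
  · have ht' := Finset.mem_range.mp ht
    exact mul_nonneg (hcf0 t ht') (roundBump_nonneg ht'.le _)

/-- Every stop is charged to the same sum of later bumps. At each outcome the stopping probabilities
add up to at most one, so this sum is paid at most once and its expectation is free of the player.
-/
theorem sum_stopProb_bump_le (hε : ε ∈ Set.Icc (-1 : ℝ) 1) (hf : f.IsProb) (B : Player m H)
    {w : ℕ → ℝ} (hw0 : ∀ t ≤ m, 0 ≤ w t) (hw : ∀ s t, s ≤ t → t < m → w s ≤ w t) (hL0 : 0 ≤ L)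
    (s : Finset (Fin m)) (hs : ∀ i ∈ s, (i : ℕ) + 2 ≤ m ∧ L ≤ (m : ℝ) - (i : ℕ)) :
    ∑ i ∈ s, gameExp ε f (fun ω => stopProb B i ω * (w i * roundBump m ε i (partialSum ω i))) ≤
      795 * ∑ t ∈ Finset.range m, w t / ((m : ℝ) - t) *
        coinExp ε (blockSize m 0 t) (roundBump m ε t) +
      ∑ i ∈ s, w i * (2 * Real.exp (-(2 * L))) := by
  refine (Finset.sum_le_sum fun i hi =>
    gameExp_stopProb_bump_le hε hf B hw0 hw hL0 (hs i hi).1 (hs i hi).2).trans ?_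
  rw [Finset.sum_add_distrib]
  refine add_le_add ?_ le_rfl
  rw [← gameExp_sum]
  have h1 : ∀ ω : Outcome m H, ∑ i ∈ s, stopProb B i ω * ∑ t ∈ Finset.range m,
        795 * (w t / ((m : ℝ) - t)) * roundBump m ε t (partialSum ω t) ≤
      ∑ t ∈ Finset.range m, 795 * (w t / ((m : ℝ) - t)) * roundBump m ε t (partialSum ω t) := by
    intro ω
    rw [← Finset.sum_mul]
    refine mul_le_of_le_one_left (Finset.sum_nonneg fun t ht => ?_) ?_
    · have ht' := Finset.mem_range.mp ht
      have : (t : ℝ) < m := by exact_mod_cast ht'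
      have h2 := div_nonneg (hw0 t (by omega)) (by linarith : 0 ≤ (m : ℝ) - t)
      exact mul_nonneg (by positivity) (roundBump_nonneg ht'.le _)
    · exact (Finset.sum_le_sum_of_subset_of_nonneg (Finset.subset_univ s)
        fun i _ _ => stopProb_nonneg B i ω).trans (sum_stopProb_le_one B ω)
  refine (gameExp_mono hε hf h1).trans (le_of_eq ?_)
  rw [gameExp_sum, Finset.mul_sum]
  refine Finset.sum_congr rfl fun t ht => ?_
  have h2 : gameExp ε f (fun ω => roundBump m ε t (partialSum ω t)) =
      coinExp ε (blockSize m 0 t) (roundBump m ε t) :=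
    (gameExp_coins hf (fun x => roundBump m ε t (coinSum x t))).trans
      (coinsExp_coinSum (Finset.mem_range.mp ht).le _)
  rw [gameExp_const_mul, h2, mul_assoc]

end Potential

/-! ### Mean bumps, undecided games and the summation over rounds -/

theorem sum_inv_sqrt_le (m : ℕ) :
    ∑ j ∈ Finset.range m, 1 / Real.sqrt ((j : ℝ) + 1) ≤ 2 * Real.sqrt m := by
  induction m with
  | zero => simp
  | succ m ih =>
    rw [Finset.sum_range_succ]
    push_cast
    have h0 : (0 : ℝ) ≤ m := Nat.cast_nonneg m
    have h1 : 0 < Real.sqrt ((m : ℝ) + 1) := Real.sqrt_pos.mpr (by linarith)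
    have h2 := Real.sq_sqrt h0
    have h3 := Real.sq_sqrt (by linarith : 0 ≤ (m : ℝ) + 1)
    have h4 : 1 / Real.sqrt ((m : ℝ) + 1) ≤ 2 * Real.sqrt ((m : ℝ) + 1) - 2 * Real.sqrt m := by
      rw [div_le_iff₀ h1]
      nlinarith [sq_nonneg (Real.sqrt ((m : ℝ) + 1) - Real.sqrt m)]
    linarith

theorem sum_indicator_le (m : ℕ) {X : ℝ} (hX : 0 ≤ X) :
    ∑ j ∈ Finset.range m, (if (j : ℝ) + 1 ≤ X then (1 : ℝ) else 0) ≤ X := by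
  rw [Finset.sum_ite, Finset.sum_const_zero, add_zero, Finset.sum_const, nsmul_one]
  have h1 : (Finset.range m).filter (fun j : ℕ => (j : ℝ) + 1 ≤ X) ⊆ Finset.range ⌊X⌋₊ := by
    intro j hj
    rw [Finset.mem_filter] at hj
    rw [Finset.mem_range]
    have : j + 1 ≤ ⌊X⌋₊ := Nat.le_floor (by exact_mod_cast hj.2)
    omega
  have h2 := Finset.card_le_card h1
  rw [Finset.card_range] at h2
  calc _ ≤ ((⌊X⌋₊ : ℕ) : ℝ) := by exact_mod_cast h2
    _ ≤ X := Nat.floor_le hX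

theorem sum_range_sub_eq (m : ℕ) (g : ℝ → ℝ) :
    ∑ t ∈ Finset.range m, g ((m : ℝ) - t) = ∑ j ∈ Finset.range m, g ((j : ℝ) + 1) := by
  rw [← Finset.sum_range_reflect (fun j : ℕ => g ((j : ℝ) + 1))]
  refine Finset.sum_congr rfl fun t ht => ?_
  have h := Finset.mem_range.mp ht
  have h1 : m - 1 - t + 1 + t = m := by omega
  have h2 : ((m - 1 - t : ℕ) : ℝ) + 1 + t = m := by exact_mod_cast h1
  congr 1
  linarith

section Spread

variable {m t : ℕ} {ε R : ℝ}

theorem coinExp_blockSize_lorentz_le (hε : |ε| ≤ 1 / 2) (ht : t < m) (h2 : 2 * ((m : ℝ) - t) ≤ m)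
    (hR : 1 ≤ R) (a : ℝ) :
    coinExp ε (blockSize m 0 t) (fun x => 1 / (1 + ((x : ℝ) + a) ^ 2 / R ^ 2)) ≤
      256 * (R / (m * Real.sqrt m)) := by
  have hm : (0 : ℝ) < m := by exact_mod_cast (by omega : 0 < m)
  have hN := cube_le_blockSize ht.le h2
  have hm3 : 0 < (m : ℝ) ^ 3 := by positivity
  have hN0 : 0 < blockSize m 0 t := by
    have : (0 : ℝ) < (blockSize m 0 t : ℕ) := by linarith
    exact_mod_cast this
  have hσ : 0 < m * Real.sqrt m := by positivity
  have hs : m * Real.sqrt m / 2 ≤ Real.sqrt (blockSize m 0 t : ℕ) := by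
    apply Real.le_sqrt_of_sq_le
    rw [div_pow, mul_sqrt_sq hm.le]
    linarith
  refine (coinExp_lorentz_le hε hN0 hR a).trans ?_
  calc 16 / Real.sqrt (blockSize m 0 t : ℕ) * (8 * R) ≤ 16 / (m * Real.sqrt m / 2) * (8 * R) := by
        gcongr
    _ = _ := by field_simp; ring

/-- In the second half of the game this is anticoncentration; in the first half the right-hand side
is at least one. -/
theorem coinExp_roundBump_le (hε : |ε| ≤ 1 / 2) (ht : t < m) :
    coinExp ε (blockSize m 0 t) (roundBump m ε t) ≤
      256 * (((m : ℝ) - t) * Real.sqrt ((m : ℝ) - t) / (m * Real.sqrt m)) := by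
  have hI : ε ∈ Set.Icc (-1 : ℝ) 1 := by
    obtain ⟨e1, e2⟩ := abs_le.mp hε
    exact ⟨by linarith, by linarith⟩
  have ht' : (t : ℝ) + 1 ≤ m := by exact_mod_cast ht
  have hm : (0 : ℝ) < m := by exact_mod_cast (by omega : 0 < m)
  have hn : 1 ≤ (m : ℝ) - t := by linarith
  rcases le_or_gt (2 * ((m : ℝ) - t)) m with h | h
  · refine le_trans (le_of_eq ?_) (coinExp_blockSize_lorentz_le hε ht h
      (R := ((m : ℝ) - t) * Real.sqrt ((m : ℝ) - t)) ?_ (ε * (remSize m (t + 1) : ℕ)))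
    · congr 1
      funext x
      exact bump_eq_lorentz (by linarith) _
    · have := Real.one_le_sqrt.mpr hn
      nlinarith
  · refine (coinExp_mono hI _ (h := fun _ => 1) fun x => roundBump_le_one ht.le x).trans ?_
    rw [coinExp_const, mul_div_assoc', le_div_iff₀ (by positivity), one_mul]
    have h1 : Real.sqrt m ≤ 2 * Real.sqrt ((m : ℝ) - t) := by
      rw [Real.sqrt_le_left (by positivity), mul_pow, Real.sq_sqrt (by linarith)]
      linarith
    have h2 : 0 ≤ Real.sqrt ((m : ℝ) - t) := Real.sqrt_nonneg _
    calc m * Real.sqrt m ≤ (2 * ((m : ℝ) - t)) * (2 * Real.sqrt ((m : ℝ) - t)) := by gcongr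
      _ ≤ 256 * (((m : ℝ) - t) * Real.sqrt ((m : ℝ) - t)) := by
        nlinarith [mul_nonneg (by linarith : 0 ≤ (m : ℝ) - t) h2]

end Spread

open scoped Classical in
/-- The event that the result of the game is still undecided in round `t + 1`. -/
noncomputable def nearIndicator (m : ℕ) (ε L : ℝ) (t : ℕ) (s : ℤ) : ℝ :=
  if |(s : ℝ) + ε * (remSize m (t + 1) : ℕ)| <
    8 * (((m : ℝ) - t) * Real.sqrt ((m : ℝ) - t)) * Real.sqrt L then 1 else 0

theorem nearIndicator_nonneg (m : ℕ) (ε L : ℝ) (t : ℕ) (s : ℤ) : 0 ≤ nearIndicator m ε L t s := by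
  unfold nearIndicator
  split_ifs <;> norm_num

/-- The indicator of a window of radius `R` is at most twice a Lorentzian of width `R`, and `n ≤ L`
gives `R ≤ 8 * L ^ 2`. -/
theorem coinExp_nearIndicator_le {m t : ℕ} {ε L : ℝ} (hε : |ε| ≤ 1 / 2) (ht : t < m)
    (h2 : 2 * ((m : ℝ) - t) ≤ m) (hL : 1 ≤ L) (hnL : (m : ℝ) - t ≤ L) :
    coinExp ε (blockSize m 0 t) (nearIndicator m ε L t) ≤
      4096 * (L ^ 2 / (m * Real.sqrt m)) := by
  have hI : ε ∈ Set.Icc (-1 : ℝ) 1 := by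
    obtain ⟨e1, e2⟩ := abs_le.mp hε
    exact ⟨by linarith, by linarith⟩
  have ht' : (t : ℝ) + 1 ≤ m := by exact_mod_cast ht
  have hn : 1 ≤ (m : ℝ) - t := by linarith
  have hn1 := Real.one_le_sqrt.mpr hn
  have hL1 := Real.one_le_sqrt.mpr hL
  set R := 8 * (((m : ℝ) - t) * Real.sqrt ((m : ℝ) - t)) * Real.sqrt L with hR
  have hnn : 1 ≤ ((m : ℝ) - t) * Real.sqrt ((m : ℝ) - t) := by nlinarith
  have hR1 : 1 ≤ R := by rw [hR]; nlinarith
  have hRL : R ≤ 8 * L ^ 2 := by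
    calc R ≤ 8 * (L * Real.sqrt L) * Real.sqrt L := by rw [hR]; gcongr
      _ = 8 * L * (Real.sqrt L ^ 2) := by ring
      _ = 8 * L ^ 2 := by rw [Real.sq_sqrt (by linarith)]; ring
  have h3 := coinExp_blockSize_lorentz_le hε ht h2 hR1 (ε * (remSize m (t + 1) : ℕ))
  have h4 : coinExp ε (blockSize m 0 t) (nearIndicator m ε L t) ≤
      coinExp ε (blockSize m 0 t) (fun x => 2 *
        (1 / (1 + ((x : ℝ) + ε * (remSize m (t + 1) : ℕ)) ^ 2 / R ^ 2))) := by
    refine coinExp_mono hI _ fun x => ?_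
    unfold nearIndicator
    split_ifs with h
    · rw [mul_one_div, le_div_iff₀ (by positivity), one_mul]
      have : ((x : ℝ) + ε * (remSize m (t + 1) : ℕ)) ^ 2 / R ^ 2 ≤ 1 := by
        rw [div_le_one (by positivity), ← sq_abs]
        gcongr
      linarith
    · positivity
  rw [coinExp_const_mul] at h4
  calc _ ≤ 2 * (256 * (R / (m * Real.sqrt m))) := by linarith
    _ ≤ 2 * (256 * (8 * L ^ 2 / (m * Real.sqrt m))) := by gcongr
    _ = _ := by ring

/-- The expected final sum has absolute value above m³ / 6. Being undecided needs a deviation that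
brings it within 8 m^(3/2) √L of zero, so at least 4 m^(3/2) √L once m^(3/2) ≥ 72 √L; here 72 = 6 ·
(8 + 4). -/
theorem coinExp_nearIndicator_le_of_biased {m t : ℕ} {ε L : ℝ} (hε : ε ∈ Set.Icc (-1 : ℝ) 1)
    (hε2 : 1 / 2 < |ε|) (ht : t < m) (hL : 0 ≤ L) (hLm : 72 ^ 2 * L ≤ m) :
    coinExp ε (blockSize m 0 t) (nearIndicator m ε L t) ≤ 2 * Real.exp (-(2 * L)) := by
  classical
  have ht' : (t : ℝ) + 1 ≤ m := by exact_mod_cast ht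
  have ht0 : (0 : ℝ) ≤ t := Nat.cast_nonneg t
  have hm : (1 : ℝ) ≤ m := by linarith
  have h1 := blockSize_add_remSize (m := m) (Nat.zero_le t) ht.le
  have h1' : ((remSize m (0 + 1) : ℕ) : ℝ) =
    (blockSize m 0 t : ℕ) + (remSize m (t + 1) : ℕ) := by exact_mod_cast h1.symm
  rw [zero_add] at h1'
  have h2 := remSize_le_cube (m := m) (t := 0) (Nat.zero_le _)
  simp only [Nat.cast_zero, sub_zero, zero_add] at h2
  have hR0 : (0 : ℝ) ≤ (remSize m (t + 1) : ℕ) := Nat.cast_nonneg _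
  set σ := m * Real.sqrt m with hσ
  have hσ2 : σ ^ 2 = (m : ℝ) ^ 3 := mul_sqrt_sq (by linarith)
  have hσ0 : 0 < σ := by positivity
  have hT := coinExp_abs_tail_le hε (blockSize m 0 t) (u := 4 * σ * Real.sqrt L)
    (s := (m : ℝ) ^ 3) (by positivity) (by positivity) (by linarith)
  have e : (4 * σ * Real.sqrt L) ^ 2 / (8 * (m : ℝ) ^ 3) = 2 * L := by
    rw [mul_pow, Real.sq_sqrt hL, mul_pow, hσ2]; field_simp; ring
  rw [e] at hT
  refine (coinExp_mono hε _ fun x => ?_).trans hT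
  unfold nearIndicator
  by_cases h : |(x : ℝ) + ε * (remSize m (t + 1) : ℕ)| <
    8 * (((m : ℝ) - t) * Real.sqrt ((m : ℝ) - t)) * Real.sqrt L
  · rw [if_pos h, if_pos]
    have h3 : |ε * (remSize m 1 : ℕ)| ≤ |(x : ℝ) + ε * (remSize m (t + 1) : ℕ)| +
        |(x : ℝ) - ε * (blockSize m 0 t : ℕ)| := by
      have : ε * (remSize m 1 : ℕ) = ((x : ℝ) + ε * (remSize m (t + 1) : ℕ)) -
        ((x : ℝ) - ε * (blockSize m 0 t : ℕ)) := by rw [h1']; ring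
      rw [this]
      exact abs_sub _ _
    have h4 : (m : ℝ) ^ 3 / 6 ≤ |ε * (remSize m 1 : ℕ)| := by
      have h5 := cube_le_remSize_one (m := m)
      rw [abs_mul, Nat.abs_cast]
      calc (m : ℝ) ^ 3 / 6 = 1 / 2 * ((m : ℝ) ^ 3 / 3) := by ring
        _ ≤ _ := by gcongr
    have h6 : ((m : ℝ) - t) * Real.sqrt ((m : ℝ) - t) ≤ σ := by
      rw [hσ]
      have : Real.sqrt ((m : ℝ) - t) ≤ Real.sqrt m := Real.sqrt_le_sqrt (by linarith)
      gcongr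
      linarith
    have hsL := Real.sqrt_nonneg L
    have h7 : 72 * Real.sqrt L ≤ σ := by
      have h8 : 72 * Real.sqrt L ≤ Real.sqrt m := by
        apply Real.le_sqrt_of_sq_le
        rw [mul_pow, Real.sq_sqrt hL]
        exact hLm
      have h9 : Real.sqrt m ≤ σ := le_mul_of_one_le_left (Real.sqrt_nonneg _) hm
      linarith
    have h10 : 8 * (((m : ℝ) - t) * Real.sqrt ((m : ℝ) - t)) * Real.sqrt L ≤
      8 * σ * Real.sqrt L := by gcongr
    have h11 : 72 * Real.sqrt L * σ ≤ (m : ℝ) ^ 3 := by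
      rw [← hσ2, sq]; gcongr
    nlinarith
  · rw [if_neg h]
    split_ifs <;> norm_num

section Weights

/-- The weight of the bump in a round with `n` rounds left. -/
noncomputable def bumpWeight (k X n : ℝ) : ℝ :=
  Real.sqrt k / n + if n ≤ X then 1 / Real.sqrt n else 0

variable {k X L : ℝ}

theorem bumpWeight_nonneg {n : ℝ} (hn : 0 ≤ n) : 0 ≤ bumpWeight k X n := by
  unfold bumpWeight
  split_ifs <;> positivity

theorem bumpWeight_antitone {n n' : ℝ} (hn : 0 < n) (hnn : n ≤ n') :
    bumpWeight k X n' ≤ bumpWeight k X n := by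
  unfold bumpWeight
  have h0 := Real.sqrt_pos.mpr hn
  have h1 := Real.sqrt_le_sqrt hnn
  have h2 : Real.sqrt k / n' ≤ Real.sqrt k / n := by gcongr
  have h3 : (if n' ≤ X then 1 / Real.sqrt n' else 0) ≤ if n ≤ X then 1 / Real.sqrt n else 0 := by
    split_ifs with h4 h5
    · gcongr
    · exact absurd (hnn.trans h4) h5
    · positivity
    · exact le_rfl
  linarith

theorem bumpWeight_le (hk : 1 ≤ k) {n : ℝ} (hn : 1 ≤ n) : bumpWeight k X n ≤ 2 * Real.sqrt k := by
  unfold bumpWeight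
  have h1 := Real.one_le_sqrt.mpr hk
  have h2 := Real.one_le_sqrt.mpr hn
  have h3 : Real.sqrt k / n ≤ Real.sqrt k := div_le_self (by linarith) hn
  have h4 : (if n ≤ X then 1 / Real.sqrt n else 0) ≤ 1 := by
    split_ifs
    · rw [div_le_one (by linarith)]; exact h2
    · norm_num
  linarith

/-- A round with `n` rounds left contributes √k n^(-1/2) m^(-3/2), and additionally m^(-3/2) if n ≤
k L³. The first part sums to 2 √k / m. The second is at most k L³ m^(-3/2), and k L³ ≤ √k √m is
where `k * L ^ 6 ≤ m` enters. -/
theorem sum_bumpWeight_le {m : ℕ} (hk : 0 ≤ k) (hL : 0 ≤ L) (hm : 0 < m) (hkL : k * L ^ 6 ≤ m) :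
    ∑ t ∈ Finset.range m, bumpWeight k (k * L ^ 3) ((m : ℝ) - t) / ((m : ℝ) - t) *
      (256 * (((m : ℝ) - t) * Real.sqrt ((m : ℝ) - t) / (m * Real.sqrt m))) ≤
      768 * (Real.sqrt k / m) := by
  have hm0 : (0 : ℝ) < m := by exact_mod_cast hm
  rw [sum_range_sub_eq m fun n => bumpWeight k (k * L ^ 3) n / n *
    (256 * (n * Real.sqrt n / (m * Real.sqrt m)))]
  have h1 : ∀ j ∈ Finset.range m, bumpWeight k (k * L ^ 3) ((j : ℝ) + 1) / ((j : ℝ) + 1) *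
      (256 * (((j : ℝ) + 1) * Real.sqrt ((j : ℝ) + 1) / (m * Real.sqrt m))) =
      256 / (m * Real.sqrt m) * (Real.sqrt k * (1 / Real.sqrt ((j : ℝ) + 1)) +
        if (j : ℝ) + 1 ≤ k * L ^ 3 then 1 else 0) := by
    intro j _
    have hj : (0 : ℝ) < (j : ℝ) + 1 := by positivity
    have hj2 := Real.sqrt_pos.mpr hj
    have hj3 := Real.sq_sqrt hj.le
    unfold bumpWeight
    have hsq : Real.sqrt k / ((j : ℝ) + 1) * Real.sqrt ((j : ℝ) + 1) =
        Real.sqrt k * (1 / Real.sqrt ((j : ℝ) + 1)) := by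
      conv_lhs => rw [← hj3]
      field_simp
      rw [hj3]
    rw [← hsq]
    split_ifs
    · field_simp
    · field_simp
      ring
  rw [Finset.sum_congr rfl h1, ← Finset.mul_sum, Finset.sum_add_distrib, ← Finset.mul_sum]
  have h2 := sum_inv_sqrt_le m
  have h3 := sum_indicator_le m (X := k * L ^ 3) (by positivity)
  have h4 : k * L ^ 3 ≤ Real.sqrt k * Real.sqrt m := by
    rw [← Real.sqrt_mul hk]
    apply Real.le_sqrt_of_sq_le
    calc (k * L ^ 3) ^ 2 = k * (k * L ^ 6) := by ring
      _ ≤ k * m := by gcongr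
  have hsk := Real.sqrt_nonneg k
  have hsm := Real.sqrt_pos.mpr hm0
  calc _ ≤ 256 / (m * Real.sqrt m) * (Real.sqrt k * (2 * Real.sqrt m) +
        Real.sqrt k * Real.sqrt m) := by gcongr; exact h3.trans h4
    _ = _ := by field_simp; ring

end Weights

theorem exp_neg_two_logb_le {m : ℝ} (hm : 1 ≤ m) :
    Real.exp (-(2 * Real.logb 2 m)) ≤ 1 / m ^ 2 := by
  have h0 : 0 < m := by linarith
  have h1 : Real.log m ≤ Real.logb 2 m := by
    rw [Real.logb, le_div_iff₀ (Real.log_pos (by norm_num))]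
    have h2 := Real.log_nonneg hm
    have h3 : Real.log 2 ≤ 1 := by linarith [Real.log_two_lt_d9]
    nlinarith
  calc Real.exp (-(2 * Real.logb 2 m)) ≤ Real.exp (-(2 * Real.log m)) := by
        apply Real.exp_le_exp.mpr; linarith
    _ = 1 / m ^ 2 := by
        rw [Real.exp_neg, two_mul, Real.exp_add, Real.exp_log h0, one_div, sq]

/-! ### The bias of the game with vector hint -/

section VectorHint

variable {m k : ℕ} {ε L : ℝ}

theorem one_le_remSize_one (hm : 1 ≤ m) : 1 ≤ remSize m 1 := by
  have h := cube_le_remSize_one (m := m)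
  have h1 : (1 : ℝ) ≤ m := by exact_mod_cast hm
  have h2 : 0 < (m : ℝ) ^ 3 := by positivity
  have h3 : (0 : ℝ) < (remSize m 1 : ℕ) := by linarith
  exact_mod_cast h3

theorem remSize_mono_one {t : ℕ} (ht : t ≤ m) : remSize m (t + 1) ≤ remSize m 1 := by
  have h := blockSize_add_remSize (m := m) (Nat.zero_le t) ht
  rw [zero_add] at h
  omega

theorem vectorHint_isProb (hε : ε ∈ Set.Icc (-1 : ℝ) 1) (hm : 1 ≤ m) (l : ℕ) :
    (vectorHint m ε l).IsProb where
  nonneg _ b c h := coinsProb_nonneg (hintBias_mem hε (one_le_remSize_one hm) (-b - c)) h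
  sum_eq _ _ _ := sum_coinsProb _

theorem hintAt_vectorHint (l : ℕ) (i : Fin m) (b : ℤ) : hintAt (vectorHint m ε l) i b =
    roundHint (remSize m ((i : ℕ) + 2)) (remSize m 1) l ε b := rfl

theorem remSize_succ_add {i : ℕ} (hi : i < m) :
    ((remSize m (i + 2) : ℕ) : ℝ) + (roundSize m (i + 1) : ℕ) = (remSize m (i + 1) : ℕ) := by
  have h2 := blockSize_add_remSize (m := m) (Nat.le_succ i) hi
  rw [blockSize_succ le_rfl, blockSize_self, zero_add] at h2
  rw [← h2]
  push_cast
  ring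

theorem remSize_add_two_le {i : ℕ} (hi : i < m) :
    ((remSize m (i + 2) : ℕ) : ℝ) ≤ ((m : ℝ) - i) ^ 3 := by
  have h1 := remSize_succ_add hi
  have h2 := remSize_le_cube hi.le
  have h3 : (0 : ℝ) ≤ (roundSize m (i + 1) : ℕ) := Nat.cast_nonneg _
  linarith

/-- The last round is excluded, as no coins follow it. -/
theorem le_remSize_add_two {i : ℕ} (hi : i + 2 ≤ m) :
    ((m : ℝ) - i) ^ 3 ≤ 24 * (remSize m (i + 2) : ℕ) := by
  have h1 := remSize_succ_add (by omega : i < m)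
  rw [remSize_cast (by omega : i ≤ m), roundSize_cast (by omega : i ≤ m)] at h1
  have hi' : (i : ℝ) + 2 ≤ m := by exact_mod_cast hi
  have h2 : 2 ≤ (m : ℝ) - i := by linarith
  generalize (m : ℝ) - i = n at *
  have h3 : 24 * ((remSize m (i + 2) : ℕ) : ℝ) = n ^ 3 + n * (7 * n ^ 2 - 12 * n + 4) := by
    linear_combination 24 * h1
  have h4 : 0 ≤ n * (7 * n ^ 2 - 12 * n + 4) := mul_nonneg (by linarith) (by nlinarith)
  linarith

theorem observationBound_near (hε : ε ∈ Set.Icc (-1 : ℝ) 1) (hL : 0 ≤ L) (l : ℕ) (i : Fin m)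
    (b : ℤ) :
    ObservationBound (coinsProb ε) (hintAt (vectorHint m ε l) i b) (valueAt ε i b)
      (nearIndicator m ε L i b) (9 * Real.exp (-(2 * L))) := by
  have hm : 1 ≤ m := by have := i.2; omega
  have hi : ((i : ℕ) : ℝ) + 1 ≤ m := by exact_mod_cast i.2
  rw [hintAt_vectorHint]
  unfold nearIndicator
  split_ifs with h
  · exact observationBound_trivial hε (one_le_remSize_one hm) (by positivity)
  · refine observationBound_of_far hε (one_le_remSize_one hm) (by linarith)
      (roundSize_cast i.2.le) (remSize_add_two_le i.2) hL ?_
    rw [remSize_succ_add i.2]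
    exact not_lt.mp h

theorem gameExp_stopProb_le {H : Type} [Fintype H] {f : HintFunction m H}
    (hε : ε ∈ Set.Icc (-1 : ℝ) 1) (hf : f.IsProb) (B : Player m H) (i : Fin m) {g : ℤ → ℝ}
    (hg : ∀ s, 0 ≤ g s) :
    gameExp ε f (fun ω => stopProb B i ω * g (partialSum ω i)) ≤
      coinExp ε (blockSize m 0 i) g := by
  refine (gameExp_mono hε hf (Ψ := fun ω => g (partialSum ω i)) fun ω =>
    mul_le_of_le_one_left (hg _) (stopProb_le_one B i ω)).trans_eq ?_
  exact (gameExp_coins hf fun x => g (coinSum x i)).trans (coinsExp_coinSum i.2.le g)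

theorem gameBias_le_of_playerBias_le {H : Type} [Fintype H] {f : HintFunction m H} {a : ℝ}
    (h : ∀ B, playerBias ε f B ≤ a) : gameBias ε f ≤ a := by
  have : Nonempty (Player m H) := ⟨fun _ _ => 0⟩
  exact ciSup_le h

theorem playerBias_le_one (hε : ε ∈ Set.Icc (-1 : ℝ) 1) (hm : 1 ≤ m) (l : ℕ)
    (B : Player m (Fin l → ℤˣ)) : playerBias ε (vectorHint m ε l) B ≤ 1 := by
  have hf := vectorHint_isProb hε hm l
  refine (playerBias_le hε hf B (fun _ _ => 1) (δ := 0) fun i b =>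
    observationBound_trivial hε (one_le_remSize_one hm) le_rfl).trans ?_
  simp only [mul_one, mul_zero, add_zero]
  rw [← gameExp_sum]
  exact (gameExp_mono hε hf fun ω => sum_stopProb_le_one B ω).trans_eq (gameExp_const hf 1)

theorem playerBias_le_of_biased (hε : ε ∈ Set.Icc (-1 : ℝ) 1) (hε2 : 1 / 2 < |ε|) (hm : 1 ≤ m)
    (hL : 0 ≤ L) (hLm : 72 ^ 2 * L ≤ m) (l : ℕ) (B : Player m (Fin l → ℤˣ)) :
    playerBias ε (vectorHint m ε l) B ≤ 11 * (m * Real.exp (-(2 * L))) := by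
  have hf := vectorHint_isProb hε hm l
  refine (playerBias_le hε hf B (fun i => nearIndicator m ε L i)
    fun i b => observationBound_near hε hL l i b).trans ?_
  have h1 : ∀ i ∈ (Finset.univ : Finset (Fin m)), gameExp ε (vectorHint m ε l) (fun ω =>
      stopProb B i ω * nearIndicator m ε L i (partialSum ω i)) ≤ 2 * Real.exp (-(2 * L)) :=
    fun i _ => (gameExp_stopProb_le hε hf B i (nearIndicator_nonneg m ε L i)).trans
      (coinExp_nearIndicator_le_of_biased hε hε2 i.2 hL hLm)
  have h2 := Finset.sum_le_card_nsmul _ _ _ h1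
  rw [nsmul_eq_mul, Finset.card_univ, Fintype.card_fin] at h2
  linarith

open scoped Classical in
/-- The bound for the effect of the vector hint in a round. -/
noncomputable def roundWeight (K : ℝ) (m k : ℕ) (ε L : ℝ) (t : ℕ) (b : ℤ) : ℝ :=
  if (m : ℝ) - t ≤ L then nearIndicator m ε L t b
  else K * Real.sqrt L * (bumpWeight k (k * L ^ 3) ((m : ℝ) - t) * roundBump m ε t b)

/-- The three regimes are joined: at most `L` rounds left, then up to `k * L ^ 3`, where the
oscillation bound supplies the second part of `bumpWeight`, and finally more, where the sensitivity
of the hint supplies the first. -/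
theorem exists_observationBound_roundWeight : ∃ K : ℝ, 0 < K ∧ ∀ (m k : ℕ) (ε L : ℝ),
    logThreshold ≤ L → 1 ≤ k → |ε| ≤ 1 / 2 → ∀ (i : Fin m) (b : ℤ),
    ObservationBound (coinsProb ε) (hintAt (vectorHint m ε (k * remSize m 1)) i b)
      (valueAt ε i b) (roundWeight K m k ε L i b) (9 * Real.exp (-(2 * L))) := by
  obtain ⟨K, hK0, hK⟩ := exists_observationBound_main
  refine ⟨K + 412800000, by positivity, fun m k ε L hL hk hε i b => ?_⟩
  have hI : ε ∈ Set.Icc (-1 : ℝ) 1 := by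
    obtain ⟨e1, e2⟩ := abs_le.mp hε
    exact ⟨by linarith, by linarith⟩
  have hL256 : (256 : ℝ) ≤ L := hL
  have hL0 : 0 ≤ L := by linarith
  unfold roundWeight
  split_ifs with hn
  · exact observationBound_near hI hL0 _ i b
  have hnL := not_le.mp hn
  have hm : 1 ≤ m := by have := i.2; omega
  have hi2 : (i : ℕ) + 2 ≤ m := by
    have : ((i : ℕ) : ℝ) + 2 ≤ m := by linarith
    exact_mod_cast this
  have hn0 : 0 < (m : ℝ) - (i : ℕ) := by linarith
  have hk1 : (1 : ℝ) ≤ k := by exact_mod_cast hk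
  have hsk := Real.sqrt_nonneg (k : ℝ)
  have hb0 := roundBump_nonneg (ε := ε) i.2.le b
  have hbump : bump ((m : ℝ) - (i : ℕ)) ((b : ℝ) + ε * ((remSize m ((i : ℕ) + 2) : ℕ) +
      (roundSize m ((i : ℕ) + 1) : ℕ))) = roundBump m ε i b := by
    rw [remSize_succ_add i.2]; rfl
  rw [hintAt_vectorHint]
  rcases le_or_gt ((m : ℝ) - (i : ℕ)) (k * L ^ 3) with h | h
  · have hmid := observationBound_mid (l := k * remSize m 1) (b := b) hε
      (one_le_remSize_one hm) (by linarith)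
      (roundSize_cast i.2.le) (remSize_add_two_le i.2) (le_remSize_add_two hi2) hL0 hnL.le
    rw [hbump] at hmid
    refine hmid.mono ?_
    unfold bumpWeight
    rw [if_pos h, mul_assoc _ (1 / _)]
    have h1 : 0 ≤ Real.sqrt k / ((m : ℝ) - (i : ℕ)) := by positivity
    gcongr
    · linarith
    · linarith
  · have hR : HintRegime (remSize m ((i : ℕ) + 2)) (remSize m 1) ((m : ℝ) - (i : ℕ)) L k :=
      ⟨hL, hk1, h.le, remSize_add_two_le i.2, le_remSize_add_two hi2,
        remSize_mono_one (by omega : (i : ℕ) + 1 ≤ m)⟩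
    have hmain := hK _ _ _ k ε _ L b hR hε (roundSize_cast i.2.le)
    rw [hbump] at hmain
    refine hmain.mono ?_
    unfold bumpWeight
    rw [if_neg (not_le.mpr h), add_zero, mul_assoc _ (_ / _)]
    gcongr
    linarith

/-- The last rounds are handled by a union bound, since they are few and rarely undecided; the
earlier ones by the potential argument, with 610560 = 795 · 768. -/
theorem playerBias_le_of_balanced {K : ℝ} (hK : 0 ≤ K) (hε : |ε| ≤ 1 / 2) (hL : logThreshold ≤ L)
    (hk : 1 ≤ k) (hkL : k * L ^ 6 ≤ m)
    (hW : ∀ (i : Fin m) (b : ℤ),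
      ObservationBound (coinsProb ε) (hintAt (vectorHint m ε (k * remSize m 1)) i b)
      (valueAt ε i b) (roundWeight K m k ε L i b) (9 * Real.exp (-(2 * L))))
    (B : Player m (Fin (k * remSize m 1) → ℤˣ)) :
    playerBias ε (vectorHint m ε (k * remSize m 1)) B ≤
      4096 / m + K * Real.sqrt L * (610560 * (Real.sqrt k / m) +
        4 * Real.sqrt k * (m * Real.exp (-(2 * L)))) + 9 * (m * Real.exp (-(2 * L))) := by
  classical
  have hI : ε ∈ Set.Icc (-1 : ℝ) 1 := by
    obtain ⟨e1, e2⟩ := abs_le.mp hε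
    exact ⟨by linarith, by linarith⟩
  have hL256 : (256 : ℝ) ≤ L := hL
  have hL0 : 0 ≤ L := by linarith
  have hk1 : (1 : ℝ) ≤ k := by exact_mod_cast hk
  have hL6 : L ^ 6 ≤ m := le_trans (le_mul_of_one_le_left (by positivity) hk1) hkL
  have hLL : L ≤ L ^ 6 := le_self_pow₀ (by linarith) (by norm_num)
  have h2L : 2 * L ≤ m := by
    have : 1 ≤ L ^ 4 := one_le_pow₀ (by linarith)
    nlinarith [mul_le_mul_of_nonneg_left this (by positivity : 0 ≤ L ^ 2)]
  have hm0 : (0 : ℝ) < m := by linarith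
  have hm : 1 ≤ m := by
    have : 0 < m := by exact_mod_cast hm0
    omega
  have hf := vectorHint_isProb hI hm (k * remSize m 1)
  set E := Real.exp (-(2 * L)) with hE
  have hE0 : 0 < E := Real.exp_pos _
  refine (playerBias_le hI hf B (fun i => roundWeight K m k ε L i) hW).trans ?_
  set w : ℕ → ℝ := fun t => bumpWeight k (k * L ^ 3) ((m : ℝ) - t) with hw
  set late : Finset (Fin m) := Finset.univ.filter fun i => (m : ℝ) - (i : ℕ) ≤ L with hlate
  set early : Finset (Fin m) := Finset.univ.filter fun i => ¬ (m : ℝ) - (i : ℕ) ≤ L with hearly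
  have hcast : ∀ i : Fin m, ((i : ℕ) : ℝ) + 1 ≤ m := fun i => by exact_mod_cast i.2
  have hlateSum : ∑ i ∈ late, gameExp ε (vectorHint m ε (k * remSize m 1)) (fun ω =>
      stopProb B i ω * roundWeight K m k ε L i (partialSum ω i)) ≤ 4096 / m := by
    have hone : ∀ i ∈ late, gameExp ε (vectorHint m ε (k * remSize m 1)) (fun ω =>
        stopProb B i ω * roundWeight K m k ε L i (partialSum ω i)) ≤
        4096 * (L ^ 2 / (m * Real.sqrt m)) := by
      intro i hi
      have hi' := (Finset.mem_filter.mp hi).2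
      have e : roundWeight K m k ε L i = nearIndicator m ε L i := by
        funext b
        exact if_pos hi'
      rw [e]
      exact (gameExp_stopProb_le hI hf B i (nearIndicator_nonneg m ε L i)).trans
        (coinExp_nearIndicator_le hε i.2 (by linarith) (by linarith) hi')
    have hcard : (late.card : ℝ) ≤ L := by
      have h1 : (late.card : ℝ) = ∑ t ∈ Finset.range m, if (m : ℝ) - t ≤ L then (1 : ℝ) else 0 := by
        rw [hlate, ← Fin.sum_univ_eq_sum_range (fun t : ℕ => if (m : ℝ) - t ≤ L then (1 : ℝ) else 0),
          Finset.sum_boole]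
      rw [h1, sum_range_sub_eq m fun n => if n ≤ L then (1 : ℝ) else 0]
      exact sum_indicator_le m hL0
    have h2 := Finset.sum_le_card_nsmul _ _ _ hone
    rw [nsmul_eq_mul] at h2
    refine h2.trans ?_
    have hsm : 0 < Real.sqrt m := Real.sqrt_pos.mpr hm0
    -- At most `L` late rounds, each undecided with probability of order L² m^(-3/2), contribute 1 /
    -- m in total.
    have h3 : L ^ 3 ≤ Real.sqrt m := by
      apply Real.le_sqrt_of_sq_le
      calc (L ^ 3) ^ 2 = L ^ 6 := by ring
        _ ≤ (m : ℝ) := hL6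
    calc (late.card : ℝ) * (4096 * (L ^ 2 / (m * Real.sqrt m)))
        ≤ L * (4096 * (L ^ 2 / (m * Real.sqrt m))) := by gcongr
      _ = 4096 * L ^ 3 / (m * Real.sqrt m) := by ring
      _ ≤ 4096 * Real.sqrt m / (m * Real.sqrt m) := by gcongr
      _ = 4096 / m := by field_simp
  have hearlySum : ∑ i ∈ early, gameExp ε (vectorHint m ε (k * remSize m 1)) (fun ω =>
      stopProb B i ω * roundWeight K m k ε L i (partialSum ω i)) ≤
      K * Real.sqrt L * (610560 * (Real.sqrt k / m) + 4 * Real.sqrt k * (m * E)) := by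
    have hone : ∀ i ∈ early, gameExp ε (vectorHint m ε (k * remSize m 1)) (fun ω =>
        stopProb B i ω * roundWeight K m k ε L i (partialSum ω i)) = K * Real.sqrt L *
        gameExp ε (vectorHint m ε (k * remSize m 1)) (fun ω =>
          stopProb B i ω * (w i * roundBump m ε i (partialSum ω i))) := by
      intro i hi
      have hi' := (Finset.mem_filter.mp hi).2
      rw [← gameExp_const_mul]
      congr 1
      funext ω
      unfold roundWeight
      rw [if_neg hi']
      ring
    rw [Finset.sum_congr rfl hone, ← Finset.mul_sum]
    have hw0 : ∀ t, t ≤ m → 0 ≤ w t := fun t ht => bumpWeight_nonneg (by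
      have : (t : ℝ) ≤ m := by exact_mod_cast ht
      linarith)
    refine mul_le_mul_of_nonneg_left ?_ (by positivity)
    have hpot := sum_stopProb_bump_le hI hf B (w := w) hw0
      (fun s t hst htm => bumpWeight_antitone (by
        have : (t : ℝ) < m := by exact_mod_cast htm
        linarith) (by
        have : (s : ℝ) ≤ t := by exact_mod_cast hst
        linarith)) hL0 early (fun i hi => by
        have hi' := not_le.mp (Finset.mem_filter.mp hi).2
        refine ⟨?_, hi'.le⟩
        have : ((i : ℕ) : ℝ) + 2 ≤ m := by linarith
        exact_mod_cast this)
    refine hpot.trans (add_le_add ?_ ?_)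
    · have h1 : ∑ t ∈ Finset.range m, w t / ((m : ℝ) - t) *
          coinExp ε (blockSize m 0 t) (roundBump m ε t) ≤ 768 * (Real.sqrt k / m) := by
        refine le_trans (Finset.sum_le_sum fun t ht => ?_)
          (sum_bumpWeight_le (k := k) (L := L) (by linarith) hL0 (by omega) hkL)
        have ht' := Finset.mem_range.mp ht
        have ht2 : (t : ℝ) < m := by exact_mod_cast ht'
        exact mul_le_mul_of_nonneg_left (coinExp_roundBump_le hε ht')
          (div_nonneg (hw0 t ht'.le) (by linarith))
      linarith
    · have h1 : ∀ i ∈ early, w i * (2 * E) ≤ 2 * Real.sqrt k * (2 * E) := fun i _ => by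
        have := bumpWeight_le (X := k * L ^ 3) hk1
          (by linarith [hcast i] : (1 : ℝ) ≤ (m : ℝ) - (i : ℕ))
        gcongr
      have h2 := Finset.sum_le_card_nsmul _ _ _ h1
      rw [nsmul_eq_mul] at h2
      refine h2.trans ?_
      have h3 : (early.card : ℝ) ≤ m := by
        have := Finset.card_le_univ early
        rw [Fintype.card_fin] at this
        exact_mod_cast this
      calc (early.card : ℝ) * (2 * Real.sqrt k * (2 * E)) ≤ m * (2 * Real.sqrt k * (2 * E)) := by
            gcongr
        _ = _ := by ring
  rw [← Finset.sum_filter_add_sum_filter_not Finset.univ (fun i : Fin m => (m : ℝ) - (i : ℕ) ≤ L)]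
  linarith

end VectorHint

theorem mainTheorem3 :
    ∃ K : ℝ, 0 < K ∧ ∀ (m k : ℕ) (ε : ℝ), 2 ≤ m → 1 ≤ k → k ≤ m → ε ∈ Set.Icc (-1 : ℝ) 1 →
      (k : ℝ) ≤ (m : ℝ) / Real.logb 2 (m : ℝ) ^ 6 →
      gameBias ε (vectorHint m ε (k * remSize m 1)) ≤
        K * (Real.sqrt (k : ℝ) / (m : ℝ) * Real.sqrt (Real.logb 2 (m : ℝ))) := by
  obtain ⟨K, hK0, hK⟩ := exists_observationBound_roundWeight
  -- The first term covers small `m`. Of the others, 4105 = 4096 + 9 collects late rounds and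
  -- exceptional hints, and 610564 = 610560 + 4 the potential argument with its atypical coins.
  refine ⟨2 ^ (256 : ℝ) + 4105 + 610564 * K, by positivity, fun m k ε hm hk _ hε hkm => ?_⟩
  set L := Real.logb 2 (m : ℝ) with hLdef
  have hm2 : (2 : ℝ) ≤ m := by exact_mod_cast hm
  have hm0 : (0 : ℝ) < m := by linarith
  have hk1 : (1 : ℝ) ≤ k := by exact_mod_cast hk
  have hL1 : 1 ≤ L := by
    rw [hLdef, Real.le_logb_iff_rpow_le (by norm_num) hm0, Real.rpow_one]
    exact hm2
  have hkL : (k : ℝ) * L ^ 6 ≤ m := (le_div_iff₀ (by positivity)).mp hkm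
  have hsk := Real.one_le_sqrt.mpr hk1
  have hsL := Real.one_le_sqrt.mpr hL1
  have hskL : 1 ≤ Real.sqrt k * Real.sqrt L := by nlinarith
  have hrate : Real.sqrt k / m * Real.sqrt L = Real.sqrt k * Real.sqrt L / m := by ring
  have hinv : 1 / (m : ℝ) ≤ Real.sqrt k / m * Real.sqrt L := by
    rw [hrate]; gcongr
  have hr0 : 0 ≤ Real.sqrt k / m * Real.sqrt L := by positivity
  have hpow : (0 : ℝ) < 2 ^ (256 : ℝ) := by positivity
  have hexp : m * Real.exp (-(2 * L)) ≤ 1 / m := by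
    have h := mul_le_mul_of_nonneg_left (exp_neg_two_logb_le (by linarith : (1 : ℝ) ≤ m)) hm0.le
    refine h.trans (le_of_eq ?_)
    field_simp
  refine gameBias_le_of_playerBias_le fun B => ?_
  -- Below the threshold `m < 2 ^ 256`, and the trivial bound 1 is a bounded multiple of `1 / m`.
  rcases lt_or_ge L 256 with hL | hL
  · refine (playerBias_le_one hε (by omega) _ B).trans ?_
    have hmle : (m : ℝ) ≤ 2 ^ (256 : ℝ) := by
      rw [← Real.logb_le_iff_le_rpow (by norm_num) hm0]
      exact hL.le
    calc (1 : ℝ) = m * (1 / m) := by field_simp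
      _ ≤ 2 ^ (256 : ℝ) * (Real.sqrt k / m * Real.sqrt L) := by gcongr
      _ ≤ _ := by
        refine mul_le_mul_of_nonneg_right ?_ hr0
        linarith
  have hL0 : 0 ≤ L := by linarith
  rcases le_or_gt |ε| (1 / 2) with hε2 | hε2
  · refine (playerBias_le_of_balanced hK0.le hε2 hL hk hkL (hK m k ε L hL hk hε2) B).trans ?_
    have h1 : 4096 / (m : ℝ) ≤ 4096 * (Real.sqrt k / m * Real.sqrt L) := by
      rw [← mul_one_div]; gcongr
    have h2 : 4 * Real.sqrt k * (m * Real.exp (-(2 * L))) ≤ 4 * (Real.sqrt k / m) := by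
      calc _ ≤ 4 * Real.sqrt k * (1 / m) := by gcongr
        _ = _ := by ring
    have h3 : K * Real.sqrt L * (610560 * (Real.sqrt k / m) +
        4 * Real.sqrt k * (m * Real.exp (-(2 * L)))) ≤
        610564 * K * (Real.sqrt k / m * Real.sqrt L) := by
      calc _ ≤ K * Real.sqrt L * (610560 * (Real.sqrt k / m) + 4 * (Real.sqrt k / m)) := by gcongr
        _ = _ := by ring
    have h4 := mul_nonneg hpow.le hr0
    linarith
  · have hLm : 72 ^ 2 * L ≤ m := by
      have h5 : (72 : ℝ) ^ 2 ≤ L ^ 5 := by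
        calc (72 : ℝ) ^ 2 ≤ 256 ^ 5 := by norm_num
          _ ≤ L ^ 5 := by gcongr
      calc 72 ^ 2 * L ≤ L ^ 5 * L := by gcongr
        _ = L ^ 6 := by ring
        _ ≤ k * L ^ 6 := le_mul_of_one_le_left (by positivity) hk1
        _ ≤ m := hkL
    refine (playerBias_le_of_biased hε hε2 (by omega) hL0 hLm _ B).trans ?_
    have h4 := mul_nonneg hpow.le hr0
    have h5 := mul_nonneg hK0.le hr0
    linarith
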